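/- Let $\mathcal V=\bigcup_{n\ge 0}\{1,2\}^n$, and for $v\in\mathcal V\setminus\{\varnothing\}$ let $\hat v$ be the parent of $v$ (its last letter is removed). A \emph{Yule-type tree} is a collection $\mathcal T=(z_v)_{v\in\mathcal V}$ of nonnegative reals with $z_{\hat v}<z_v$ for all $v\ne\varnothing$ and $z_{(v_1,\dots,v_n)}\to\infty$ for every $\mathbf v=(v_1,v_2,\dots)\in\{1,2\}^{\mathbb N}$. It is identified with the rooted metric tree $$(\{\varnothing\}\times[0,z_\varnothing])\cup\bigcup_{v\neq\varnothing}\{v\}\times(z_{\hat v},z_v],$$ with root $(\varnothing,0)$, in which $(v,r)$ has height $r$ and $(v,z_v)$ is the branching point from which the edges labelled $v1$ and $v2$ start. Geodesic rays from the root are identified with elements of $\{1,2\}^{\mathbb N}$: the ray $\mathbf v$ consists of the points on the edges labelled $(v_1,\dots,v_n)$, $n\ge0$. The set $\mathbb T$ of Yule-type trees carries the $\sigma$-field generated by the coordinates, and $\{1,2\}^{\mathbb N}$ the product $\sigma$-field. Let $\Theta$ be the law on $\mathbb T$ of the Yule tree $\Gamma$, for which $z_v$ is the sum of $V_u$ over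 all ancestors $u$ of $v$ ($v$ included), where $(V_u)_{u\in\mathcal V}$ are independent exponential variables of mean $1$. For $\mathcal T\in\mathbb T$, consider Brownian motion on $\mathcal T$ with drift $1/2$ towards infinity: the diffusion (up to its possibly finite lifetime) with generator $\frac12 f''+\frac12 f'$ on every edge, reflected at the root, which at a branching point chooses each of the three incident segments with equal probability; that is, the solution of the martingale problem for the functions $f$ with bounded support that are continuous on $\mathcal T$, of class $C^2$ on each edge up to its ends, have zero slope at the root, and at each branching point satisfy: the slope on the incoming edge equals the sum of the slopes on the two outgoing edges. (If $z_\varnothing=0$, the two outgoing slopes at the root add up to $0$.) The harmonic measure $\nu_{\mathcal T}$ is the law on $\{1,2\}^{\mathbb N}$ of the exit ray of this Brownian motion started from the root, i.e. of the unique ray that it visits at arbitrarily large times (arbitrarily close to the lifetime, if that is finite). If $z_\varnothing>0$, the conductance of $\mathcal T$ is $$\mathcal C(\mathcal T)=\lim_{\varepsilon\downarrow0}\varepsilon^{-1}P_{(\varnothing,\varepsilon)}(T_0=\infty),$$ where $T_0$ is the hitting time of the root by Brownian motion started from $(\varnothing,\varepsilon)$. Let $\gamma$ be the law of $\mathcal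 C(\Gamma)$, let $$\Theta^*(d\mathcal T\,d\mathbf v)=\Theta(d\mathcal T)\,\nu_{\mathcal T}(d\mathbf v),$$ a probability measure on $\mathbb T^*=\mathbb T\times\{1,2\}^{\mathbb N}$, and let $S:\mathbb T^*\to\mathbb T^*$ be the shift at the first branching point, $$S(\mathcal T,(v_1,v_2,\dots))=(\mathcal T_{(v_1)},(v_2,v_3,\dots)),\qquad \mathcal T_{(i)}=(z_{iv}-z_\varnothing)_{v\in\mathcal V}.$$ \textbf{Proposition.} For $r\ge1$ set $$\kappa(r)=\iint\gamma(ds)\,\gamma(dt)\,\frac{rs}{r+s+t-1}.$$ The objects above are well defined: for $\Theta$-almost every $\mathcal T$ the exit ray exists and is unique almost surely, and the limit defining $\mathcal C(\mathcal T)$ exists and is at least $1$; moreover, $\mathcal T\mapsto\mathcal C(\mathcal T)$ and $\mathcal T\mapsto\nu_{\mathcal T}$ are $\Theta$-measurable. The measure $\kappa(\mathcal C(\mathcal T))\cdot\Theta^*(d\mathcal T\,d\mathbf v)$ on $\mathbb T^*$ is finite and invariant under $S$. -/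

import Mathlib

open MeasureTheory ProbabilityTheory Filter Topology
open scoped NNReal ENNReal

noncomputable section

namespace YuleConductance

/-- Finite words over a two-letter alphabet; `v ++ [i]` is the `i`-th child of `v`, the letters
`0, 1 : Fin 2` standing for the first and the second child. -/
abbrev Vertex := List (Fin 2)

/-- Infinite words, which label the geodesic rays of a binary tree. -/
abbrev Ray := ℕ → Fin 2

instance : MeasurableSpace (List (Fin 2)) := ⊤

/-- `(u₁, …, uₙ)`. -/
def Ray.trunc (u : Ray) (n : ℕ) : Vertex := List.ofFn fun i : Fin n => u i

/-- The longest common prefix of two words. -/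
def meet : Vertex → Vertex → Vertex
  | a :: v, b :: w => if a = b then a :: meet v w else []
  | _, _ => []

/-! ### Yule-type trees -/

/-- The conditions on the heights `z v` of the branching points of a Yule-type tree. -/
structure IsYuleType (z : Vertex → ℝ) : Prop where
  nonneg : ∀ v, 0 ≤ z v
  lt_child : ∀ v i, z v < z (v ++ [i])
  tendsto : ∀ u : Ray, Tendsto (fun n => z (u.trunc n)) atTop atTop

/-- The space of Yule-type trees, with the σ-field generated by the coordinates. -/
abbrev YuleTree := {z : Vertex → ℝ // IsYuleType z}

/-- A point `(v, r)`: it lies on the edge labelled `v`, at height `r`. -/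
abbrev Pt := Vertex × ℝ

def rootPt : Pt := ([], 0)

namespace YuleTree

/-- The underlying set of the tree: the root edge `{∅} × [0, z ∅]` and, for `v ≠ ∅`, the edges
`{v} × (z (parent of v), z v]`. -/
def points (T : YuleTree) : Set Pt :=
  {x | x.2 ≤ T.1 x.1 ∧ ((x.1 = [] ∧ 0 ≤ x.2) ∨ (x.1 ≠ [] ∧ T.1 x.1.dropLast < x.2))}

/-- The tree distance (meaningful on `T.points`). -/
def treeDist (T : YuleTree) (x y : Pt) : ℝ :=
  if x.1 <+: y.1 ∨ y.1 <+: x.1 then |x.2 - y.2|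
  else (x.2 - T.1 (meet x.1 y.1)) + (y.2 - T.1 (meet x.1 y.1))

theorem le_cons (T : YuleTree) (i : Fin 2) (v : Vertex) : T.1 [] ≤ T.1 (i :: v) := by
  induction v using List.reverseRecOn with
  | nil => exact (T.2.lt_child [] i).le
  | append_singleton v j ih => exact ih.trans (T.2.lt_child (i :: v) j).le

/-- The subtree of the descendants of the first branching point in the direction `i`: the
collection `(z (iv) - z ∅)`. -/
def sub (T : YuleTree) (i : Fin 2) : YuleTree :=
  ⟨fun v => T.1 (i :: v) - T.1 [],
   { nonneg := fun v => sub_nonneg.2 (T.le_cons i v)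
     lt_child := fun v j => sub_lt_sub_right (T.2.lt_child (i :: v) j) _
     tendsto := fun u => by
       have h := (T.2.tendsto (fun n => Nat.casesOn n i u)).comp (tendsto_add_atTop_nat 1)
       refine (tendsto_atTop_add_const_right atTop (-(T.1 [])) h).congr fun n => ?_
       simp [Ray.trunc, List.ofFn_succ, sub_eq_add_neg] }⟩

end YuleTree

/-! ### The Yule tree -/

/-- The heights `Z v`: the sum of the lifetimes `V u` over the ancestors `u` of `v`, including
`v` itself. -/
def heightsOfLifetimes (V : Vertex → ℝ) : Vertex → ℝ := fun v => (v.inits.map V).sum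

/-- The law of the Yule tree on the space of Yule-type trees: the lifetimes are independent
exponential variables of mean `1`, and the law of the heights is regarded as a measure on the
subset of Yule-type collections, which has full measure. -/
def yuleLaw : Measure YuleTree :=
  ((Measure.infinitePi fun _ : Vertex => expMeasure 1).map heightsOfLifetimes).comap Subtype.val

/-! ### Brownian motion with drift `1/2` on a tree

A Yule-type tree may branch so fast that Brownian motion on it explodes in finite time, so paths
are allowed a lifetime: `none` is a cemetery point. For the Yule tree the lifetime is a.s.
infinite. -/

/-- States: points, or the cemetery `none`. -/
abbrev State := Option Pt

instance : MeasurableSpace (Option (List (Fin 2) × ℝ)) := MeasurableSpace.map some inferInstance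

/-- Continuous paths in `T` that may leave every bounded set at a finite lifetime, after which
they stay in the cemetery. -/
structure IsTreePath (T : YuleTree) (w : ℝ≥0 → State) : Prop where
  mem : ∀ t x, w t = some x → x ∈ T.points
  continuous : ∀ t x, w t = some x →
    ∀ ε > 0, ∀ᶠ s in 𝓝 t, ∃ y, w s = some y ∧ T.treeDist y x < ε
  absorbed : ∀ s t, s ≤ t → w s = none → w t = none
  explode : ∀ t, w t = none → (∀ s < t, w s ≠ none) →
    ∀ R : ℝ, ∀ᶠ s in 𝓝[<] t, ∀ x, w s = some x → R < x.2

/-- The path space, with the σ-field generated by the coordinates. -/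
def TreePath (T : YuleTree) := {w : ℝ≥0 → State // IsTreePath T w}

instance (T : YuleTree) : MeasurableSpace (TreePath T) :=
  ⨆ t : ℝ≥0, MeasurableSpace.comap (fun w => w.1 t) inferInstance

/-- The filtration generated by the coordinate process. -/
def canonicalFiltration (T : YuleTree) :
    Filtration ℝ≥0 (inferInstance : MeasurableSpace (TreePath T)) where
  seq t := ⨆ s : Set.Iic t, MeasurableSpace.comap (fun w => w.1 s) inferInstance
  mono' _ _ h := iSup_le fun s =>
    le_iSup_of_le (⟨s.1, s.2.trans h⟩ : Set.Iic _) le_rfl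
  le' _ := iSup_le fun s => le_iSup_of_le s.1 le_rfl

/-- Test functions for the generator of Brownian motion with drift `1/2` towards infinity:
`f v` is the function on the edge `v`, of class `C²` up to the ends of the edge. The functions match
continuously at the branching points, where the slopes satisfy the gluing condition that gives
equal probabilities to the three incident edges; the slope vanishes at the root (reflection), and
the support is bounded. When `z ∅ = 0` the conditions `reflect` and `glue` at `v = ∅` together say
that the two outgoing slopes at the root add up to zero. -/
structure TestFunction (T : YuleTree) where
  f : Vertex → ℝ → ℝ
  contDiff : ∀ v, ContDiff ℝ 2 (f v)
  matching : ∀ v i, f (v ++ [i]) (T.1 v) = f v (T.1 v)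
  glue : ∀ v, deriv (f v) (T.1 v) = ∑ i : Fin 2, deriv (f (v ++ [i])) (T.1 v)
  reflect : deriv (f []) 0 = 0
  support : ∃ R : ℝ, ∀ x ∈ T.points, R ≤ x.2 → f x.1 x.2 = 0

namespace TestFunction

variable {T : YuleTree}

/-- The value at a state, with value `0` at the cemetery. -/
def eval (φ : TestFunction T) : State → ℝ
  | some x => φ.f x.1 x.2
  | none => 0

/-- The generator `½ f'' + ½ f'` on every edge (extended by `0` to the cemetery). Its
values at the branching points play no role, the time spent there being of measure zero. -/
def gen (φ : TestFunction T) : State → ℝ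
  | some x => (1 / 2) * deriv (deriv (φ.f x.1)) x.2 + (1 / 2) * deriv (φ.f x.1) x.2
  | none => 0

end TestFunction

/-- `P` is the law of Brownian motion with drift `1/2` on `T` (reflected at the root) started from
`x`: it solves the martingale problem for the generator above. -/
structure IsBrownianLaw (T : YuleTree) (x : Pt) (P : Measure (TreePath T)) : Prop where
  prob : IsProbabilityMeasure P
  start : ∀ᵐ w ∂P, w.1 0 = some x
  martingale : ∀ φ : TestFunction T,
    Martingale (fun (t : ℝ≥0) (w : TreePath T) =>
      φ.eval (w.1 t) - ∫ s in (0 : ℝ)..t, φ.gen (w.1 s.toNNReal)) (canonicalFiltration T) P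

/-- A choice, for every Yule-type tree and every starting point of it, of the law of Brownian
motion with drift `1/2`. -/
def IsBrownianFamily (BM : ∀ T : YuleTree, Pt → Measure (TreePath T)) : Prop :=
  ∀ T, ∀ x ∈ T.points, IsBrownianLaw T x (BM T x)

/-! ### Exit ray, harmonic measure, conductance -/

/-- The point `x` lies on the geodesic ray `u`. -/
def OnRay (x : Pt) (u : Ray) : Prop := ∃ n, x.1 = u.trunc n

/-- The path visits the ray `u` at arbitrarily large times (arbitrarily close to its lifetime, if
the latter is finite). -/
def IsExitRay {T : YuleTree} (w : TreePath T) (u : Ray) : Prop :=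
  ∀ t, w.1 t ≠ none → ∃ s ≥ t, ∃ x, w.1 s = some x ∧ OnRay x u

/-- The exit ray of a path (an arbitrary ray if there is none). -/
def exitRay {T : YuleTree} (w : TreePath T) : Ray := Classical.epsilon (IsExitRay w)

variable (BM : ∀ T : YuleTree, Pt → Measure (TreePath T))

/-- The harmonic measure of `T`: the law of the exit ray of Brownian motion started from the
root. -/
def harmonicMeasure (T : YuleTree) : Measure Ray := (BM T rootPt).map exitRay

/-- `ε⁻¹ P(T₀ = ∞)`, where `T₀` is the hitting time of the root by Brownian motion started at
height `ε` on the root edge. -/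
def escapeRate (T : YuleTree) (ε : ℝ) : ℝ :=
  ε⁻¹ * (BM T ([], ε)).real {w | ∀ t > 0, w.1 t ≠ some rootPt}

/-- The conductance of `T` between the root and infinity. -/
def conductance (T : YuleTree) : ℝ := limUnder (𝓝[>] (0 : ℝ)) (escapeRate BM T)

/-- The law of the conductance of the Yule tree. -/
def conductanceLaw : Measure ℝ := yuleLaw.map (conductance BM)

/-- `κ(r) = ∬ γ(ds) γ(dt) r s / (r + s + t - 1)`, an integral of a nonnegative function, as `γ` is
carried by `[1, ∞)`. -/
def kappa (r : ℝ) : ℝ≥0∞ :=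
  ∫⁻ s, ∫⁻ t, ENNReal.ofReal (r * s / (r + s + t - 1)) ∂(conductanceLaw BM) ∂(conductanceLaw BM)

/-- The law of the pair (Yule tree, exit ray of Brownian motion on it):
`Θ*(dT dv) = Θ(dT) ν_T(dv)`. -/
def yuleRayLaw : Measure (YuleTree × Ray) :=
  yuleLaw.bind fun T => (harmonicMeasure BM T).map (Prod.mk T)

/-- The measure `κ(C(T)) · Θ*(dT dv)`. -/
def invariantMeasure : Measure (YuleTree × Ray) :=
  (yuleRayLaw BM).withDensity fun p => kappa BM (conductance BM p.1)

/-- The shift at the first branching point. -/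
def shift (p : YuleTree × Ray) : YuleTree × Ray := (p.1.sub (p.2 0), fun n => p.2 (n + 1))

end YuleConductance

end

noncomputable section

namespace YuleConductance

/-! ### Local structure of the tree and of its paths -/

namespace YuleTree

/-! Conductance and harmonic measure are computed by network reduction. The functions harmonic for
`½ f'' + ½ f'` on an edge are spanned by `1` and `exp (-r)`; in this scale an edge of length `z`
followed by a conductor `K` has conductance `serial z K`, and a single infinite ray has conductance
`1`. Cutting the tree after `n` generations and closing it with single rays gives an increasing
sequence, whose limit `cond` satisfies C(T) = serial(z, C(T₀) + C(T₁)). The exit ray should enter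
the subtree `i` with probability C(Tᵢ) / (C(T₀) + C(T₁)); iterating this gives `exitProb`.

Brownian motion is known only through its martingale problem, so each fact about it comes from an
explicit function, solved edge by edge and glued at the branching points (`glued_extend`), cut off
beyond a generation `N`, and stopped no later than the exit from the first `N` generations
(`Glued.integral_hitTime`). `timeFun` shows that finitely many generations are always left. The
superharmonic `superFun`, which vanishes at infinity, gives transience (`ae_transient`), hence a
unique exit ray. The harmonic functions `harm`, with indicator limits at infinity, give its law
(`exitRay_law`). Finally `escapeFun` shows that the root is avoided from height ε with probability
exactly C(T)(1 - exp(-ε)), which identifies the conductance with `cond` (`tendsto_escapeRate`).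

Under the Yule law the root edge V and the two subtrees are independent (`map_split_yuleLaw`).
Together with the one-step decomposition of the harmonic measure (`harmonicMeasure_eq`), this
reduces invariance to an equation for the density: κ(r) = 2 E[κ(serial(V, r + C)) r / (r + C)],
where the 2 counts the two subtrees. It holds because C has the law of serial(V, C + C'): this is
substituted for one variable in κ, the identity `serial_ratio` transfers the edge V to the side of
r, and κ is symmetrised in its two integration variables (`kap_eq`). The measure is finite because
rs / (r + s + t - 1) ≤ √r √s, and √C is integrable since C ≤ 1 / (1 - exp(-V)). -/

theorem mono_prefix (T : YuleTree) {v w : Vertex} (h : v <+: w) : T.1 v ≤ T.1 w := by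
  obtain ⟨s, rfl⟩ := h
  induction s using List.reverseRecOn with
  | nil => simp
  | append_singleton s i ih =>
    rw [← List.append_assoc]
    exact ih.trans (T.2.lt_child _ i).le

theorem prefix_dropLast {v w : Vertex} (h : v <+: w) (hne : v ≠ w) : v <+: w.dropLast := by
  obtain ⟨s, rfl⟩ := h
  have hs : s ≠ [] := by rintro rfl; simp at hne
  rw [List.dropLast_append_of_ne_nil hs]
  exact List.prefix_append _ _

theorem le_dropLast (T : YuleTree) {v w : Vertex} (h : v <+: w) (hne : v ≠ w) :
    T.1 v ≤ T.1 w.dropLast := T.mono_prefix (prefix_dropLast h hne)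

theorem meet_prefix_left : ∀ v w : Vertex, meet v w <+: v
  | [], w => by simp [meet]
  | a :: v, [] => by simp [meet]
  | a :: v, b :: w => by
    by_cases h : a = b
    · simp [meet, h, meet_prefix_left v w]
    · simp [meet, h]

theorem meet_prefix_right : ∀ v w : Vertex, meet v w <+: w
  | [], w => by simp [meet]
  | a :: v, [] => by simp [meet]
  | a :: v, b :: w => by
    by_cases h : a = b
    · simp [meet, h, meet_prefix_right v w]
    · simp [meet, h]

theorem lt_of_mem {T : YuleTree} {x : Pt} (hx : x ∈ T.points) (h : x.1 ≠ []) :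
    T.1 x.1.dropLast < x.2 := by
  rcases hx.2 with h' | h'
  · exact absurd h'.1 h
  · exact h'.2

theorem nonneg_of_mem {T : YuleTree} {x : Pt} (hx : x ∈ T.points) : 0 ≤ x.2 := by
  rcases hx.2 with h' | h'
  · exact h'.2
  · exact (T.2.nonneg _).trans h'.2.le

theorem lt_of_prefix_ne {T : YuleTree} {x : Pt} (hx : x ∈ T.points) {v : Vertex}
    (h : v <+: x.1) (hne : v ≠ x.1) : T.1 v < x.2 := by
  have h0 : x.1 ≠ [] := by
    intro h0; rw [h0] at h hne; exact hne (List.prefix_nil.1 h)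
  exact (T.le_dropLast h hne).trans_lt (lt_of_mem hx h0)

/-- `y` lies on the same edge as `x`, or `x` is a branching point from which the edge of `y`
starts. -/
def Near (T : YuleTree) (x y : Pt) : Prop :=
  y.1 = x.1 ∨ (x.2 = T.1 x.1 ∧ ∃ i, y.1 = x.1 ++ [i])

/-- The radius is at most the distance from `x` down to the lower end of its edge, and up to its
upper end, or to the ends of the outgoing edges if `x` is a branching point. No other branching
point can then intervene, and the tree distance is a difference of heights. -/
theorem exists_near (T : YuleTree) {x : Pt} (hx : x ∈ T.points) :
    ∃ δ > 0, ∀ y ∈ T.points, T.treeDist y x < δ →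
      T.Near x y ∧ |y.2 - x.2| = T.treeDist y x := by
  obtain ⟨δ₁, h₁, h₁'⟩ : ∃ δ₁ > 0, x.1 ≠ [] → δ₁ ≤ x.2 - T.1 x.1.dropLast := by
    by_cases h : x.1 = []
    · exact ⟨1, one_pos, fun h' => absurd h h'⟩
    · exact ⟨x.2 - T.1 x.1.dropLast, sub_pos.2 (lt_of_mem hx h), fun _ => le_rfl⟩
  obtain ⟨δ₂, h₂, h₂', h₂''⟩ : ∃ δ₂ > 0, (x.2 < T.1 x.1 → δ₂ ≤ T.1 x.1 - x.2) ∧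
      (x.2 = T.1 x.1 → ∀ i, δ₂ ≤ T.1 (x.1 ++ [i]) - x.2) := by
    rcases hx.1.lt_or_eq with h | h
    · exact ⟨_, sub_pos.2 h, fun _ => le_rfl, fun h' => absurd h' h.ne⟩
    · refine ⟨min (T.1 (x.1 ++ [0]) - x.2) (T.1 (x.1 ++ [1]) - x.2), ?_, fun h' => absurd h h'.ne,
        fun _ i => ?_⟩
      · rw [h]
        exact lt_min (sub_pos.2 (T.2.lt_child _ _)) (sub_pos.2 (T.2.lt_child _ _))
      · fin_cases i
        · exact min_le_left _ _
        · exact min_le_right _ _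
  refine ⟨min δ₁ δ₂, lt_min h₁ h₂, fun y hy hd => ?_⟩
  have hd₁ := hd.trans_le (min_le_left _ _)
  have hd₂ := hd.trans_le (min_le_right _ _)
  by_cases hc : y.1 <+: x.1 ∨ x.1 <+: y.1
  · have hdist : T.treeDist y x = |y.2 - x.2| := if_pos hc
    refine ⟨?_, hdist.symm⟩
    rw [hdist] at hd₁ hd₂
    by_cases he : y.1 = x.1
    · exact Or.inl he
    rcases hc with hc | hc
    · exfalso
      have h0 : x.1 ≠ [] := by
        intro h0; rw [h0] at hc he; exact he (List.prefix_nil.1 hc)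
      have h3 := h₁' h0
      have h4 := T.le_dropLast hc he
      have h5 := hy.1
      have := neg_abs_le (y.2 - x.2)
      linarith
    · right
      have h6 := le_abs_self (y.2 - x.2)
      have h7 : T.1 x.1 < y.2 := lt_of_prefix_ne hy hc (Ne.symm he)
      have hxe : x.2 = T.1 x.1 := by
        by_contra hne
        have := h₂' (lt_of_le_of_ne hx.1 hne)
        linarith
      refine ⟨hxe, ?_⟩
      obtain ⟨s, hs⟩ := hc
      rcases s with _ | ⟨i, s⟩
      · simp at hs; exact absurd hs.symm he
      refine ⟨i, ?_⟩
      by_contra hne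
      have hp : x.1 ++ [i] <+: y.1 := ⟨s, by rw [← hs]; simp⟩
      have := lt_of_prefix_ne hy hp (Ne.symm hne)
      have := h₂'' hxe i
      linarith
  -- For incomparable labels the geodesic goes down to `meet`, which is no higher than the lower end
  -- of the edge of `x`; its length exceeds `δ₁`.
  · exfalso
    have hdist : T.treeDist y x = (y.2 - T.1 (meet y.1 x.1)) + (x.2 - T.1 (meet y.1 x.1)) :=
      if_neg hc
    rw [hdist] at hd₁
    have hl := meet_prefix_left y.1 x.1
    have hr := meet_prefix_right y.1 x.1
    have hnl : meet y.1 x.1 ≠ y.1 := fun h => hc (Or.inl (h ▸ hr))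
    have hnr : meet y.1 x.1 ≠ x.1 := fun h => hc (Or.inr (h ▸ hl))
    have h0 : x.1 ≠ [] := by
      intro h0; rw [h0] at hr hnr; exact hnr (List.prefix_nil.1 hr)
    have := lt_of_prefix_ne hy hl hnl
    have := T.le_dropLast hr hnr
    have := h₁' h0
    linarith

end YuleTree

open YuleTree

/-- The state is a point on an edge of generation at most `N`. -/
def InGen (N : ℕ) (a : State) : Prop := ∃ x, a = some x ∧ x.1.length ≤ N

/-- The state is a point beyond, or on, the edge `v`. -/
def Beyond (v : Vertex) (a : State) : Prop := ∃ x, a = some x ∧ v <+: x.1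

theorem InGen.mono {N M : ℕ} (h : N ≤ M) {a : State} (ha : InGen N a) : InGen M a := by
  obtain ⟨x, hx, hl⟩ := ha
  exact ⟨x, hx, hl.trans h⟩

namespace TreePath

variable {T : YuleTree} (w : TreePath T)

theorem mem {t : ℝ≥0} {x : Pt} (h : w.1 t = some x) : x ∈ T.points := w.2.mem t x h

theorem alive_of_le {s t : ℝ≥0} (h : s ≤ t) (ht : w.1 t ≠ none) : w.1 s ≠ none :=
  fun hs => ht (w.2.absorbed s t h hs)

theorem eventually_near {t : ℝ≥0} {x : Pt} (h : w.1 t = some x) {ε : ℝ} (hε : 0 < ε) :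
    ∀ᶠ s in 𝓝 t, ∃ y, w.1 s = some y ∧ T.Near x y ∧ |y.2 - x.2| < ε := by
  obtain ⟨δ, hδ, hn⟩ := T.exists_near (w.mem h)
  filter_upwards [w.2.continuous t x h (min ε δ) (lt_min hε hδ)] with s hs
  obtain ⟨y, hy, hd⟩ := hs
  have h2 := hn y (w.mem hy) (hd.trans_le (min_le_right _ _))
  exact ⟨y, hy, h2.1, h2.2 ▸ hd.trans_le (min_le_left _ _)⟩

theorem eventually_near' {t : ℝ≥0} {x : Pt} (h : w.1 t = some x) :
    ∀ᶠ s in 𝓝 t, ∃ y, w.1 s = some y ∧ T.Near x y := by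
  filter_upwards [w.eventually_near h one_pos] with s hs
  obtain ⟨y, hy, hd, -⟩ := hs
  exact ⟨y, hy, hd⟩

theorem isOpen_alive : IsOpen {t | w.1 t ≠ none} := by
  refine isOpen_iff_mem_nhds.2 fun t ht => ?_
  obtain ⟨x, hx⟩ := Option.ne_none_iff_exists'.1 ht
  filter_upwards [w.eventually_near' hx] with s hs
  obtain ⟨y, hy, -⟩ := hs
  simp [hy]

/-- Edges are open at their lower end, so the neighbours of a point beyond `v` are again beyond `v`.
-/
theorem isOpen_beyond (v : Vertex) : IsOpen {t | Beyond v (w.1 t)} := by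
  refine isOpen_iff_mem_nhds.2 fun t ht => ?_
  obtain ⟨x, hx, hv⟩ := ht
  filter_upwards [w.eventually_near' hx] with s hs
  obtain ⟨y, hy, hn⟩ := hs
  refine ⟨y, hy, ?_⟩
  rcases hn with h | ⟨-, i, h⟩
  · rwa [h]
  · rw [h]; exact hv.trans (List.prefix_append _ _)

/-- Being past generation `N` is open for the same reason. In the cemetery, absorption settles the
times to the right, which is all that optional times require. -/
theorem eventually_not_inGen {N : ℕ} {t : ℝ≥0} (h : ¬ InGen N (w.1 t)) :
    ∀ᶠ s in 𝓝[≥] t, ¬ InGen N (w.1 s) := by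
  rcases ht : w.1 t with _ | x
  · filter_upwards [self_mem_nhdsWithin] with s hs
    rw [w.2.absorbed t s hs ht]
    rintro ⟨x, hx, -⟩
    cases hx
  · filter_upwards [mem_nhdsWithin_of_mem_nhds (w.eventually_near' ht)] with s hs
    obtain ⟨y, hy, hn⟩ := hs
    rintro ⟨y', hy', hl⟩
    rw [hy] at hy'
    cases hy'
    refine h ⟨x, ht, ?_⟩
    rcases hn with h | ⟨-, i, h⟩
    · rwa [← h]
    · rw [h] at hl; simp at hl; omega

theorem exists_inGen {t : ℝ≥0} (ht : w.1 t ≠ none) : ∃ M, ∀ s ≤ t, InGen M (w.1 s) := by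
  have key : ∃ M, ∀ s ∈ Set.Icc 0 t, InGen M (w.1 s) := by
    refine isCompact_Icc.induction_on (p := fun S => ∃ M, ∀ s ∈ S, InGen M (w.1 s))
      ⟨0, by simp⟩ (fun s u hsu ⟨M, hM⟩ => ⟨M, fun r hr => hM r (hsu hr)⟩) ?_ ?_
    · rintro s u ⟨M, hM⟩ ⟨M', hM'⟩
      refine ⟨max M M', fun r hr => ?_⟩
      rcases hr with hr | hr
      · exact (hM r hr).mono (le_max_left _ _)
      · exact (hM' r hr).mono (le_max_right _ _)
    · intro s hs
      obtain ⟨x, hx⟩ := Option.ne_none_iff_exists'.1 (w.alive_of_le hs.2 ht)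
      refine ⟨{r | ∃ y, w.1 r = some y ∧ T.Near x y},
        mem_nhdsWithin_of_mem_nhds (w.eventually_near' hx), x.1.length + 1, ?_⟩
      rintro r ⟨y, hy, hn⟩
      refine ⟨y, hy, ?_⟩
      rcases hn with h | ⟨-, i, h⟩ <;> simp [h]
  obtain ⟨M, hM⟩ := key
  exact ⟨M, fun s hs => hM s ⟨zero_le, hs⟩⟩

/-- Connectedness of the time interval: being beyond `v ++ [i]`, and being alive neither there nor
at the branching point, are disjoint open conditions, so the path cannot pass from one to the other
without visiting the branching point. -/
theorem exists_crossing {v : Vertex} {i : Fin 2} {s t : ℝ≥0} (hs' : w.1 s ≠ none)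
    (hs : ¬ Beyond (v ++ [i]) (w.1 s)) (ht : Beyond (v ++ [i]) (w.1 t)) :
    ∃ r ∈ Set.uIcc s t, w.1 r = some (v, T.1 v) := by
  by_contra! hcon
  have hal : w.1 t ≠ none := by obtain ⟨x, hx, -⟩ := ht; simp [hx]
  set U := {r | Beyond (v ++ [i]) (w.1 r)}
  set V := {r | ∃ x, w.1 r = some x ∧ ¬ v ++ [i] <+: x.1 ∧ x ≠ (v, T.1 v)}
  have hV : IsOpen V := by
    refine isOpen_iff_mem_nhds.2 fun r hr => ?_
    obtain ⟨x, hx, hp, hne⟩ := hr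
    obtain ⟨ε, hε, hd⟩ : ∃ ε > 0, T.1 v ≠ x.2 → ε ≤ |T.1 v - x.2| := by
      by_cases hx1 : T.1 v = x.2
      · exact ⟨1, one_pos, fun h => absurd hx1 h⟩
      · exact ⟨|T.1 v - x.2|, abs_pos.2 (sub_ne_zero.2 hx1), fun _ => le_rfl⟩
    filter_upwards [w.eventually_near hx hε] with q hq
    obtain ⟨y, hy, hn, hyd⟩ := hq
    have hy2 : y = (v, T.1 v) → T.1 v = x.2 := by
      rintro rfl
      by_contra h
      exact absurd hyd (not_lt.2 (hd h))
    rcases hn with h | ⟨h2, j, h⟩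
    · refine ⟨y, hy, by rwa [h], fun h' => hne (Prod.ext ?_ (hy2 h').symm)⟩
      rw [← h, h']
    · refine ⟨y, hy, ?_, fun h' => ?_⟩
      · intro h3
        rw [h] at h3
        rcases List.prefix_concat_iff.1 h3 with h4 | h4
        · have h5 := List.append_inj' h4 rfl
          exact hne (Prod.ext h5.1.symm (by rw [h2, h5.1]))
        · exact hp h4
      · have h3 := hy2 h'
        have h4 : v = x.1 ++ [j] := by rw [← h, h']
        have := T.2.lt_child x.1 j
        rw [← h4] at this
        linarith
  have halive : ∀ r ∈ Set.uIcc s t, w.1 r ≠ none := by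
    intro r hr
    rcases le_total s t with h | h
    · exact w.alive_of_le (hr.2.trans_eq (max_eq_right h)) hal
    · exact w.alive_of_le (hr.2.trans_eq (max_eq_left h)) hs'
  have hsub : Set.uIcc s t ⊆ U ∪ V := by
    intro r hr
    obtain ⟨x, hx⟩ := Option.ne_none_iff_exists'.1 (halive r hr)
    by_cases hb : v ++ [i] <+: x.1
    · exact Or.inl ⟨x, hx, hb⟩
    · exact Or.inr ⟨x, hx, hb, fun h => hcon r hr (h ▸ hx)⟩
  have hsV : s ∈ V := by
    rcases hsub Set.left_mem_uIcc with h | h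
    · exact absurd h hs
    · exact h
  obtain ⟨r, -, hrU, hrV⟩ := isPreconnected_uIcc U V (w.isOpen_beyond _) hV hsub
    ⟨t, Set.right_mem_uIcc, ht⟩ ⟨s, Set.left_mem_uIcc, hsV⟩
  obtain ⟨x, hx, hb⟩ := hrU
  obtain ⟨y, hy, hb', -⟩ := hrV
  rw [hx] at hy
  cases hy
  exact hb' hb

/-! ### Measurability and continuity in time -/

theorem measurable_some_state : Measurable (some : Pt → State) := fun _ h => h

theorem measurableSet_state {S : Set State} : MeasurableSet S ↔ MeasurableSet (some ⁻¹' S : Set Pt) :=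
  Iff.rfl

theorem measurable_of_state {β : Type*} [MeasurableSpace β] {f : State → β}
    (h : Measurable fun x : Pt => f (some x)) : Measurable f := fun _ hs => h hs

theorem measurableSet_inGen (N : ℕ) : MeasurableSet {a : State | InGen N a} := by
  have : MeasurableSet ((Prod.fst : Pt → Vertex) ⁻¹' {u | u.length ≤ N}) := measurable_fst trivial
  refine measurableSet_state.2 ?_
  convert this using 1
  ext ⟨v', r⟩
  simp [InGen]

/-- Needed to integrate the generator along a path. The label is `v` when the path is beyond `v` and
beyond no child of `v`, a difference of open sets of times. -/
theorem measurable_time : Measurable w.1 := by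
  have h1 : MeasurableSet {t | w.1 t ≠ none} := w.isOpen_alive.measurableSet
  have h2 : Measurable fun t => ((w.1 t).map Prod.fst).getD [] := by
    refine measurable_to_countable' fun v => ?_
    have hA : MeasurableSet {t | Beyond v (w.1 t) ∧ ∀ i, ¬ Beyond (v ++ [i]) (w.1 t)} := by
      refine (w.isOpen_beyond v).measurableSet.inter ?_
      have : {t | ∀ i, ¬ Beyond (v ++ [i]) (w.1 t)} = ⋂ i, {t | Beyond (v ++ [i]) (w.1 t)}ᶜ := by
        ext; simp
      change MeasurableSet {t | ∀ i, ¬ Beyond (v ++ [i]) (w.1 t)}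
      rw [this]
      exact MeasurableSet.iInter fun i => (w.isOpen_beyond _).measurableSet.compl
    have : (fun t => ((w.1 t).map Prod.fst).getD []) ⁻¹' {v} =
        {t | Beyond v (w.1 t) ∧ ∀ i, ¬ Beyond (v ++ [i]) (w.1 t)} ∪
          ({t | w.1 t ≠ none}ᶜ ∩ {_t | v = []}) := by
      ext t
      rcases ht : w.1 t with _ | x
      · simp [Beyond, ht, eq_comm]
      · simp only [Set.mem_preimage, ht, Option.map_some, Option.getD_some, Set.mem_singleton_iff,
          Beyond, Set.mem_union, Set.mem_ofPred_eq, Option.some.injEq, exists_eq_left', ne_eq,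
          Set.mem_inter_iff, Set.mem_compl_iff, reduceCtorEq, not_false_eq_true, not_true,
          false_and, or_false]
        constructor
        · rintro rfl
          refine ⟨List.prefix_rfl, fun i h => ?_⟩
          have := h.length_le
          simp at this
        · rintro ⟨⟨s, hs⟩, h⟩
          rcases s with _ | ⟨i, s⟩
          · simpa using hs.symm
          · exact absurd ⟨s, by rw [← hs]; simp⟩ (h i)
    rw [this]
    exact hA.union (h1.compl.inter (MeasurableSet.const _))
  have h3 : Measurable fun t => ((w.1 t).map Prod.snd).getD 0 := by
    refine measurable_of_Ioi fun a => ?_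
    have hO : IsOpen {t | ∃ x, w.1 t = some x ∧ a < x.2} := by
      refine isOpen_iff_mem_nhds.2 fun t ⟨x, hx, ha⟩ => ?_
      filter_upwards [w.eventually_near hx (sub_pos.2 ha)] with s hs
      obtain ⟨y, hy, -, hd⟩ := hs
      refine ⟨y, hy, ?_⟩
      have := neg_abs_le (y.2 - x.2)
      linarith
    have : (fun t => ((w.1 t).map Prod.snd).getD 0) ⁻¹' Set.Ioi a =
        {t | ∃ x, w.1 t = some x ∧ a < x.2} ∪ ({t | w.1 t ≠ none}ᶜ ∩ {_t | a < 0}) := by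
      ext t
      rcases ht : w.1 t with _ | ⟨v', r⟩ <;> simp [ht]
    rw [this]
    exact hO.measurableSet.union (h1.compl.inter (MeasurableSet.const _))
  have h4 : w.1 = fun t => if w.1 t ≠ none then
      some (((w.1 t).map Prod.fst).getD [], ((w.1 t).map Prod.snd).getD 0) else none := by
    funext t
    rcases ht : w.1 t with _ | x <;> simp
  rw [h4]
  exact Measurable.ite h1 (measurable_some_state.comp (h2.prodMk h3)) measurable_const

/-- The function on the states given by a function on every edge, with value `0` at the
cemetery. -/
def _root_.YuleConductance.edgeEval (F : Vertex → ℝ → ℝ) : State → ℝ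
  | some x => F x.1 x.2
  | none => 0

theorem continuousAt_edgeEval {F : Vertex → ℝ → ℝ} (hF : ∀ v, Continuous (F v))
    {t : ℝ≥0} {x : Pt} (hx : w.1 t = some x)
    (hm : ∀ i, F (x.1 ++ [i]) (T.1 x.1) = F x.1 (T.1 x.1)) :
    ContinuousAt (fun s => edgeEval F (w.1 s)) t := by
  rw [Metric.continuousAt_iff']
  intro ε hε
  have h0 := Metric.continuousAt_iff.1 ((hF x.1).continuousAt (x := x.2)) ε hε
  obtain ⟨δ, hδ, h0⟩ := h0
  have h1 : ∀ i, ∃ δ > 0, ∀ r, dist r x.2 < δ →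
      dist (F (x.1 ++ [i]) r) (F (x.1 ++ [i]) x.2) < ε := fun i =>
    Metric.continuousAt_iff.1 ((hF (x.1 ++ [i])).continuousAt (x := x.2)) ε hε
  choose d hd h1 using h1
  have hpos : 0 < min δ (min (d 0) (d 1)) := lt_min hδ (lt_min (hd 0) (hd 1))
  filter_upwards [w.eventually_near hx hpos] with s hs
  obtain ⟨y, hy, hn, hyd⟩ := hs
  rw [hy, hx]
  simp only [edgeEval]
  rcases hn with h | ⟨h2, i, h⟩
  · rw [h]
    exact h0 (by rw [Real.dist_eq]; exact hyd.trans_le (min_le_left _ _))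
  · rw [h, h2, ← hm i, ← h2]
    refine h1 i _ ?_
    rw [Real.dist_eq]
    refine hyd.trans_le ((min_le_right _ _).trans ?_)
    fin_cases i
    · exact min_le_left _ _
    · exact min_le_right _ _

theorem continuousWithinAt_edgeEval {F : Vertex → ℝ → ℝ} (hF : ∀ v, Continuous (F v))
    (hm : ∀ v i, F (v ++ [i]) (T.1 v) = F v (T.1 v)) (t : ℝ≥0) :
    ContinuousWithinAt (fun s => edgeEval F (w.1 s)) (Set.Ici t) t := by
  rcases ht : w.1 t with _ | x
  · refine (continuousWithinAt_const (b := edgeEval F (w.1 t))).congr (fun s hs => ?_) rfl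
    rw [w.2.absorbed t s hs ht, ht]
  · exact (w.continuousAt_edgeEval hF ht (hm x.1)).continuousWithinAt

/-! ### First exits -/

/-- A path that has remained in finitely many edges is still alive. -/
theorem alive_of_forall_lt {N : ℕ} {t : ℝ≥0} (h0 : w.1 0 ≠ none)
    (h : ∀ s < t, InGen N (w.1 s)) : w.1 t ≠ none := by
  intro ht
  have hpos : 0 < t := by
    rcases eq_or_lt_of_le (zero_le (a := t)) with h | h
    · rw [← h] at ht; exact absurd ht h0
    · exact h
  have hfin : {v : Vertex | v.length ≤ N}.Finite := List.finite_length_le _ _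
  obtain ⟨R, hR⟩ := (hfin.image T.1).bddAbove
  have := w.2.explode t ht (fun s hs => by obtain ⟨x, hx, -⟩ := h s hs; simp [hx]) R
  have hne : (𝓝[<] t).NeBot := nhdsLT_neBot_of_exists_lt ⟨0, hpos⟩
  obtain ⟨s, hs, hst⟩ := (this.and self_mem_nhdsWithin).exists
  obtain ⟨x, hx, hl⟩ := h s hst
  have h1 := hs x hx
  have h2 := (w.mem hx).1
  have h3 := hR ⟨x.1, hl, rfl⟩
  linarith

/-- A later generation is reached arbitrarily close to `t` only from the upper end of an edge of
generation exactly `N`. -/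
theorem eq_branching_of_frequently {N : ℕ} {t : ℝ≥0} (ht : InGen N (w.1 t))
    (hf : ∃ᶠ s in 𝓝 t, ¬ InGen N (w.1 s)) :
    ∃ v : Vertex, v.length = N ∧ w.1 t = some (v, T.1 v) := by
  obtain ⟨x, hx, hl⟩ := ht
  obtain ⟨s, hs, y, hy, hn⟩ := (hf.and_eventually (w.eventually_near' hx)).exists
  have hy' : N < y.1.length := by
    by_contra h
    exact hs ⟨y, hy, by omega⟩
  rcases hn with h | ⟨h2, i, h⟩
  · rw [h] at hy'; omega
  · rw [h] at hy'
    simp at hy'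
    refine ⟨x.1, by omega, ?_⟩
    rw [hx, ← h2]

end TreePath

/-! ### Optional stopping in continuous time -/

section OptionalStopping

variable {Ω : Type*} {m0 : MeasurableSpace Ω} {P : Measure Ω} {ℱ : Filtration ℝ≥0 m0}
  {M : ℝ≥0 → Ω → ℝ} {t : ℝ≥0} {τ : Ω → ℝ≥0}

theorem measurableSet_lt_min (hle : ∀ w, τ w ≤ t)
    (hτ : ∀ s, MeasurableSet[ℱ s] {w | τ w < s}) (s : ℝ≥0) :
    MeasurableSet[ℱ (min s t)] {w | τ w < s} := by
  rcases le_or_gt s t with h | h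
  · rw [min_eq_left h]; exact hτ s
  · have : {w | τ w < s} = Set.univ := Set.eq_univ_of_forall fun w => (hle w).trans_lt h
    rw [this]
    exact MeasurableSet.univ

/-- The time `τ` is replaced by the next grid time strictly above it. The added `1` matters: that
the floor equals `j` is decided by whether `τ` is less than consecutive grid times, hence is known
at the new time, although `τ` is only optional. The martingale property is then applied on finitely
many events. -/
theorem integral_discretization [IsFiniteMeasure P] (hM : Martingale M ℱ P)
    (hle : ∀ w, τ w ≤ t) (hτ : ∀ s, MeasurableSet[ℱ s] {w | τ w < s}) (n : ℕ) :
    AEStronglyMeasurable (fun w => M (min ((⌊(n + 1) * τ w⌋₊ + 1) / (n + 1)) t) w) P ∧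
    ∫ w, M (min ((⌊(n + 1) * τ w⌋₊ + 1) / (n + 1)) t) w ∂P = ∫ w, M t w ∂P := by
  set s : ℕ → ℝ≥0 := fun j => min (((j : ℝ≥0) + 1) / (n + 1)) t with hs
  set A : ℕ → Set Ω := fun j => {w | ⌊((n : ℝ≥0) + 1) * τ w⌋₊ = j} with hA
  have hnpos : (0 : ℝ≥0) < n + 1 := by positivity
  have hAe : ∀ j, A j = {w | τ w < ((j : ℝ≥0) + 1) / (n + 1)} \ {w | τ w < (j : ℝ≥0) / (n + 1)} := by
    intro j
    ext w
    simp only [hA, Set.mem_ofPred_eq, Set.mem_sdiff, not_lt]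
    rw [Nat.floor_eq_iff zero_le, lt_div_iff₀ hnpos, div_le_iff₀ hnpos, mul_comm, and_comm]
  have hAm : ∀ j, MeasurableSet[ℱ (s j)] (A j) := by
    intro j
    rw [hAe]
    refine (measurableSet_lt_min hle hτ _).diff ?_
    refine ℱ.mono ?_ _ (measurableSet_lt_min hle hτ _)
    exact min_le_min_right _ (by gcongr; exact le_self_add)
  have hAm' : ∀ j, MeasurableSet (A j) := fun j => ℱ.le _ _ (hAm j)
  set K := ⌊((n : ℝ≥0) + 1) * t⌋₊ + 1 with hK
  have hsum : ∀ (f : ℕ → Ω → ℝ) (w : Ω), f ⌊((n : ℝ≥0) + 1) * τ w⌋₊ w =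
      ∑ j ∈ Finset.range K, (A j).indicator (f j) w := by
    intro f w
    rw [Finset.sum_eq_single ⌊((n : ℝ≥0) + 1) * τ w⌋₊]
    · rw [Set.indicator_of_mem]; exact rfl
    · intro j _ hj
      rw [Set.indicator_of_notMem]
      exact fun h => hj h.symm
    · intro h
      exfalso
      apply h
      rw [Finset.mem_range, hK, Nat.lt_succ_iff]
      exact Nat.floor_le_floor (by gcongr; exact hle w)
  have h1 : (fun w => M (min ((⌊((n : ℝ≥0) + 1) * τ w⌋₊ + 1) / (n + 1)) t) w) =
      fun w => ∑ j ∈ Finset.range K, (A j).indicator (M (s j)) w := by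
    funext w
    exact hsum (fun j => M (s j)) w
  have h2 : M t = fun w => ∑ j ∈ Finset.range K, (A j).indicator (M t) w := by
    funext w
    exact hsum (fun _ => M t) w
  have hint : ∀ r j, Integrable ((A j).indicator (M r)) P :=
    fun r j => (hM.integrable r).indicator (hAm' j)
  rw [h1]
  refine ⟨(integrable_finsetSum _ fun j _ => hint _ j).1, ?_⟩
  conv_rhs => rw [h2]
  rw [integral_finsetSum _ fun j _ => hint _ j, integral_finsetSum _ fun j _ => hint _ j]
  refine Finset.sum_congr rfl fun j _ => ?_
  rw [integral_indicator (hAm' j), integral_indicator (hAm' j)]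
  exact hM.setIntegral_eq (min_le_right _ _) (hAm j)

/-- The grid times converge to `τ` from the right, so right continuity of the paths and the bound
`B` allow dominated convergence. The filtration itself need not be right continuous. -/
theorem integral_optional_stopping [IsFiniteMeasure P] (hM : Martingale M ℱ P)
    (hle : ∀ w, τ w ≤ t) (hτ : ∀ s, MeasurableSet[ℱ s] {w | τ w < s})
    (hc : ∀ w s, ContinuousWithinAt (fun r => M r w) (Set.Ici s) s)
    {B : ℝ} (hB : ∀ w, ∀ s ≤ t, |M s w| ≤ B) :
    Integrable (fun w => M (τ w) w) P ∧ ∫ w, M (τ w) w ∂P = ∫ w, M 0 w ∂P := by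
  set σ : ℕ → Ω → ℝ≥0 := fun n w => min ((⌊((n : ℝ≥0) + 1) * τ w⌋₊ + 1) / (n + 1)) t with hσ
  have hge : ∀ n w, τ w ≤ σ n w := by
    intro n w
    have hnpos : (0 : ℝ≥0) < n + 1 := by positivity
    refine le_min ?_ (hle w)
    rw [le_div_iff₀ hnpos, mul_comm]
    exact (Nat.lt_floor_add_one _).le
  have hup : ∀ n w, σ n w ≤ τ w + 1 / (n + 1) := by
    intro n w
    have hnpos : (0 : ℝ≥0) < n + 1 := by positivity
    refine (min_le_left _ _).trans ?_
    rw [div_le_iff₀ hnpos, add_mul (τ w), div_mul_cancel₀ _ hnpos.ne', mul_comm (τ w)]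
    gcongr
    exact Nat.floor_le zero_le
  have hlim : ∀ w, Tendsto (fun n => σ n w) atTop (𝓝 (τ w)) := by
    intro w
    have h0 : Tendsto (fun n : ℕ => τ w + 1 / ((n : ℝ≥0) + 1)) atTop (𝓝 (τ w + 0)) :=
      tendsto_const_nhds.add tendsto_one_div_add_atTop_nhds_zero_nat
    rw [add_zero] at h0
    exact tendsto_of_tendsto_of_tendsto_of_le_of_le tendsto_const_nhds h0
      (fun n => hge n w) (fun n => hup n w)
  have hlimM : ∀ w, Tendsto (fun n => M (σ n w) w) atTop (𝓝 (M (τ w) w)) := by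
    intro w
    have : Tendsto (fun n => σ n w) atTop (𝓝[≥] (τ w)) :=
      tendsto_nhdsWithin_iff.2 ⟨hlim w, Eventually.of_forall fun n => hge n w⟩
    exact (hc w (τ w)).tendsto.comp this
  have hd := fun n => integral_discretization hM hle hτ n
  have hmeas : AEStronglyMeasurable (fun w => M (τ w) w) P :=
    aestronglyMeasurable_of_tendsto_ae atTop (fun n => (hd n).1) (ae_of_all _ hlimM)
  refine ⟨Integrable.of_bound hmeas B (ae_of_all _ fun w => hB w _ (hle w)), ?_⟩
  have h1 : Tendsto (fun n => ∫ w, M (σ n w) w ∂P) atTop (𝓝 (∫ w, M (τ w) w ∂P)) :=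
    tendsto_integral_of_dominated_convergence (fun _ => B) (fun n => (hd n).1)
      (integrable_const B) (fun n => ae_of_all _ fun w => hB w _ (min_le_right _ _))
      (ae_of_all _ hlimM)
  have h2 : (fun n => ∫ w, M (σ n w) w ∂P) = fun _ => ∫ w, M 0 w ∂P := by
    funext n
    rw [(hd n).2, ← setIntegral_univ, ← setIntegral_univ (μ := P) (f := M 0)]
    exact (hM.setIntegral_eq zero_le MeasurableSet.univ).symm
  rw [h2] at h1
  exact tendsto_nhds_unique h1 tendsto_const_nhds

end OptionalStopping

/-! ### First times at which a condition holds -/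

/-- The rational times. -/
def ratTime (q : ℚ) : ℝ≥0 := Real.toNNReal q

/-- A property that lasts for a while after `r` is seen at a rational time; this is how conditions
over all times become countable. -/
theorem exists_ratTime {p : ℝ≥0 → Prop} {r s : ℝ≥0} (h : ∀ᶠ u in 𝓝[≥] r, p u) (hrs : r < s) :
    ∃ q, r < ratTime q ∧ ratTime q < s ∧ p (ratTime q) := by
  obtain ⟨u, hu, hsub⟩ := (mem_nhdsGE_iff_exists_Ico_subset' hrs).1 h
  obtain ⟨q, -, h1, h2⟩ := (NNReal.lt_iff_exists_rat_btwn r (min u s)).1 (lt_min hu hrs)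
  exact ⟨q, h1, h2.trans_le (min_le_right _ _), hsub ⟨h1.le, h2.trans_le (min_le_left _ _)⟩⟩

/-- The first time, at most `t`, at which the condition `Q` holds. -/
def firstTime (t : ℝ≥0) (Q : ℝ≥0 → Prop) : ℝ≥0 := sInf ({s | Q s} ∪ {t})

section FirstTime

variable {t : ℝ≥0} {Q : ℝ≥0 → Prop}

theorem firstTime_le : firstTime t Q ≤ t := csInf_le' (Or.inr rfl)

theorem firstTime_le_of {s : ℝ≥0} (h : Q s) : firstTime t Q ≤ s := csInf_le' (Or.inl h)

theorem not_of_lt_firstTime {s : ℝ≥0} (h : s < firstTime t Q) : ¬ Q s :=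
  fun hs => absurd (firstTime_le_of hs) (not_le.2 h)

theorem firstTime_lt_iff {s : ℝ≥0} : firstTime t Q < s ↔ (∃ r < s, Q r) ∨ t < s := by
  rw [firstTime, csInf_lt_iff (OrderBot.bddBelow _) ⟨t, Or.inr rfl⟩]
  constructor
  · rintro ⟨r, hr | hr, hrs⟩
    · exact Or.inl ⟨r, hrs, hr⟩
    · rw [Set.mem_singleton_iff] at hr
      exact Or.inr (hr ▸ hrs)
  · rintro (⟨r, hrs, hr⟩ | h)
    · exact ⟨r, Or.inl hr, hrs⟩
    · exact ⟨t, Or.inr rfl, h⟩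

theorem frequently_of_firstTime_lt (h : firstTime t Q < t) :
    ∃ᶠ s in 𝓝[≥] (firstTime t Q), Q s := by
  have h1 : IsGLB ({s | Q s} ∪ {t}) (firstTime t Q) := isGLB_csInf ⟨t, Or.inr rfl⟩ (OrderBot.bddBelow _)
  have h2 := h1.frequently_mem ⟨t, Or.inr rfl⟩
  have h3 : ∀ᶠ s in 𝓝[≥] (firstTime t Q), s < t := mem_nhdsWithin_of_mem_nhds (Iio_mem_nhds h)
  refine (h2.and_eventually h3).mono fun s hs => ?_
  rcases hs.1 with h | h
  · exact h
  · exact absurd hs.2 (by rw [Set.mem_singleton_iff.1 h]; exact lt_irrefl _)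

/-- If the condition, once it has occurred, lasts for some time, the first time is optional. -/
theorem measurableSet_firstTime_lt {Ω : Type*} {m0 : MeasurableSpace Ω} {ℱ : Filtration ℝ≥0 m0}
    {Q : Ω → ℝ≥0 → Prop} (hQ : ∀ w r, Q w r → ∀ᶠ s in 𝓝[≥] r, Q w s)
    (hm : ∀ s, MeasurableSet[ℱ s] {w | Q w s}) (s : ℝ≥0) :
    MeasurableSet[ℱ s] {w | firstTime t (Q w) < s} := by
  have : {w | firstTime t (Q w) < s} =
      (⋃ q : {q : ℚ // ratTime q < s}, {w | Q w (ratTime q)}) ∪ {_w | t < s} := by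
    ext w
    simp only [Set.mem_ofPred_eq, firstTime_lt_iff, Set.mem_union, Set.mem_iUnion]
    refine or_congr_left ⟨?_, ?_⟩
    · rintro ⟨r, hrs, hr⟩
      obtain ⟨q, -, h2, h3⟩ := exists_ratTime (hQ w r hr) hrs
      exact ⟨⟨q, h2⟩, h3⟩
    · rintro ⟨q, hq⟩
      exact ⟨_, q.2, hq⟩
  rw [this]
  exact (MeasurableSet.iUnion fun q => ℱ.mono q.2.le _ (hm _)).union (MeasurableSet.const _)

end FirstTime

/-! ### Optional stopping for Brownian motion on a tree -/

theorem measurable_edgeEval {F : Vertex → ℝ → ℝ} (hF : ∀ v, Measurable (F v)) :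
    Measurable (edgeEval F) := by
  refine TreePath.measurable_of_state ?_
  exact measurable_from_prod_countable_right hF

theorem measurable_coord {T : YuleTree} (t : ℝ≥0) :
    Measurable[canonicalFiltration T t] fun w : TreePath T => w.1 t := by
  refine measurable_iff_comap_le.2 ?_
  exact le_iSup (fun s : Set.Iic t =>
    MeasurableSpace.comap (fun w : TreePath T => w.1 s) inferInstance) ⟨t, Set.mem_Iic.2 le_rfl⟩

theorem measurable_coord' {T : YuleTree} (t : ℝ≥0) :
    Measurable fun w : TreePath T => w.1 t :=
  (measurable_coord t).mono ((canonicalFiltration T).le t) le_rfl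

namespace TestFunction

variable {T : YuleTree} (φ : TestFunction T)

theorem eval_eq (a : State) : φ.eval a = edgeEval φ.f a := by cases a <;> rfl

theorem gen_eq (a : State) : φ.gen a = edgeEval (fun v r =>
    (1 / 2) * deriv (deriv (φ.f v)) r + (1 / 2) * deriv (φ.f v) r) a := by cases a <;> rfl

theorem continuous_genEdge (v : Vertex) : Continuous fun r =>
    (1 / 2) * deriv (deriv (φ.f v)) r + (1 / 2) * deriv (φ.f v) r := by
  have h1 : ContDiff ℝ 1 (deriv (φ.f v)) := by
    have := (φ.contDiff v)
    exact ((contDiff_succ_iff_deriv (n := 1)).1 (by simpa [one_add_one_eq_two] using this)).2.2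
  have h2 := h1.continuous_deriv le_rfl
  have h3 := h1.continuous
  fun_prop

theorem measurable_gen : Measurable φ.gen := by
  have : φ.gen = edgeEval _ := funext φ.gen_eq
  rw [this]
  exact measurable_edgeEval fun v => (φ.continuous_genEdge v).measurable

/-- A common bound for the function and its image under the generator. -/
def IsBound (B : ℝ) : Prop := ∀ x ∈ T.points, |φ.eval (some x)| ≤ B ∧ |φ.gen (some x)| ≤ B

variable {φ} {B : ℝ}

theorem IsBound.eval_le (hB : φ.IsBound B) (w : TreePath T) (t : ℝ≥0) :
    |φ.eval (w.1 t)| ≤ B ∧ |φ.gen (w.1 t)| ≤ B := by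
  rcases ht : w.1 t with _ | x
  · have h : (([], 0) : Pt) ∈ T.points := ⟨T.2.nonneg _, Or.inl ⟨rfl, le_rfl⟩⟩
    have := (abs_nonneg _).trans (hB _ h).1
    simpa [eval, gen] using this
  · exact hB x (w.mem ht)

theorem IsBound.intervalIntegrable (hB : φ.IsBound B) (w : TreePath T) (a b : ℝ) :
    IntervalIntegrable (fun s => φ.gen (w.1 s.toNNReal)) volume a b := by
  have hm : Measurable fun s : ℝ => φ.gen (w.1 s.toNNReal) :=
    φ.measurable_gen.comp (w.measurable_time.comp measurable_real_toNNReal)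
  rw [intervalIntegrable_iff]
  refine Measure.integrableOn_of_bounded (M := B) ?_ hm.aestronglyMeasurable
    (ae_of_all _ fun s => (hB.eval_le w _).2)
  exact measure_Ioc_lt_top.ne

theorem IsBound.optional_stopping (hB : φ.IsBound B) {x : Pt} {P : Measure (TreePath T)}
    (hP : IsBrownianLaw T x P) (t : ℝ≥0) {Q : TreePath T → ℝ≥0 → Prop}
    (hQ : ∀ w r, Q w r → ∀ᶠ s in 𝓝[≥] r, Q w s)
    (hm : ∀ s, MeasurableSet[canonicalFiltration T s] {w | Q w s}) :
    Integrable (fun w => φ.eval (w.1 (firstTime t (Q w))) -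
      ∫ s in (0 : ℝ)..firstTime t (Q w), φ.gen (w.1 s.toNNReal)) P ∧
    ∫ w, (φ.eval (w.1 (firstTime t (Q w))) -
      ∫ s in (0 : ℝ)..firstTime t (Q w), φ.gen (w.1 s.toNNReal)) ∂P = φ.f x.1 x.2 := by
  have := hP.prob
  have h := integral_optional_stopping (t := t) (τ := fun w => firstTime t (Q w))
    (hP.martingale φ) (fun w => firstTime_le) (measurableSet_firstTime_lt hQ hm)
    -- Up to time `t` the function contributes at most `B` and the integral of the generator at most
    -- `B * t`.
    (B := B + B * t) ?_ ?_
  · refine ⟨h.1, h.2.trans ?_⟩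
    have h0 : (fun w : TreePath T => φ.eval (w.1 0) -
        ∫ s in (0 : ℝ)..(0 : ℝ≥0), φ.gen (w.1 s.toNNReal)) =ᵐ[P] fun _ => φ.f x.1 x.2 := by
      filter_upwards [hP.start] with w hw
      simp [hw, eval]
    rw [integral_congr_ae h0]
    simp
  · intro w s
    refine ContinuousWithinAt.sub ?_ ?_
    · simp only [eval_eq]
      exact w.continuousWithinAt_edgeEval (fun v => (φ.contDiff v).continuous) φ.matching s
    · have hc : Continuous fun b : ℝ => ∫ s in (0 : ℝ)..b, φ.gen (w.1 s.toNNReal) :=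
        intervalIntegral.continuous_primitive (fun a b => hB.intervalIntegrable w a b) 0
      exact (hc.comp NNReal.continuous_coe).continuousWithinAt
  · intro w s hs
    have h1 := (hB.eval_le w s).1
    have h2 : |∫ s in (0 : ℝ)..s, φ.gen (w.1 s.toNNReal)| ≤ B * |(s : ℝ) - 0| :=
      intervalIntegral.norm_integral_le_of_norm_le_const
        (f := fun r => φ.gen (w.1 r.toNNReal)) fun r _ => (hB.eval_le w _).2
    have h3 : |(s : ℝ) - 0| ≤ t := by simpa using hs
    have h4 : 0 ≤ B := (abs_nonneg _).trans h1
    calc _ ≤ |φ.eval (w.1 s)| + |∫ s in (0 : ℝ)..s, φ.gen (w.1 s.toNNReal)| := abs_sub _ _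
      _ ≤ _ := add_le_add h1 (h2.trans (by gcongr))

end TestFunction

/-! ### Functions on the tree glued at the branching points -/

/-- Functions on the edges that satisfy the continuity and gluing conditions at all branching
points. -/
structure Glued (T : YuleTree) (F : Vertex → ℝ → ℝ) : Prop where
  contDiff : ∀ v, ContDiff ℝ 2 (F v)
  matching : ∀ v i, F (v ++ [i]) (T.1 v) = F v (T.1 v)
  glue : ∀ v, deriv (F v) (T.1 v) = ∑ i : Fin 2, deriv (F (v ++ [i])) (T.1 v)

theorem sub_pos_root (T : YuleTree) (i : Fin 2) : 0 < (T.sub i).1 [] :=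
  sub_pos.2 (T.2.lt_child [] i)

theorem YuleTree.sub_apply (T : YuleTree) (i : Fin 2) (v : Vertex) :
    (T.sub i).1 v = T.1 (i :: v) - T.1 [] := rfl

/-- The function equal to `F₀` on the root edge and to `F₁ i` on the subtree in the direction
`i`. -/
def consFun (T : YuleTree) (F₀ : ℝ → ℝ) (F₁ : Fin 2 → Vertex → ℝ → ℝ) : Vertex → ℝ → ℝ
  | [] => F₀
  | i :: v => fun r => F₁ i v (r - T.1 [])

theorem glued_consFun {T : YuleTree} {F₀ : ℝ → ℝ} {F₁ : Fin 2 → Vertex → ℝ → ℝ}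
    (h₀ : ContDiff ℝ 2 F₀) (h₁ : ∀ i, Glued (T.sub i) (F₁ i))
    (hm : ∀ i, F₁ i [] 0 = F₀ (T.1 [])) (hg : deriv F₀ (T.1 []) = ∑ i, deriv (F₁ i []) 0) :
    Glued T (consFun T F₀ F₁) where
  contDiff v := by
    rcases v with _ | ⟨i, v⟩
    · exact h₀
    · exact ((h₁ i).contDiff v).comp (contDiff_id.sub contDiff_const)
  matching v i := by
    rcases v with _ | ⟨j, v⟩
    · simpa [consFun] using hm i
    · exact (h₁ j).matching v i
  glue v := by
    rcases v with _ | ⟨j, v⟩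
    · simpa [consFun, deriv_comp_sub_const] using hg
    · simpa [consFun, deriv_comp_sub_const, YuleTree.sub_apply] using (h₁ j).glue v

section Extend

variable {σ : Type*} (val : YuleTree → σ → ℝ → ℝ) (next : YuleTree → σ → Fin 2 → σ)

/-- A function on the tree built edge by edge: `val T s` on the root edge, where `s` is an
initial state, and then the same in the subtrees with the initial states `next T s i`. -/
def extend : YuleTree → σ → Vertex → ℝ → ℝ
  | T, s, [] => val T s
  | T, s, i :: v => fun r => extend (T.sub i) (next T s i) v (r - T.1 [])

variable {val next}

/-- Every subtree carries a function of the same form, so only the first branching point has to be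
checked. Positivity of the root height is assumed for `T` alone, because it is automatic for the
subtrees. -/
theorem glued_extend (hc : ∀ T s, ContDiff ℝ 2 (val T s))
    (hm : ∀ (T : YuleTree) s i, 0 < T.1 [] → val (T.sub i) (next T s i) 0 = val T s (T.1 []))
    (hg : ∀ (T : YuleTree) s, 0 < T.1 [] →
      deriv (val T s) (T.1 []) = ∑ i, deriv (val (T.sub i) (next T s i)) 0)
    {T : YuleTree} (hT : 0 < T.1 []) (s : σ) : Glued T (extend val next T s) where
  contDiff v := by
    induction v generalizing T s with
    | nil => exact hc T s
    | cons i v ih => exact (ih (sub_pos_root T i) _).comp (contDiff_id.sub contDiff_const)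
  matching v i := by
    induction v generalizing T s with
    | nil => simpa [extend] using hm T s i hT
    | cons j v ih => exact ih (sub_pos_root T j) _
  glue v := by
    induction v generalizing T s with
    | nil => simpa [extend, deriv_comp_sub_const] using hg T s hT
    | cons j v ih =>
      simpa [extend, deriv_comp_sub_const, YuleTree.sub_apply] using ih (sub_pos_root T j) (next T s j)

end Extend

/-! ### The differential equation on an edge -/

/-- The operator `½ f'' + ½ f'`. -/
def edgeGen (f : ℝ → ℝ) (r : ℝ) : ℝ := (1 / 2) * deriv (deriv f) r + (1 / 2) * deriv f r

theorem edgeGen_comp_sub (f : ℝ → ℝ) (z r : ℝ) :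
    edgeGen (fun r => f (r - z)) r = edgeGen f (r - z) := by
  have h : deriv (fun r => f (r - z)) = fun r => deriv f (r - z) := by
    funext r; exact deriv_comp_sub_const (f := f) _ _
  rw [edgeGen, h, deriv_comp_sub_const (f := deriv f)]
  rfl

/-- The solution of `½ f'' + ½ f' = c` with value `a` and slope `m` at `0`. -/
def odeSol (c a m r : ℝ) : ℝ := a + 2 * c * r + (m - 2 * c) * (1 - Real.exp (-r))

theorem hasDerivAt_odeSol (c a m r : ℝ) :
    HasDerivAt (odeSol c a m) (2 * c + (m - 2 * c) * Real.exp (-r)) r := by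
  have h1 : HasDerivAt (fun r : ℝ => Real.exp (-r)) (Real.exp (-r) * -1) r :=
    (hasDerivAt_neg r).exp
  have h2 := (((hasDerivAt_id r).const_mul (2 * c)).const_add a).add
    ((h1.const_sub 1).const_mul (m - 2 * c))
  refine h2.congr_deriv ?_
  ring

theorem deriv_odeSol (c a m : ℝ) :
    deriv (odeSol c a m) = fun r => 2 * c + (m - 2 * c) * Real.exp (-r) :=
  funext fun r => (hasDerivAt_odeSol c a m r).deriv

theorem odeSol_zero (c a m : ℝ) : odeSol c a m 0 = a := by simp [odeSol]

theorem deriv_odeSol_zero (c a m : ℝ) : deriv (odeSol c a m) 0 = m := by simp [deriv_odeSol]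

theorem contDiff_odeSol (c a m : ℝ) : ContDiff ℝ 2 (odeSol c a m) := by
  unfold odeSol
  fun_prop

theorem edgeGen_odeSol (c a m r : ℝ) : edgeGen (odeSol c a m) r = c := by
  have h1 : HasDerivAt (fun r : ℝ => Real.exp (-r)) (Real.exp (-r) * -1) r :=
    (hasDerivAt_neg r).exp
  have h2 := ((h1.const_mul (m - 2 * c)).const_add (2 * c)).deriv
  rw [edgeGen, deriv_odeSol, h2]
  ring

theorem edgeGen_extend {σ : Type*} {val : YuleTree → σ → ℝ → ℝ} {next : YuleTree → σ → Fin 2 → σ}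
    {c : ℝ} (h : ∀ T s r, edgeGen (val T s) r = c) (T : YuleTree) (s : σ) (v : Vertex) (r : ℝ) :
    edgeGen (extend val next T s v) r = c := by
  induction v generalizing T s r with
  | nil => exact h T s r
  | cons i v ih =>
    change edgeGen (fun r => extend val next (T.sub i) (next T s i) v (r - T.1 [])) r = c
    rw [edgeGen_comp_sub]
    exact ih _ _ _

/-! ### Cutting off -/

/-- A smooth function equal to `1` near `a` and before, and to `0` near `b` and beyond. -/
def cutoffFun (a b r : ℝ) : ℝ := 1 - Real.smoothTransition (2 * ((r - a) / (b - a)) - 1 / 2)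

theorem contDiff_cutoffFun (a b : ℝ) : ContDiff ℝ 2 (cutoffFun a b) := by
  unfold cutoffFun
  have h : ContDiff ℝ 2 Real.smoothTransition := Real.smoothTransition.contDiff
  refine contDiff_const.sub (h.comp ?_)
  fun_prop

theorem cutoffFun_eventually_one {a b : ℝ} : ∀ᶠ r in 𝓝 a, cutoffFun a b r = 1 := by
  have hc : ContinuousAt (fun r => 2 * ((r - a) / (b - a)) - 1 / 2) a := by fun_prop
  -- The argument of the transition is `-1/2` at `a` and, when `a < b`, `3/2` at `b`: both lie
  -- strictly outside `[0, 1]`, so the cutoff is constant near each end.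
  have h0 : (fun r => 2 * ((r - a) / (b - a)) - 1 / 2) a < 0 := by norm_num
  filter_upwards [hc.eventually_lt continuousAt_const h0] with r hr
  rw [cutoffFun, Real.smoothTransition.zero_of_nonpos hr.le, sub_zero]

theorem cutoffFun_eventually_zero {a b : ℝ} (h : a < b) : ∀ᶠ r in 𝓝 b, cutoffFun a b r = 0 := by
  have hc : ContinuousAt (fun r => 2 * ((r - a) / (b - a)) - 1 / 2) b := by fun_prop
  have h0 : 1 < (fun r => 2 * ((r - a) / (b - a)) - 1 / 2) b := by
    simp only [div_self (sub_pos.2 h).ne']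
    norm_num
  filter_upwards [continuousAt_const.eventually_lt hc h0] with r hr
  rw [cutoffFun, Real.smoothTransition.one_of_one_le hr.le, sub_self]

/-- The function `F` cut off on the edges of generation `N + 1`. -/
def cutoffEdge (T : YuleTree) (F : Vertex → ℝ → ℝ) (N : ℕ) (v : Vertex) : ℝ → ℝ :=
  if v.length ≤ N then F v
  else if v.length = N + 1 then fun r => F v r * cutoffFun (T.1 v.dropLast) (T.1 v) r
  else fun _ => 0

section CutoffEdge

variable {T : YuleTree} {F : Vertex → ℝ → ℝ} {N : ℕ} {v : Vertex}

theorem cutoffEdge_of_le (h : v.length ≤ N) : cutoffEdge T F N v = F v := if_pos h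

theorem cutoffEdge_of_lt (h : N + 1 < v.length) : cutoffEdge T F N v = fun _ => 0 := by
  rw [cutoffEdge, if_neg (by omega), if_neg (by omega)]

theorem cutoffEdge_concat (h : v.length ≤ N) (i : Fin 2) :
    cutoffEdge T F N (v ++ [i]) =ᶠ[𝓝 (T.1 v)] F (v ++ [i]) := by
  rcases h.lt_or_eq with h | h
  · rw [cutoffEdge_of_le (by simp; omega)]
  · rw [cutoffEdge, if_neg (by simp; omega), if_pos (by simp; omega), List.dropLast_concat]
    filter_upwards [cutoffFun_eventually_one (a := T.1 v) (b := T.1 (v ++ [i]))] with r hr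
    rw [hr, mul_one]

theorem cutoffEdge_eventually_zero (h : N < v.length) :
    cutoffEdge T F N v =ᶠ[𝓝 (T.1 v)] fun _ => 0 := by
  rcases Nat.lt_or_eq_of_le (Nat.succ_le_of_lt h) with h | h
  · rw [cutoffEdge_of_lt h]
  · have hlt : T.1 v.dropLast < T.1 v := by
      have hne : v ≠ [] := by rintro rfl; simp at h
      have := T.2.lt_child v.dropLast (v.getLast hne)
      rwa [List.dropLast_append_getLast] at this
    rw [cutoffEdge, if_neg (by omega), if_pos (by omega)]
    filter_upwards [cutoffFun_eventually_zero hlt] with r hr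
    rw [hr, mul_zero]

/-- The cutoff is `1` near the lower end and `0` near the upper end of an edge of generation `N +
1`. At each branching point either the three germs are those of `F`, or all three vanish. -/
theorem Glued.cutoffEdge (hF : Glued T F) (N : ℕ) : Glued T (cutoffEdge T F N) where
  contDiff v := by
    unfold YuleConductance.cutoffEdge
    split_ifs
    · exact hF.contDiff v
    · exact (hF.contDiff v).mul (contDiff_cutoffFun _ _)
    · exact contDiff_const
  matching v i := by
    rcases le_or_gt v.length N with h | h
    · rw [(cutoffEdge_concat h i).self_of_nhds, cutoffEdge_of_le h]
      exact hF.matching v i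
    · rw [cutoffEdge_of_lt (by simp; omega), (cutoffEdge_eventually_zero h).self_of_nhds]
  glue v := by
    rcases le_or_gt v.length N with h | h
    · rw [cutoffEdge_of_le h, hF.glue v]
      exact Finset.sum_congr rfl fun i _ => (cutoffEdge_concat h i).deriv_eq.symm
    · rw [(cutoffEdge_eventually_zero h).deriv_eq, Finset.sum_eq_zero, deriv_const]
      intro i _
      rw [cutoffEdge_of_lt (by simp; omega), deriv_const]

end CutoffEdge

/-- The test function that coincides with `F` up to generation `N`. -/
def Glued.testFunction {T : YuleTree} {F : Vertex → ℝ → ℝ} (hF : Glued T F)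
    (h0 : deriv (F []) 0 = 0) (N : ℕ) : TestFunction T where
  f := YuleConductance.cutoffEdge T F N
  contDiff := (hF.cutoffEdge N).contDiff
  matching := (hF.cutoffEdge N).matching
  glue := (hF.cutoffEdge N).glue
  reflect := by simpa [YuleConductance.cutoffEdge] using h0
  support := by
    obtain ⟨R, hR⟩ := ((List.finite_length_le (Fin 2) (N + 1)).image T.1).bddAbove
    refine ⟨R + 1, fun x hx hRx => ?_⟩
    unfold YuleConductance.cutoffEdge
    have h1 : ¬ x.1.length ≤ N + 1 := fun h => by
      have := hR ⟨x.1, h, rfl⟩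
      have := hx.1
      linarith
    rw [if_neg (by omega), if_neg (by omega)]

namespace Glued

variable {T : YuleTree} {F : Vertex → ℝ → ℝ} (hF : Glued T F) (h0 : deriv (F []) 0 = 0) (N : ℕ)

theorem testFunction_f {v : Vertex} (hv : v.length ≤ N) : (hF.testFunction h0 N).f v = F v :=
  if_pos hv

theorem eval_testFunction {a : State} (ha : InGen N a) :
    (hF.testFunction h0 N).eval a = edgeEval F a := by
  obtain ⟨x, rfl, hl⟩ := ha
  rw [TestFunction.eval, testFunction_f hF h0 N hl]
  rfl

theorem gen_testFunction {a : State} (ha : InGen N a) :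
    (hF.testFunction h0 N).gen a = edgeEval (fun v => edgeGen (F v)) a := by
  obtain ⟨x, rfl, hl⟩ := ha
  rw [TestFunction.gen, testFunction_f hF h0 N hl]
  rfl

theorem exists_isBound : ∃ B, (hF.testFunction h0 N).IsBound B := by
  set φ := hF.testFunction h0 N
  have key : ∀ v, ∃ B, ∀ r ∈ Set.Icc 0 (T.1 v), |φ.eval (some (v, r))| ≤ B ∧
      |φ.gen (some (v, r))| ≤ B := by
    intro v
    obtain ⟨B₁, h₁⟩ := isCompact_Icc.exists_bound_of_continuousOn (s := Set.Icc 0 (T.1 v))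
      (φ.contDiff v).continuous.continuousOn
    obtain ⟨B₂, h₂⟩ := isCompact_Icc.exists_bound_of_continuousOn (s := Set.Icc 0 (T.1 v))
      (φ.continuous_genEdge v).continuousOn
    exact ⟨max B₁ B₂, fun r hr => ⟨(h₁ r hr).trans (le_max_left _ _),
      (h₂ r hr).trans (le_max_right _ _)⟩⟩
  choose B hB using key
  obtain ⟨R, hR⟩ := ((List.finite_length_le (Fin 2) (N + 1)).image B).bddAbove
  refine ⟨max R 0, fun x hx => ?_⟩
  by_cases hl : x.1.length ≤ N + 1
  · have h1 := hB x.1 x.2 ⟨YuleTree.nonneg_of_mem hx, hx.1⟩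
    have h2 : B x.1 ≤ max R 0 := (hR ⟨x.1, hl, rfl⟩).trans (le_max_left _ _)
    exact ⟨h1.1.trans h2, h1.2.trans h2⟩
  · have h1 : φ.f x.1 = fun _ => 0 := by
      change YuleConductance.cutoffEdge T F N x.1 = _
      rw [YuleConductance.cutoffEdge, if_neg (by omega), if_neg (by omega)]
    simp [TestFunction.eval, TestFunction.gen, h1]

end Glued

/-! ### The conductance as a limit, and harmonic functions -/

/-- The conductance of an edge of length `z` in series with conductors of total conductance `K`
at its end, in the scale of Brownian motion with drift `1/2`. -/
def serial (z K : ℝ) : ℝ := K / (Real.exp (-z) + K * (1 - Real.exp (-z)))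

theorem exp_neg_le_one {z : ℝ} (hz : 0 ≤ z) : Real.exp (-z) ≤ 1 :=
  Real.exp_le_one_iff.2 (neg_nonpos.2 hz)

theorem serial_denom_pos {z K : ℝ} (hz : 0 ≤ z) (hK : 0 ≤ K) :
    0 < Real.exp (-z) + K * (1 - Real.exp (-z)) :=
  add_pos_of_pos_of_nonneg (Real.exp_pos _) (mul_nonneg hK (sub_nonneg.2 (exp_neg_le_one hz)))

theorem serial_mono {z K K' : ℝ} (hz : 0 ≤ z) (hK : 0 ≤ K) (h : K ≤ K') :
    serial z K ≤ serial z K' := by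
  rw [serial, serial, div_le_div_iff₀ (serial_denom_pos hz hK) (serial_denom_pos hz (hK.trans h))]
  have := mul_le_mul_of_nonneg_right h (Real.exp_pos (-z)).le
  nlinarith

theorem one_le_serial {z K : ℝ} (hz : 0 ≤ z) (hK : 1 ≤ K) : 1 ≤ serial z K := by
  rw [serial, le_div_iff₀ (serial_denom_pos hz (by linarith))]
  nlinarith [mul_le_mul_of_nonneg_right hK (Real.exp_pos (-z)).le]

theorem serial_mul_lt_one {z K : ℝ} (hz : 0 ≤ z) (hK : 0 ≤ K) :
    serial z K * (1 - Real.exp (-z)) < 1 := by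
  rw [serial, div_mul_eq_mul_div, div_lt_one (serial_denom_pos hz hK)]
  linarith [Real.exp_pos (-z)]

/-- The conductance obtained by replacing the subtrees after `n` generations by single rays. -/
def condApprox : ℕ → YuleTree → ℝ
  | 0, _ => 1
  | n + 1, T => serial (T.1 []) (condApprox n (T.sub 0) + condApprox n (T.sub 1))

theorem one_le_condApprox (n : ℕ) (T : YuleTree) : 1 ≤ condApprox n T := by
  induction n generalizing T with
  | zero => exact le_rfl
  | succ n ih => exact one_le_serial (T.2.nonneg _) (by linarith [ih (T.sub 0), ih (T.sub 1)])

/-- Closing with a single ray underestimates a subtree, and `serial` is monotone in the conductance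
at the end. -/
theorem condApprox_le_succ (n : ℕ) (T : YuleTree) : condApprox n T ≤ condApprox (n + 1) T := by
  induction n generalizing T with
  | zero => exact one_le_condApprox 1 T
  | succ n ih =>
    refine serial_mono (T.2.nonneg _) ?_ (add_le_add (ih _) (ih _))
    linarith [one_le_condApprox n (T.sub 0), one_le_condApprox n (T.sub 1)]

theorem condApprox_mono (T : YuleTree) : Monotone fun n => condApprox n T :=
  monotone_nat_of_le_succ fun n => condApprox_le_succ n T

/-- However large the conductance behind it, the root edge alone limits the total to `1 / (1 - exp
(-z))`. -/
theorem bddAbove_condApprox {T : YuleTree} (hT : 0 < T.1 []) :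
    BddAbove (Set.range fun n => condApprox n T) := by
  have he : 0 < 1 - Real.exp (-T.1 []) := sub_pos.2 (Real.exp_lt_one_iff.2 (neg_lt_zero.2 hT))
  refine ⟨max 1 (1 / (1 - Real.exp (-T.1 []))), ?_⟩
  rintro _ ⟨n, rfl⟩
  rcases n with _ | n
  · exact le_max_left _ _
  · refine le_trans ?_ (le_max_right _ _)
    rw [le_div_iff₀ he]
    refine (serial_mul_lt_one hT.le ?_).le
    linarith [one_le_condApprox n (T.sub 0), one_le_condApprox n (T.sub 1)]

/-- The conductance of the tree between the root and infinity, as a limit. -/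
def cond (T : YuleTree) : ℝ := ⨆ n, condApprox n T

theorem tendsto_condApprox {T : YuleTree} (hT : 0 < T.1 []) :
    Tendsto (fun n => condApprox n T) atTop (𝓝 (cond T)) :=
  tendsto_atTop_ciSup (condApprox_mono T) (bddAbove_condApprox hT)

theorem one_le_cond {T : YuleTree} (hT : 0 < T.1 []) : 1 ≤ cond T :=
  (one_le_condApprox 0 T).trans (le_ciSup (bddAbove_condApprox hT) 0)

/-- The total conductance of the two subtrees at the first branching point. -/
def condSum (T : YuleTree) : ℝ := cond (T.sub 0) + cond (T.sub 1)

theorem two_le_condSum (T : YuleTree) : 2 ≤ condSum T := by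
  have h0 := one_le_cond (sub_pos_root T 0)
  have h1 := one_le_cond (sub_pos_root T 1)
  rw [condSum]; linarith

theorem cond_eq {T : YuleTree} (hT : 0 < T.1 []) : cond T = serial (T.1 []) (condSum T) := by
  have h1 := (tendsto_condApprox hT).comp (tendsto_add_atTop_nat 1)
  have h2 : Tendsto (fun n => condApprox n (T.sub 0) + condApprox n (T.sub 1)) atTop
      (𝓝 (condSum T)) :=
    (tendsto_condApprox (sub_pos_root T 0)).add (tendsto_condApprox (sub_pos_root T 1))
  have hd := serial_denom_pos hT.le (K := condSum T) (by linarith [two_le_condSum T])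
  have h3 : Tendsto (fun n => condApprox (n + 1) T) atTop (𝓝 (serial (T.1 []) (condSum T))) :=
    h2.div (tendsto_const_nhds.add (h2.mul_const _)) hd.ne'
  exact tendsto_nhds_unique h1 h3

theorem measurable_sub (i : Fin 2) : Measurable fun T : YuleTree => T.sub i := by
  refine Measurable.subtype_mk (measurable_pi_lambda _ fun v => ?_)
  exact ((measurable_pi_apply _).comp measurable_subtype_coe).sub
    ((measurable_pi_apply _).comp measurable_subtype_coe)

theorem measurable_height (v : Vertex) : Measurable fun T : YuleTree => T.1 v :=
  (measurable_pi_apply _).comp measurable_subtype_coe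

theorem measurable_condApprox (n : ℕ) : Measurable (condApprox n) := by
  induction n with
  | zero => exact measurable_const
  | succ n ih =>
    have h0 := ih.comp (measurable_sub 0)
    have h1 := ih.comp (measurable_sub 1)
    have h2 := (measurable_height []).neg.exp
    exact (h0.add h1).div (h2.add ((h0.add h1).mul (h2.const_sub 1)))

theorem measurable_cond : Measurable cond := Measurable.iSup measurable_condApprox

/-- The probability that the exit ray passes through the edge `v`. -/
def exitProb : YuleTree → Vertex → ℝ
  | _, [] => 1
  | T, i :: v => cond (T.sub i) / condSum T * exitProb (T.sub i) v

theorem measurable_exitProb (v : Vertex) : Measurable fun T => exitProb T v := by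
  induction v with
  | nil => exact measurable_const
  | cons i v ih =>
    have h := fun i => measurable_cond.comp (measurable_sub i)
    exact ((h i).div ((h 0).add (h 1))).mul (ih.comp (measurable_sub i))

theorem cond_le_condSum (T : YuleTree) (i : Fin 2) : cond (T.sub i) ≤ condSum T := by
  have h0 := one_le_cond (sub_pos_root T 0)
  have h1 := one_le_cond (sub_pos_root T 1)
  rw [condSum]
  fin_cases i
  · change cond (T.sub 0) ≤ _; linarith
  · change cond (T.sub 1) ≤ _; linarith

theorem exitProb_mem (T : YuleTree) (v : Vertex) : 0 ≤ exitProb T v ∧ exitProb T v ≤ 1 := by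
  induction v generalizing T with
  | nil => exact ⟨zero_le_one, le_rfl⟩
  | cons i v ih =>
    have h1 := one_le_cond (sub_pos_root T i)
    have h2 := two_le_condSum T
    have h3 : cond (T.sub i) / condSum T ≤ 1 := (div_le_one (by linarith)).2 (cond_le_condSum T i)
    have h4 : 0 ≤ cond (T.sub i) / condSum T := div_nonneg (by linarith) (by linarith)
    exact ⟨mul_nonneg h4 (ih _).1, mul_le_one₀ h3 (ih _).1 (ih _).2⟩

/-- The probability of a target: the edge `v`, or the empty set. -/
def targetProb (T : YuleTree) : Option Vertex → ℝ
  | none => 0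
  | some v => exitProb T v

/-- The part of a target that lies in the subtree in the direction `j`. -/
def targetTail : Option Vertex → Fin 2 → Option Vertex
  | none, _ => none
  | some [], _ => some []
  | some (i :: v), j => if i = j then some v else none

/-- Conservation of flow at the branching point: exit probabilities average over the two subtrees
with weights proportional to their conductances. -/
theorem condSum_mul_targetProb (T : YuleTree) (g : Option Vertex) :
    condSum T * targetProb T g = ∑ j, cond (T.sub j) * targetProb (T.sub j) (targetTail g j) := by
  have h2 := two_le_condSum T
  have h3 : condSum T ≠ 0 := by linarith
  rcases g with _ | _ | ⟨i, v⟩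
  · simp [targetProb, targetTail]
  · simp [targetProb, targetTail, exitProb, condSum]
  · have hs : ∀ j, cond (T.sub j) * targetProb (T.sub j) (targetTail (some (i :: v)) j) =
        if i = j then cond (T.sub i) * exitProb (T.sub i) v else 0 := by
      intro j
      by_cases h : i = j
      · subst h; simp [targetTail, targetProb]
      · simp [targetTail, targetProb, h]
    rw [Finset.sum_congr rfl fun j _ => hs j, Finset.sum_ite_eq, if_pos (Finset.mem_univ _),
      targetProb, exitProb]
    field_simp

/-! ### Harmonic functions with prescribed limits at infinity -/

/-- A harmonic function on the root edge, with value `p.1` at the root, that belongs to the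
target `p.2`. -/
def harmVal (T : YuleTree) (p : ℝ × Option Vertex) : ℝ → ℝ :=
  odeSol 0 p.1 (cond T * (targetProb T p.2 - p.1))

/-- The value at the first branching point and the remaining target. -/
def harmNext (T : YuleTree) (p : ℝ × Option Vertex) (i : Fin 2) : ℝ × Option Vertex :=
  (harmVal T p (T.1 []), targetTail p.2 i)

/-- The harmonic function with value `a` at the root that tends at infinity to the indicator of
the target `g`. -/
def harm (T : YuleTree) (a : ℝ) (g : Option Vertex) : Vertex → ℝ → ℝ :=
  extend harmVal harmNext T (a, g)

/-- The initial slope on an edge is the conductance times the gap between target probability and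
value. By the series law the slope at the far end is `condSum` times the gap there, and
`condSum_mul_targetProb` splits it into the two outgoing slopes. -/
theorem glued_harm {T : YuleTree} (hT : 0 < T.1 []) (a : ℝ) (g : Option Vertex) :
    Glued T (harm T a g) := by
  refine glued_extend (fun T s => contDiff_odeSol _ _ _) (fun T s i _ => odeSol_zero _ _ _)
    (fun T s h => ?_) hT _
  change deriv (harmVal T s) (T.1 []) = ∑ i, deriv (harmVal (T.sub i) (harmNext T s i)) 0
  have h1 : ∀ i, deriv (harmVal (T.sub i) (harmNext T s i)) 0 =
      cond (T.sub i) * targetProb (T.sub i) (targetTail s.2 i) -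
        cond (T.sub i) * harmVal T s (T.1 []) := by
    intro i
    rw [harmVal, deriv_odeSol_zero, harmNext]
    ring
  rw [Finset.sum_congr rfl fun i _ => h1 i, Finset.sum_sub_distrib, ← condSum_mul_targetProb,
    ← Finset.sum_mul, Fin.sum_univ_two, ← condSum, harmVal, deriv_odeSol, cond_eq h, odeSol, serial]
  have hd := (serial_denom_pos h.le (K := condSum T) (by linarith [two_le_condSum T])).ne'
  field_simp
  ring

theorem harm_nil (T : YuleTree) (a : ℝ) (g : Option Vertex) (r : ℝ) :
    harm T a g [] r = a + cond T * (targetProb T g - a) * (1 - Real.exp (-r)) := by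
  simp [harm, extend, harmVal, odeSol]

theorem harm_cons (T : YuleTree) (a : ℝ) (g : Option Vertex) (i : Fin 2) (v : Vertex) (r : ℝ) :
    harm T a g (i :: v) r =
      harm (T.sub i) (harm T a g [] (T.1 [])) (targetTail g i) v (r - T.1 []) := rfl

theorem edgeGen_harm (T : YuleTree) (a : ℝ) (g : Option Vertex) (v : Vertex) (r : ℝ) :
    edgeGen (harm T a g v) r = 0 :=
  edgeGen_extend (fun _ _ _ => edgeGen_odeSol _ _ _ _) _ _ _ _

theorem mem_points_sub {T : YuleTree} {i : Fin 2} {v : Vertex} {r : ℝ}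
    (h : (i :: v, r) ∈ T.points) : (v, r - T.1 []) ∈ (T.sub i).points := by
  refine ⟨sub_le_sub_right h.1 _, ?_⟩
  have h2 := YuleTree.lt_of_mem h (by simp)
  rcases v with _ | ⟨j, v⟩
  · left
    refine ⟨rfl, ?_⟩
    simp at h2 ⊢
    exact h2.le
  · right
    refine ⟨by simp, ?_⟩
    simpa [YuleTree.sub_apply] using h2

theorem cond_mul_lt_one {T : YuleTree} (hT : 0 < T.1 []) {r : ℝ} (h : r ≤ T.1 []) :
    cond T * (1 - Real.exp (-r)) < 1 := by
  have h1 : cond T * (1 - Real.exp (-T.1 [])) < 1 := by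
    rw [cond_eq hT]
    exact serial_mul_lt_one hT.le (by linarith [two_le_condSum T])
  refine lt_of_le_of_lt ?_ h1
  have := one_le_cond hT
  gcongr

theorem nil_mem_points {T : YuleTree} {r : ℝ} (h : ([], r) ∈ T.points) : 0 ≤ r ∧ r ≤ T.1 [] :=
  ⟨YuleTree.nonneg_of_mem h, h.1⟩

/-- Comparison with a single ray: conductances are at least `1`, so along each edge the function
decays at least as fast as `exp (-r)`, and the factors multiply along the path. -/
theorem harm_none_bounds {T : YuleTree} (hT : 0 < T.1 []) {a : ℝ} (ha : 0 ≤ a) {v : Vertex} {r : ℝ}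
    (h : (v, r) ∈ T.points) :
    0 ≤ harm T a none v r ∧ harm T a none v r ≤ a * Real.exp (-r) := by
  have key : ∀ r, 0 ≤ r → r ≤ T.1 [] →
      0 ≤ harm T a none [] r ∧ harm T a none [] r ≤ a * Real.exp (-r) := by
    intro r h0 h1
    have h2 := cond_mul_lt_one hT h1
    have h3 : 1 - Real.exp (-r) ≤ cond T * (1 - Real.exp (-r)) :=
      le_mul_of_one_le_left (sub_nonneg.2 (exp_neg_le_one h0)) (one_le_cond hT)
    have h4 : harm T a none [] r = a * (1 - cond T * (1 - Real.exp (-r))) := by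
      rw [harm_nil, targetProb]; ring
    rw [h4]
    exact ⟨mul_nonneg ha (by linarith), mul_le_mul_of_nonneg_left (by linarith) ha⟩
  induction v generalizing T a r with
  | nil => exact key r (nil_mem_points h).1 (nil_mem_points h).2
  | cons i v ih =>
    obtain ⟨k1, k2⟩ := key (T.1 []) hT.le le_rfl
    have h1 := sub_pos_root T i
    have := ih h1 k1 (mem_points_sub h) ?_
    · rw [harm_cons]
      refine ⟨this.1, this.2.trans ?_⟩
      calc _ ≤ a * Real.exp (-T.1 []) * Real.exp (-(r - T.1 [])) := by gcongr
        _ = _ := by rw [mul_assoc, ← Real.exp_add]; ring_nf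
    · intro r h0 h1'
      have h2 := cond_mul_lt_one h1 h1'
      have h3 : 1 - Real.exp (-r) ≤ cond (T.sub i) * (1 - Real.exp (-r)) :=
        le_mul_of_one_le_left (sub_nonneg.2 (exp_neg_le_one h0)) (one_le_cond h1)
      have h4 : harm (T.sub i) (harm T a none [] (T.1 [])) none [] r =
          harm T a none [] (T.1 []) * (1 - cond (T.sub i) * (1 - Real.exp (-r))) := by
        rw [harm_nil (T.sub i), targetProb]; ring
      rw [h4]
      exact ⟨mul_nonneg k1 (by linarith), mul_le_mul_of_nonneg_left (by linarith) k1⟩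

/-- The function decreases along each edge, and by `cond_mul_lt_one` an edge never takes up the
whole drop to `0`. -/
theorem harm_none_pos {T : YuleTree} (hT : 0 < T.1 []) {a : ℝ} (ha : 0 < a) {v : Vertex} {r : ℝ}
    (h : (v, r) ∈ T.points) :
    0 < harm T a none v (T.1 v) ∧ harm T a none v (T.1 v) ≤ harm T a none v r := by
  have h4 : ∀ r, harm T a none [] r = a * (1 - cond T * (1 - Real.exp (-r))) := by
    intro r; rw [harm_nil, targetProb]; ring
  have h5 : 0 < harm T a none [] (T.1 []) := by
    rw [h4]
    exact mul_pos ha (sub_pos.2 (cond_mul_lt_one hT le_rfl))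
  induction v generalizing T a r with
  | nil =>
    refine ⟨h5, ?_⟩
    rw [h4, h4]
    have h0 := one_le_cond hT
    have h1 := (nil_mem_points h).2
    gcongr
  | cons i v ih =>
    have h1 := sub_pos_root T i
    refine ih h1 h5 (mem_points_sub h) ?_ ?_
    · intro r; rw [harm_nil (T.sub i), targetProb]; ring
    · rw [harm_nil (T.sub i), targetProb]
      have := mul_pos h5 (sub_pos.2 (cond_mul_lt_one h1 le_rfl))
      linarith

/-- Subtraction from `1` exchanges the limits `0` and `1` at infinity, so the estimates for the
empty target transfer to the full one. -/
theorem harm_some_nil (T : YuleTree) (a : ℝ) (v : Vertex) (r : ℝ) :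
    harm T a (some []) v r = 1 - harm T (1 - a) none v r := by
  have h1 : ∀ (T : YuleTree) a r, harm T a (some []) [] r = 1 - harm T (1 - a) none [] r := by
    intro T a r
    rw [harm_nil, harm_nil, targetProb, targetProb, exitProb]; ring
  induction v generalizing T a r with
  | nil => exact h1 T a r
  | cons i v ih =>
    change harm (T.sub i) (harm T a (some []) [] (T.1 [])) (some []) v _ =
      1 - harm (T.sub i) (harm T (1 - a) none [] (T.1 [])) none v _
    rw [ih, h1]
    simp

/-- On the way to `u` the values at the branching points are convex combinations of `a` and exit
probabilities, hence stay in `[0, 1]`. Once the label has turned away from `u`, or has reached `u`,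
the remaining target is empty or everything, and the exponential decay applies from there on. -/
theorem harm_tendsto_indicator {T : YuleTree} (hT : 0 < T.1 []) {a : ℝ} (h0 : 0 ≤ a) (h1 : a ≤ 1)
    {u v : Vertex} {r : ℝ} (hl : u.length ≤ v.length) (h : (v, r) ∈ T.points) :
    |harm T a (some u) v r - if u <+: v then 1 else 0| ≤ Real.exp (T.1 u - r) := by
  induction u generalizing T a v r with
  | nil =>
    rw [if_pos List.nil_prefix, harm_some_nil]
    obtain ⟨h2, h3⟩ := harm_none_bounds hT (sub_nonneg.2 h1) h
    rw [sub_sub_cancel_left, abs_neg, abs_of_nonneg h2]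
    refine h3.trans ?_
    calc (1 - a) * Real.exp (-r) ≤ 1 * Real.exp (-r) := by gcongr; linarith
      _ ≤ Real.exp (T.1 [] - r) := by rw [one_mul]; gcongr; linarith
  | cons i u ih =>
    rcases v with _ | ⟨j, v⟩
    · simp at hl
    rw [harm_cons]
    have h2 := cond_mul_lt_one hT le_rfl
    have h3 : 0 ≤ cond T * (1 - Real.exp (-T.1 [])) :=
      mul_nonneg (by linarith [one_le_cond hT]) (sub_nonneg.2 (exp_neg_le_one hT.le))
    obtain ⟨h4, h5⟩ := exitProb_mem T (i :: u)
    have h6 : harm T a (some (i :: u)) [] (T.1 []) =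
        (1 - cond T * (1 - Real.exp (-T.1 []))) * a +
          cond T * (1 - Real.exp (-T.1 [])) * exitProb T (i :: u) := by
      rw [harm_nil, targetProb]; ring
    have h7 : 0 ≤ harm T a (some (i :: u)) [] (T.1 []) := by
      rw [h6]
      exact add_nonneg (mul_nonneg (by linarith) h0) (mul_nonneg h3 h4)
    have h8 : harm T a (some (i :: u)) [] (T.1 []) ≤ 1 := by
      rw [h6]
      have k1 := mul_le_mul_of_nonneg_left h1
        (show 0 ≤ 1 - cond T * (1 - Real.exp (-T.1 [])) by linarith)
      have k2 := mul_le_mul_of_nonneg_left h5 h3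
      linarith
    have hm := mem_points_sub h
    by_cases hij : i = j
    · subst hij
      have h9 := ih (sub_pos_root T i) h7 h8 (by simpa using hl) hm
      simp only [targetTail, List.cons_prefix_cons, if_true, true_and]
      refine h9.trans_eq ?_
      rw [YuleTree.sub_apply]
      ring_nf
    · simp only [targetTail, List.cons_prefix_cons, hij, false_and, if_false, sub_zero]
      obtain ⟨k1, k2⟩ := harm_none_bounds (sub_pos_root T j) h7 hm
      rw [abs_of_nonneg k1]
      refine k2.trans ?_
      calc _ ≤ 1 * Real.exp (-(r - T.1 [])) := by gcongr
        _ ≤ _ := by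
          rw [one_mul]
          gcongr
          have := T.le_cons i u
          linarith

/-! ### A function to bound exit times -/

/-- A function whose image under the generator is `1`, and whose slope at the root is `0`. -/
def timeFun (T : YuleTree) : Vertex → ℝ → ℝ :=
  extend (σ := ℝ × ℝ) (fun _ p => odeSol 1 p.1 p.2)
    (fun T p _ => (odeSol 1 p.1 p.2 (T.1 []), deriv (odeSol 1 p.1 p.2) (T.1 []) / 2)) T (0, 0)

theorem glued_timeFun {T : YuleTree} (hT : 0 < T.1 []) : Glued T (timeFun T) := by
  refine glued_extend (fun T s => contDiff_odeSol _ _ _) (fun T s i _ => odeSol_zero _ _ _)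
    (fun T s h => ?_) hT _
  simp only [deriv_odeSol_zero, Fin.sum_univ_two]
  ring

theorem edgeGen_timeFun (T : YuleTree) (v : Vertex) (r : ℝ) : edgeGen (timeFun T v) r = 1 :=
  edgeGen_extend (fun _ _ _ => edgeGen_odeSol _ _ _ _) _ _ _ _

theorem deriv_timeFun (T : YuleTree) : deriv (timeFun T []) 0 = 0 := deriv_odeSol_zero _ _ _

/-! ### A superharmonic function that vanishes at infinity -/

/-- The image of `superFun T` under the generator on the root edge. -/
def superRate (T : YuleTree) : ℝ := -condSum T / (2 * (1 - Real.exp (-T.1 [])))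

/-- The value of `superFun T` at the root. -/
def superMax (T : YuleTree) : ℝ :=
  1 - 2 * superRate T * (T.1 [] - (1 - Real.exp (-T.1 [])))

/-- A function with slope `0` at the root, superharmonic on the root edge, harmonic elsewhere,
and vanishing at infinity. -/
def superFun (T : YuleTree) : Vertex → ℝ → ℝ :=
  consFun T (odeSol (superRate T) (superMax T) 0) fun i => harm (T.sub i) 1 none

theorem superRate_neg {T : YuleTree} (hT : 0 < T.1 []) : superRate T < 0 := by
  have h1 : 0 < 1 - Real.exp (-T.1 []) := sub_pos.2 (Real.exp_lt_one_iff.2 (neg_lt_zero.2 hT))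
  exact div_neg_of_neg_of_pos (by linarith [two_le_condSum T]) (by linarith)

theorem superFun_nil (T : YuleTree) (r : ℝ) : superFun T [] r =
    1 - 2 * superRate T * ((T.1 [] - (1 - Real.exp (-T.1 []))) - (r - (1 - Real.exp (-r)))) := by
  simp only [superFun, consFun, odeSol, superMax]
  ring

theorem sub_one_sub_exp_mono {r s : ℝ} (h0 : 0 ≤ r) (h : r ≤ s) :
    r - (1 - Real.exp (-r)) ≤ s - (1 - Real.exp (-s)) := by
  have h1 : Real.exp (-s) = Real.exp (-r) * Real.exp (-(s - r)) := by
    rw [← Real.exp_add]; ring_nf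
  have h2 := Real.add_one_le_exp (-(s - r))
  have h3 := exp_neg_le_one h0
  have h4 := Real.exp_pos (-r)
  rw [h1]
  nlinarith [mul_le_mul_of_nonneg_left h2 h4.le, mul_le_mul_of_nonneg_right h3 (sub_nonneg.2 h)]

/-- `superRate` is the rate for which slope `0` at the root becomes `-condSum T` at the end of the
root edge, and `superMax` makes the value there `1`. The continuation is `harm` from `1` down to
`0`, with initial slopes `-cond (T.sub i)`. -/
theorem glued_superFun {T : YuleTree} (hT : 0 < T.1 []) : Glued T (superFun T) := by
  refine glued_consFun (contDiff_odeSol _ _ _) (fun i => glued_harm (sub_pos_root T i) _ _) ?_ ?_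
  · intro i
    have := superFun_nil T (T.1 [])
    simp only [superFun, consFun] at this
    rw [this, harm_nil]
    simp
  · have h1 : ∀ i, deriv (harm (T.sub i) 1 none []) 0 = -cond (T.sub i) := by
      intro i
      change deriv (odeSol _ _ _) 0 = _
      rw [deriv_odeSol_zero]
      simp [targetProb]
    rw [Finset.sum_congr rfl fun i _ => h1 i, Finset.sum_neg_distrib, Fin.sum_univ_two, ← condSum,
      deriv_odeSol, superRate]
    have h2 : 1 - Real.exp (-T.1 []) ≠ 0 :=
      (sub_pos.2 (Real.exp_lt_one_iff.2 (neg_lt_zero.2 hT))).ne'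
    field_simp
    ring

theorem deriv_superFun (T : YuleTree) : deriv (superFun T []) 0 = 0 := deriv_odeSol_zero _ _ _

theorem edgeGen_superFun_nonpos {T : YuleTree} (hT : 0 < T.1 []) (v : Vertex) (r : ℝ) :
    edgeGen (superFun T v) r ≤ 0 := by
  rcases v with _ | ⟨i, v⟩
  · exact (edgeGen_odeSol _ _ _ _).trans_le (superRate_neg hT).le
  · change edgeGen (fun r => harm (T.sub i) 1 none v (r - T.1 [])) r ≤ 0
    rw [edgeGen_comp_sub, edgeGen_harm]

theorem superFun_cons_le {T : YuleTree} {i : Fin 2} {v : Vertex} {r : ℝ}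
    (h : (i :: v, r) ∈ T.points) : superFun T (i :: v) r ≤ Real.exp (T.1 [] - r) := by
  have := (harm_none_bounds (sub_pos_root T i) zero_le_one (mem_points_sub h)).2
  rw [one_mul, neg_sub] at this
  exact this

theorem superFun_le {T : YuleTree} (hT : 0 < T.1 []) {x : Pt} (h : x ∈ T.points) :
    superFun T x.1 x.2 ≤ superMax T := by
  obtain ⟨v, r⟩ := x
  have h0 := (superRate_neg hT).le
  rcases v with _ | ⟨i, v⟩
  · have h1 := sub_one_sub_exp_mono le_rfl (nil_mem_points h).1
    rw [superFun_nil, superMax]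
    simp at h1
    nlinarith
  · refine (superFun_cons_le h).trans ?_
    have h1 := YuleTree.lt_of_prefix_ne h List.nil_prefix (by simp)
    have h2 := sub_one_sub_exp_mono le_rfl hT.le
    have h3 : Real.exp (T.1 [] - r) ≤ 1 := Real.exp_le_one_iff.2 (by simp at h1; linarith)
    simp at h2
    rw [superMax]
    nlinarith

theorem exists_superFun_ge {T : YuleTree} (hT : 0 < T.1 []) (v : Vertex) :
    ∃ δ > 0, ∀ r, (v, r) ∈ T.points → δ ≤ superFun T v r := by
  have h0 := (superRate_neg hT).le
  rcases v with _ | ⟨i, v⟩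
  · refine ⟨1, one_pos, fun r hr => ?_⟩
    have h1 := sub_one_sub_exp_mono (nil_mem_points hr).1 (nil_mem_points hr).2
    rw [superFun_nil]
    nlinarith
  · have h1 := sub_pos_root T i
    have hv : (i :: v, T.1 (i :: v)) ∈ T.points := by
      refine ⟨le_rfl, Or.inr ⟨by simp, ?_⟩⟩
      have := T.2.lt_child (i :: v).dropLast ((i :: v).getLast (by simp))
      rwa [List.dropLast_append_getLast] at this
    exact ⟨_, (harm_none_pos h1 one_pos (mem_points_sub hv)).1, fun r hr =>
      (harm_none_pos h1 one_pos (mem_points_sub hr)).2⟩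

/-- Finitely many edges, with a positive lower bound on each: a small value of `superFun` thus
certifies a late generation. -/
theorem exists_superFun_ge_of_length {T : YuleTree} (hT : 0 < T.1 []) (n : ℕ) :
    ∃ δ > 0, ∀ x ∈ T.points, x.1.length ≤ n → δ ≤ superFun T x.1 x.2 := by
  choose δ h0 h1 using exists_superFun_ge hT
  obtain ⟨v, -, hv⟩ := (List.finite_length_le (Fin 2) n).exists_minimalFor δ _ ⟨[], by simp⟩
  refine ⟨δ v, h0 v, fun x hx hl => le_trans ?_ (h1 x.1 x.2 hx)⟩
  rcases le_total (δ v) (δ x.1) with h | h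
  · exact h
  · exact hv hl h

theorem superFun_nonneg {T : YuleTree} (hT : 0 < T.1 []) {x : Pt} (hx : x ∈ T.points) :
    0 ≤ superFun T x.1 x.2 := by
  obtain ⟨δ, h0, h1⟩ := exists_superFun_ge hT x.1
  exact h0.le.trans (h1 _ hx)

/-! ### Rays -/

namespace Ray

theorem length_trunc (u : Ray) (n : ℕ) : (u.trunc n).length = n := by simp [Ray.trunc]

theorem getElem_trunc (u : Ray) (n k : ℕ) (h : k < (u.trunc n).length) : (u.trunc n)[k] = u k := by
  simp [Ray.trunc]

theorem trunc_succ (u : Ray) (n : ℕ) : u.trunc (n + 1) = u.trunc n ++ [u n] := by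
  rw [Ray.trunc, List.ofFn_succ_last]
  rfl

theorem trunc_prefix (u : Ray) {m n : ℕ} (h : m ≤ n) : u.trunc m <+: u.trunc n := by
  induction n, h using Nat.le_induction with
  | base => exact List.prefix_rfl
  | succ n _ ih => exact ih.trans (trunc_succ u n ▸ List.prefix_append _ _)

theorem eq_trunc_of_forall {u : Ray} {v : Vertex}
    (h : ∀ k (hk : k < v.length), v[k] = u k) : u.trunc v.length = v := by
  refine List.ext_getElem (length_trunc _ _) fun k h1 h2 => ?_
  rw [getElem_trunc, h]

theorem exists_trunc_eq (v : Vertex) : ∃ u : Ray, u.trunc v.length = v :=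
  ⟨fun k => v[k]?.getD 0, eq_trunc_of_forall fun k hk => by simp [hk]⟩

theorem trunc_prefix_iff {u : Ray} {v : Vertex} {n : ℕ} (hn : v.length ≤ n) :
    v <+: u.trunc n ↔ u.trunc v.length = v := by
  constructor
  · intro h
    have h1 := u.trunc_prefix hn
    exact (List.prefix_of_prefix_length_le h1 h (by rw [length_trunc])).eq_of_length
      (by rw [length_trunc])
  · intro h
    rw [← h]
    exact u.trunc_prefix hn

end Ray

/-- In a Yule-type tree the heights tend to infinity uniformly. -/
theorem IsYuleType.exists_le {z : Vertex → ℝ} (hz : IsYuleType z) (R : ℝ) :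
    ∃ N, ∀ v : Vertex, N ≤ v.length → R ≤ z v := by
  have hmono : ∀ {v w : Vertex}, v <+: w → z v ≤ z w := fun {v w} h =>
    YuleTree.mono_prefix ⟨z, hz⟩ h
  have hopen : ∀ n, IsOpen {u : Ray | R ≤ z (u.trunc n)} := by
    intro n
    have hc : Continuous fun (u : Ray) (i : Fin n) => u i :=
      continuous_pi fun i => continuous_apply _
    exact (isOpen_discrete {a : Fin n → Fin 2 | R ≤ z (List.ofFn a)}).preimage hc
  -- Compactness of the space of rays: the open sets of rays that have reached height `R` by
  -- generation `n` increase with `n` and cover the space.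
  obtain ⟨N, hN⟩ := isCompact_univ.elim_directed_cover (fun n => {u : Ray | R ≤ z (u.trunc n)})
    hopen (fun u _ => by
      obtain ⟨n, hn⟩ := ((hz.tendsto u).eventually_ge_atTop R).exists
      exact Set.mem_iUnion.2 ⟨n, hn⟩)
    (directed_of_isDirected_le fun m n hmn u hu => le_trans (show R ≤ _ from hu)
      (hmono (u.trunc_prefix hmn)))
  refine ⟨N, fun v hv => ?_⟩
  obtain ⟨u, hu⟩ := Ray.exists_trunc_eq v
  have h1 : R ≤ z (u.trunc N) := hN (Set.mem_univ u)
  exact h1.trans (hmono (hu ▸ u.trunc_prefix hv))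

/-! ### Transient paths -/

namespace TreePath

variable {T : YuleTree}

/-- The path leaves the first generations for ever. -/
def Transient (w : TreePath T) : Prop :=
  ∀ n, ∃ r, w.1 r ≠ none ∧ ∀ s ≥ r, ¬ InGen n (w.1 s)

/-- From some time on, the path stays on the edge `v` or beyond. -/
def Settles (w : TreePath T) (v : Vertex) : Prop :=
  ∃ r, w.1 r ≠ none ∧ ∀ s ≥ r, w.1 s ≠ none → Beyond v (w.1 s)

variable {w : TreePath T}

theorem Settles.of_prefix {u v : Vertex} (h : w.Settles v) (huv : u <+: v) : w.Settles u := by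
  obtain ⟨r, hr, h⟩ := h
  refine ⟨r, hr, fun s hs hal => ?_⟩
  obtain ⟨x, hx, hv⟩ := h s hs hal
  exact ⟨x, hx, huv.trans hv⟩

theorem alive_max {r s : ℝ≥0} (hr : w.1 r ≠ none) (hs : w.1 s ≠ none) : w.1 (max r s) ≠ none := by
  rcases max_choice r s with h | h <;> rwa [h]

theorem Settles.prefix {u v : Vertex} (hu : w.Settles u) (hv : w.Settles v)
    (h : u.length ≤ v.length) : u <+: v := by
  obtain ⟨r, hr, hu⟩ := hu
  obtain ⟨s, hs, hv⟩ := hv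
  obtain ⟨x, hx, hux⟩ := hu _ (le_max_left r s) (alive_max hr hs)
  obtain ⟨y, hy, hvy⟩ := hv _ (le_max_right r s) (alive_max hr hs)
  rw [hx] at hy
  cases hy
  exact List.prefix_of_prefix_length_le hux hvy h

/-- Once the generations up to `n` have been left for ever, the ancestor of generation `n + 1` is
fixed: by `exists_crossing`, changing it would require a visit to a branching point of generation
`n`. -/
theorem Transient.exists_settles (h : w.Transient) (n : ℕ) :
    ∃ v : Vertex, v.length = n + 1 ∧ w.Settles v := by
  obtain ⟨r, hr, hn⟩ := h n
  obtain ⟨x, hx⟩ := Option.ne_none_iff_exists'.1 hr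
  have hl : n + 1 ≤ x.1.length := by
    by_contra hl
    exact hn r le_rfl ⟨x, hx, by omega⟩
  refine ⟨x.1.take (n + 1), by simp [hl], r, hr, fun s hs hal => ?_⟩
  have hne : x.1.take (n + 1) ≠ [] := by
    intro h0
    have := congrArg List.length h0
    simp [hl] at this
  by_contra hcon
  have hb : Beyond (x.1.take (n + 1)) (w.1 r) := ⟨x, hx, List.take_prefix _ _⟩
  rw [← List.dropLast_append_getLast hne] at hcon hb
  obtain ⟨q, hq, hwq⟩ := w.exists_crossing hal hcon hb
  rw [Set.uIcc_of_ge hs] at hq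
  exact hn q hq.1 ⟨_, hwq, by simp⟩

theorem Transient.exists_ray (h : w.Transient) :
    ∃ u : Ray, ∀ n, w.Settles (u.trunc n) := by
  choose p hl hp using h.exists_settles
  have hpre : ∀ {m n}, m ≤ n → p m <+: p n := fun {m n} hmn =>
    (hp m).prefix (hp n) (by rw [hl, hl]; omega)
  -- The words `p k` are nested and `p k` has length `k + 1`, so the default letter is never used.
  refine ⟨fun k => (p k)[k]?.getD 0, fun n => (hp n).of_prefix ?_⟩
  have : Ray.trunc (fun k => (p k)[k]?.getD 0) (p n).length = p n := by
    refine Ray.eq_trunc_of_forall fun k hk => ?_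
    have h1 : k < (p k).length := by rw [hl]; omega
    rw [hl] at hk
    have h2 := (hpre (show k ≤ n by omega)).getElem h1
    simp [h1, h2]
  conv_rhs => rw [← this]
  exact Ray.trunc_prefix _ (by rw [hl]; omega)

/-- A ray visited after the path has settled beyond `u.trunc (k + 1)` agrees with `u` at the letter
`k`. Conversely, settling ever farther along `u` forces late visits to the branching points of `u`.
-/
theorem isExitRay_iff {u : Ray} (hu : ∀ n, w.Settles (u.trunc n)) {u' : Ray} :
    IsExitRay w u' ↔ u' = u := by
  constructor
  · intro h
    funext k
    obtain ⟨r, hr, hb⟩ := hu (k + 1)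
    obtain ⟨s, hs, x, hx, m, hm⟩ := h r hr
    obtain ⟨y, hy, hpre⟩ := hb s hs (by simp [hx])
    rw [hx] at hy
    cases hy
    rw [hm] at hpre
    have h1 := hpre.length_le
    rw [Ray.length_trunc, Ray.length_trunc] at h1
    have h2 := hpre.getElem (i := k) (by rw [Ray.length_trunc]; omega)
    rw [Ray.getElem_trunc, Ray.getElem_trunc] at h2
    exact h2.symm
  · rintro rfl
    intro t ht
    obtain ⟨x, hx⟩ := Option.ne_none_iff_exists'.1 ht
    obtain ⟨r, hr, hb⟩ := hu (x.1.length + 1)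
    have hal := alive_max ht hr
    have h1 := hb _ (le_max_right t r) hal
    have h2 : ¬ Beyond (u'.trunc (x.1.length + 1)) (w.1 t) := by
      rintro ⟨y, hy, hpre⟩
      rw [hx] at hy
      cases hy
      have := hpre.length_le
      rw [Ray.length_trunc] at this
      omega
    rw [Ray.trunc_succ] at h1 h2
    obtain ⟨q, hq, hwq⟩ := w.exists_crossing ht h2 h1
    rw [Set.uIcc_of_le (le_max_left _ _)] at hq
    exact ⟨q, hq.1, _, hwq, _, rfl⟩

theorem Transient.existsUnique_exitRay (h : w.Transient) : ∃! u, IsExitRay w u := by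
  obtain ⟨u, hu⟩ := h.exists_ray
  exact ⟨u, (isExitRay_iff hu).2 rfl, fun u' => (isExitRay_iff hu).1⟩

theorem Transient.settles_exitRay (h : w.Transient) (n : ℕ) : w.Settles ((exitRay w).trunc n) := by
  obtain ⟨u, hu⟩ := h.exists_ray
  have h1 : IsExitRay w (exitRay w) := Classical.epsilon_spec ⟨u, (isExitRay_iff hu).2 rfl⟩
  rw [(isExitRay_iff hu).1 h1]
  exact hu n

end TreePath

/-! ### Exit times of Brownian motion -/

namespace TreePath

variable {T : YuleTree} (w : TreePath T)

/-- Edges contain their upper ends, so the first `N` generations form a closed set; survival up to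
`t` is `alive_of_forall_lt`. -/
theorem inGen_of_forall_lt {N : ℕ} {t : ℝ≥0} (h0 : InGen N (w.1 0))
    (h : ∀ s < t, InGen N (w.1 s)) : InGen N (w.1 t) := by
  rcases eq_or_lt_of_le (zero_le (a := t)) with ht | ht
  · rwa [← ht]
  have hal : w.1 t ≠ none :=
    w.alive_of_forall_lt (by obtain ⟨x, hx, -⟩ := h0; simp [hx]) h
  obtain ⟨x, hx⟩ := Option.ne_none_iff_exists'.1 hal
  have hne : (𝓝[<] t).NeBot := nhdsLT_neBot_of_exists_lt ⟨0, ht⟩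
  obtain ⟨s, ⟨y, hy, hn⟩, hs⟩ :=
    ((eventually_nhdsWithin_of_eventually_nhds (w.eventually_near' hx)).and
      (self_mem_nhdsWithin (s := Set.Iio t))).exists
  obtain ⟨y', hy', hl⟩ := h s hs
  rw [hy] at hy'
  cases hy'
  refine ⟨x, hx, ?_⟩
  rcases hn with h1 | ⟨-, i, h1⟩
  · rwa [← h1]
  · rw [h1] at hl; simp at hl; omega

theorem inGen_firstTime {N : ℕ} {t : ℝ≥0} {Q : ℝ≥0 → Prop} (h0 : InGen N (w.1 0))
    (hQ : ∀ s, ¬ InGen N (w.1 s) → Q s) : ∀ s ≤ firstTime t Q, InGen N (w.1 s) := by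
  have h1 : ∀ s < firstTime t Q, InGen N (w.1 s) := fun s hs => by
    by_contra h
    exact not_of_lt_firstTime hs (hQ s h)
  intro s hs
  rcases hs.lt_or_eq with h | h
  · exact h1 s h
  · rw [h]; exact w.inGen_of_forall_lt h0 h1

theorem exists_exit_vertex {N : ℕ} {t : ℝ≥0} (h0 : InGen N (w.1 0))
    (ht : firstTime t (fun s => ¬ InGen N (w.1 s)) < t) :
    ∃ v : Vertex, v.length = N ∧
      w.1 (firstTime t (fun s => ¬ InGen N (w.1 s))) = some (v, T.1 v) :=
  w.eq_branching_of_frequently (w.inGen_firstTime h0 (fun _ h => h) _ le_rfl)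
    ((frequently_of_firstTime_lt ht).filter_mono nhdsWithin_le_nhds)

end TreePath

theorem vertex_mem_points (T : YuleTree) (v : Vertex) : (v, T.1 v) ∈ T.points := by
  refine ⟨le_rfl, ?_⟩
  by_cases h : v = []
  · exact Or.inl ⟨h, T.2.nonneg _⟩
  · refine Or.inr ⟨h, ?_⟩
    have := T.2.lt_child v.dropLast (v.getLast h)
    rwa [List.dropLast_append_getLast] at this

theorem measurableSet_not_inGen {T : YuleTree} (N : ℕ) (s : ℝ≥0) :
    MeasurableSet[canonicalFiltration T s] {w : TreePath T | ¬ InGen N (w.1 s)} :=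
  measurable_coord s (TreePath.measurableSet_inGen N).compl

/-- The first time at which `Q` holds. -/
def hitTime (Q : ℝ≥0 → Prop) : ℝ≥0 := sInf {s | Q s}

theorem firstTime_eq_min {Q : ℝ≥0 → Prop} (h : ∃ s, Q s) (t : ℝ≥0) :
    firstTime t Q = min (hitTime Q) t := by
  have h1 : ({t} : Set ℝ≥0).Nonempty := Set.singleton_nonempty t
  rw [firstTime, csInf_union (s := {s | Q s}) (OrderBot.bddBelow _) h (OrderBot.bddBelow _) h1,
    csInf_singleton]
  rfl

theorem firstTime_eq_hitTime {Q : ℝ≥0 → Prop} (h : ∃ s, Q s) {t : ℝ≥0} (ht : hitTime Q ≤ t) :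
    firstTime t Q = hitTime Q := by rw [firstTime_eq_min h, min_eq_left ht]

section Brownian

variable {T : YuleTree} {x : Pt} {P : Measure (TreePath T)} {F : Vertex → ℝ → ℝ} {N : ℕ}

theorem ae_inGen_zero (hP : IsBrownianLaw T x P) (hN : x.1.length ≤ N) :
    ∀ᵐ w ∂P, InGen N (w.1 0) := by
  filter_upwards [hP.start] with w hw
  exact ⟨x, hw, hN⟩

theorem Glued.exists_bound (hF : Glued T F) (h0 : deriv (F []) 0 = 0) (N : ℕ) :
    ∃ B, ∀ w : TreePath T, ∀ s, InGen N (w.1 s) → |edgeEval F (w.1 s)| ≤ B := by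
  obtain ⟨B, hB⟩ := hF.exists_isBound h0 N
  refine ⟨B, fun w s hs => ?_⟩
  rw [← hF.eval_testFunction h0 N hs]
  exact (hB.eval_le w s).1

/-- Optional stopping before the exit from the first `N` generations. -/
theorem Glued.optional_stopping (hF : Glued T F) (h0 : deriv (F []) 0 = 0)
    (hP : IsBrownianLaw T x P) (hN : x.1.length ≤ N) (t : ℝ≥0) {Q : TreePath T → ℝ≥0 → Prop}
    (hQ : ∀ w r, Q w r → ∀ᶠ s in 𝓝[≥] r, Q w s)
    (hm : ∀ s, MeasurableSet[canonicalFiltration T s] {w | Q w s})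
    (hQN : ∀ w s, ¬ InGen N (w.1 s) → Q w s) :
    Integrable (fun w => edgeEval F (w.1 (firstTime t (Q w))) -
      ∫ s in (0 : ℝ)..firstTime t (Q w), (hF.testFunction h0 N).gen (w.1 s.toNNReal)) P ∧
    ∫ w, (edgeEval F (w.1 (firstTime t (Q w))) -
      ∫ s in (0 : ℝ)..firstTime t (Q w), (hF.testFunction h0 N).gen (w.1 s.toNNReal)) ∂P =
        F x.1 x.2 := by
  obtain ⟨B, hB⟩ := hF.exists_isBound h0 N
  have key := hB.optional_stopping hP t hQ hm
  have hae : (fun w => (hF.testFunction h0 N).eval (w.1 (firstTime t (Q w))) -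
      ∫ s in (0 : ℝ)..firstTime t (Q w), (hF.testFunction h0 N).gen (w.1 s.toNNReal)) =ᵐ[P]
      fun w => edgeEval F (w.1 (firstTime t (Q w))) -
      ∫ s in (0 : ℝ)..firstTime t (Q w), (hF.testFunction h0 N).gen (w.1 s.toNNReal) := by
    filter_upwards [ae_inGen_zero hP hN] with w hw
    rw [hF.eval_testFunction h0 N (w.inGen_firstTime hw (hQN w) _ le_rfl)]
  rw [hF.testFunction_f h0 N hN] at key
  exact ⟨key.1.congr hae, (integral_congr_ae hae).symm.trans key.2⟩

/-- The path does not leave the first `N` generations before time `t`. -/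
def staySet (T : YuleTree) (N : ℕ) (t : ℝ≥0) : Set (TreePath T) :=
  ⋂ q : {q : ℚ // ratTime q < t}, {w | InGen N (w.1 (ratTime q))}

theorem measurableSet_staySet (t : ℝ≥0) : MeasurableSet (staySet T N t) :=
  MeasurableSet.iInter fun _ => measurable_coord' _ (TreePath.measurableSet_inGen N)

theorem mem_staySet {w : TreePath T} {t : ℝ≥0} :
    w ∈ staySet T N t ↔ t ≤ firstTime t (fun s => ¬ InGen N (w.1 s)) := by
  rw [← not_lt, firstTime_lt_iff]
  simp only [staySet, Set.mem_iInter, lt_irrefl, or_false, not_exists, not_and, not_not]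
  constructor
  · intro h r hr
    by_contra hcon
    obtain ⟨q, -, h2, h3⟩ := exists_ratTime (w.eventually_not_inGen hcon) hr
    exact h3 (h ⟨q, h2⟩)
  · exact fun h q => h _ q.2

/-- `timeFun` has generator `1`, so the mean of the exit time truncated at `t` is the mean increment
of `timeFun`, which is bounded on finitely many edges. On the event considered, the truncated time
equals `t`. -/
theorem exists_staySet_le (hT : 0 < T.1 []) (hP : IsBrownianLaw T x P) (hN : x.1.length ≤ N) :
    ∃ C, ∀ t : ℝ≥0, t * P.real (staySet T N t) ≤ C := by
  have := hP.prob
  have hF := glued_timeFun hT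
  have h0 := deriv_timeFun T
  obtain ⟨B, hB⟩ := hF.exists_bound h0 N
  refine ⟨B - timeFun T x.1 x.2, fun t => ?_⟩
  obtain ⟨h1, h2⟩ := hF.optional_stopping h0 hP hN t
    (Q := fun w s => ¬ InGen N (w.1 s)) (fun w r h => w.eventually_not_inGen h)
    (measurableSet_not_inGen N) (fun _ _ h => h)
  have h3 : ∫ w, (B - (staySet T N t).indicator (fun _ => (t : ℝ)) w) ∂P =
      B - t * P.real (staySet T N t) := by
    rw [integral_sub (integrable_const _)
      ((integrable_const _).indicator (measurableSet_staySet t)),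
      integral_indicator (measurableSet_staySet t)]
    simp [mul_comm]
  have h4 : timeFun T x.1 x.2 ≤ B - t * P.real (staySet T N t) := by
    rw [← h2, ← h3]
    refine integral_mono_ae h1 ((integrable_const _).sub
      ((integrable_const _).indicator (measurableSet_staySet t))) ?_
    filter_upwards [ae_inGen_zero hP hN] with w hw
    have hin := w.inGen_firstTime (t := t) hw (Q := fun s => ¬ InGen N (w.1 s)) (fun _ h => h)
    set τ := firstTime t (fun s => ¬ InGen N (w.1 s)) with hτ
    have h5 : ∫ s in (0 : ℝ)..τ, (hF.testFunction h0 N).gen (w.1 s.toNNReal) = τ := by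
      have : ∫ s in (0 : ℝ)..τ, (hF.testFunction h0 N).gen (w.1 s.toNNReal) =
          ∫ s in (0 : ℝ)..τ, 1 := by
        refine intervalIntegral.integral_congr_Ioo_of_le τ.2 fun s hs => ?_
        have hs' : InGen N (w.1 s.toNNReal) := hin _ (Real.toNNReal_le_iff_le_coe.2 hs.2.le)
        change (hF.testFunction h0 N).gen (w.1 s.toNNReal) = 1
        rw [hF.gen_testFunction h0 N hs']
        obtain ⟨y, hy, -⟩ := hs'
        rw [hy]
        exact edgeGen_timeFun _ _ _
      rw [this]; simp
    have h6 := (le_abs_self _).trans (hB w τ (hin τ le_rfl))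
    simp only [h5]
    by_cases hw' : w ∈ staySet T N t
    · have h7 := mem_staySet.1 hw'
      have h8 : (t : ℝ) ≤ τ := h7
      rw [Set.indicator_of_mem hw']
      linarith
    · rw [Set.indicator_of_notMem hw']
      have : (0 : ℝ) ≤ τ := τ.2
      linarith
  linarith

theorem tendsto_staySet (hT : 0 < T.1 []) (hP : IsBrownianLaw T x P) (hN : x.1.length ≤ N) :
    Tendsto (fun n : ℕ => P.real (staySet T N n)) atTop (𝓝 0) := by
  have := hP.prob
  obtain ⟨C, hC⟩ := exists_staySet_le hT hP hN
  have h1 : Tendsto (fun n : ℕ => C / (n : ℝ)) atTop (𝓝 0) :=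
    tendsto_const_div_atTop_nhds_zero_nat C
  refine tendsto_of_tendsto_of_tendsto_of_le_of_le' tendsto_const_nhds h1
    (Eventually.of_forall fun n => measureReal_nonneg) ?_
  filter_upwards [eventually_gt_atTop 0] with n hn
  rw [le_div_iff₀ (by exact_mod_cast hn), mul_comm]
  exact_mod_cast hC n

/-- Brownian motion leaves the first `N` generations. -/
theorem ae_exists_exit (hT : 0 < T.1 []) (hP : IsBrownianLaw T x P) :
    ∀ᵐ w ∂P, ∀ N, ∃ s, ¬ InGen N (w.1 s) := by
  have := hP.prob
  rw [ae_all_iff]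
  intro N
  -- The number of generations is enlarged so as to contain the starting point.
  have h1 : ∀ᵐ w ∂P, ∃ s, ¬ InGen (N + x.1.length) (w.1 s) := by
    have h2 := tendsto_staySet hT hP (N := N + x.1.length) (by omega)
    have h3 : P.real {w | ¬ ∃ s, ¬ InGen (N + x.1.length) (w.1 s)} ≤ 0 := by
      refine ge_of_tendsto' h2 fun n => measureReal_mono ?_
      intro w hw
      simp only [Set.mem_ofPred_eq, not_exists, not_not] at hw
      exact Set.mem_iInter.2 fun q => hw _
    rw [ae_iff]
    exact (measureReal_eq_zero_iff).1 (le_antisymm h3 measureReal_nonneg)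
  filter_upwards [h1] with w ⟨s, hs⟩
  exact ⟨s, fun h => hs (h.mono (by omega))⟩

/-- Harmonic functions at the first time at which `Q` holds. -/
theorem Glued.integral_hitTime (hF : Glued T F) (h0 : deriv (F []) 0 = 0) (hT : 0 < T.1 [])
    (hP : IsBrownianLaw T x P) (hN : x.1.length ≤ N) {Q : TreePath T → ℝ≥0 → Prop}
    (hQ : ∀ w r, Q w r → ∀ᶠ s in 𝓝[≥] r, Q w s)
    (hm : ∀ s, MeasurableSet[canonicalFiltration T s] {w | Q w s})
    (hQN : ∀ w s, ¬ InGen N (w.1 s) → Q w s)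
    (hgen : ∀ w s, ¬ Q w s → edgeEval (fun v => edgeGen (F v)) (w.1 s) = 0) :
    Integrable (fun w => edgeEval F (w.1 (hitTime (Q w)))) P ∧
    ∫ w, edgeEval F (w.1 (hitTime (Q w))) ∂P = F x.1 x.2 := by
  have := hP.prob
  obtain ⟨B, hB⟩ := hF.exists_bound h0 N
  have h1 : ∀ t : ℝ≥0, Integrable (fun w => edgeEval F (w.1 (firstTime t (Q w)))) P ∧
      ∫ w, edgeEval F (w.1 (firstTime t (Q w))) ∂P = F x.1 x.2 := by
    intro t
    have h2 := hF.optional_stopping h0 hP hN t hQ hm hQN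
    have h3 : (fun w => edgeEval F (w.1 (firstTime t (Q w))) - ∫ s in (0 : ℝ)..firstTime t (Q w),
        (hF.testFunction h0 N).gen (w.1 s.toNNReal)) =ᵐ[P]
        fun w => edgeEval F (w.1 (firstTime t (Q w))) := by
      filter_upwards [ae_inGen_zero hP hN] with w hw
      have hin := w.inGen_firstTime (t := t) hw (hQN w)
      have : ∫ s in (0 : ℝ)..firstTime t (Q w), (hF.testFunction h0 N).gen (w.1 s.toNNReal) =
          ∫ s in (0 : ℝ)..firstTime t (Q w), 0 := by
        refine intervalIntegral.integral_congr_Ioo_of_le (firstTime t (Q w)).2 fun s hs => ?_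
        have hs1 : s.toNNReal < firstTime t (Q w) := (Real.toNNReal_lt_iff_lt_coe hs.1.le).2 hs.2
        change (hF.testFunction h0 N).gen (w.1 s.toNNReal) = 0
        rw [hF.gen_testFunction h0 N (hin _ hs1.le)]
        exact hgen w _ (not_of_lt_firstTime hs1)
      rw [this]
      simp
    exact ⟨h2.1.congr h3, (integral_congr_ae h3).symm.trans h2.2⟩
  have hlim : ∀ᵐ w ∂P, Tendsto (fun n : ℕ => edgeEval F (w.1 (firstTime n (Q w)))) atTop
      (𝓝 (edgeEval F (w.1 (hitTime (Q w))))) := by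
    filter_upwards [ae_exists_exit hT hP] with w hw
    obtain ⟨s, hs⟩ := hw N
    obtain ⟨n, hn⟩ := exists_nat_ge (hitTime (Q w))
    refine tendsto_const_nhds.congr' ?_
    filter_upwards [eventually_ge_atTop n] with m hm
    rw [firstTime_eq_hitTime ⟨s, hQN w s hs⟩ (hn.trans (by exact_mod_cast hm))]
  have hbound : ∀ n : ℕ, ∀ᵐ w ∂P, ‖edgeEval F (w.1 (firstTime n (Q w)))‖ ≤ B := by
    intro n
    filter_upwards [ae_inGen_zero hP hN] with w hw
    exact hB w _ (w.inGen_firstTime hw (hQN w) _ le_rfl)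
  have hmeas := aestronglyMeasurable_of_tendsto_ae atTop (fun n : ℕ => (h1 n).1.1) hlim
  refine ⟨Integrable.of_bound hmeas B ?_, ?_⟩
  · filter_upwards [hlim, ae_all_iff.2 hbound] with w h2 h3
    exact le_of_tendsto' h2.norm h3
  · have h2 := tendsto_integral_of_dominated_convergence (fun _ => B) (fun n : ℕ => (h1 n).1.1)
      (integrable_const B) hbound hlim
    simp only [(h1 _).2] at h2
    exact tendsto_nhds_unique h2 tendsto_const_nhds

end Brownian

/-! ### Transience -/

theorem le_firstTime {t : ℝ≥0} {Q : ℝ≥0 → Prop} {a : ℝ≥0} (h : ∀ s, Q s → a ≤ s) (ht : a ≤ t) :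
    a ≤ firstTime t Q := by
  refine le_csInf ⟨t, Or.inr rfl⟩ ?_
  rintro s (hs | hs)
  · exact h s hs
  · rw [Set.mem_singleton_iff.1 hs]; exact ht

theorem exists_not_inGen_ratTime {T : YuleTree} {w : TreePath T} {N : ℕ} {r s : ℝ≥0} (hrs : r < s)
    (hr : ¬ InGen N (w.1 r)) : ∃ q, ratTime q < s ∧ ¬ InGen N (w.1 (ratTime q)) := by
  obtain ⟨q, -, h2, h3⟩ := exists_ratTime (w.eventually_not_inGen hr) hrs
  exact ⟨q, h2, h3⟩

/-- After the exit from the first `N` generations, the function `F` exceeds `δ`, or the path leaves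
the first `M` generations. -/
def ReturnCond (T : YuleTree) (F : Vertex → ℝ → ℝ) (N M : ℕ) (δ : ℝ) (w : TreePath T) (s : ℝ≥0) :
    Prop :=
  (δ < edgeEval F (w.1 s) ∧ ∃ q, ratTime q < s ∧ ¬ InGen N (w.1 (ratTime q))) ∨
    ¬ InGen M (w.1 s)

section ReturnCond

variable {T : YuleTree} {F : Vertex → ℝ → ℝ} {N M : ℕ} {δ : ℝ}

theorem ReturnCond.eventually (hF : Glued T F) {w : TreePath T} {r : ℝ≥0}
    (h : ReturnCond T F N M δ w r) : ∀ᶠ s in 𝓝[≥] r, ReturnCond T F N M δ w s := by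
  rcases h with ⟨h1, q, hq, h2⟩ | h
  · have hc := w.continuousWithinAt_edgeEval (fun v => (hF.contDiff v).continuous) hF.matching r
    filter_upwards [hc.eventually_const_lt h1, self_mem_nhdsWithin] with s hs hs'
    exact Or.inl ⟨hs, q, hq.trans_le hs', h2⟩
  · filter_upwards [w.eventually_not_inGen h] with s hs
    exact Or.inr hs

theorem measurableSet_returnCond (hF : Glued T F) (s : ℝ≥0) :
    MeasurableSet[canonicalFiltration T s] {w | ReturnCond T F N M δ w s} := by
  have h1 : MeasurableSet {a : State | δ < edgeEval F a} :=
    measurable_edgeEval (fun v => (hF.contDiff v).continuous.measurable) measurableSet_Ioi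
  have h2 : {w : TreePath T | ReturnCond T F N M δ w s} =
      ({w | δ < edgeEval F (w.1 s)} ∩
        ⋃ q : {q : ℚ // ratTime q < s}, {w | ¬ InGen N (w.1 (ratTime q))}) ∪
      {w | ¬ InGen M (w.1 s)} := by
    ext w
    simp [ReturnCond]
  rw [h2]
  refine MeasurableSet.union (MeasurableSet.inter (measurable_coord s h1) ?_)
    (measurableSet_not_inGen M s)
  exact MeasurableSet.iUnion fun q =>
    (canonicalFiltration T).mono q.2.le _ (measurableSet_not_inGen N _)

end ReturnCond

section Brownian

variable {T : YuleTree} {P : Measure (TreePath T)} {N : ℕ}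

/-- The path exceeds the level `δ` of `superFun T` before time `t` and before it leaves the first
`M` generations, after it has left the first `N` generations. -/
def returnSet (T : YuleTree) (N M : ℕ) (δ : ℝ) (t : ℝ≥0) : Set (TreePath T) :=
  {w | ∃ s < t, ∃ r < s, δ < edgeEval (superFun T) (w.1 s) ∧ ¬ InGen N (w.1 r) ∧
    ∀ s' ≤ s, InGen M (w.1 s')}

/-- A maximal inequality. `X` and `Y` are the compensated process stopped at the return `σ` and at
the exit `τ`; they have the same mean. As the generator of `superFun` is nonpositive, `X - Y` is at
least the increment of `superFun` from `τ` to `σ`. Adding a bound for the value at `τ`, which is `ε`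
after a true exit and `superMax T` otherwise, gives `Z ≥ 0` with `Z ≥ δ` on the return event, and
Markov's inequality applies. -/
theorem measure_returnSet_le (hT : 0 < T.1 []) (hP : IsBrownianLaw T rootPt P) {M : ℕ}
    (hNM : N ≤ M) {δ ε : ℝ} (hδ : 0 < δ) (hε0 : 0 ≤ ε)
    (hε : ∀ v : Vertex, v.length = N → superFun T v (T.1 v) ≤ ε) (t : ℝ≥0) :
    δ * P.real (returnSet T N M δ t) ≤ ε + superMax T * P.real (staySet T N t) := by
  have := hP.prob
  have hF := glued_superFun hT
  have h0 := deriv_superFun T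
  have hroot : rootPt ∈ T.points := ⟨T.2.nonneg _, Or.inl ⟨rfl, le_rfl⟩⟩
  have hmax : 0 ≤ superMax T := (superFun_nonneg hT hroot).trans (superFun_le hT hroot)
  have hX := hF.optional_stopping h0 hP (N := M) (by simp [rootPt]) t
    (Q := ReturnCond T (superFun T) N M δ) (fun w r h => h.eventually hF)
    (measurableSet_returnCond hF) (fun w s h => Or.inr h)
  have hY := hF.optional_stopping h0 hP (N := M) (by simp [rootPt]) t
    (Q := fun w s => ¬ InGen N (w.1 s)) (fun w r h => w.eventually_not_inGen h)
    (measurableSet_not_inGen N) (fun w s h h' => h (h'.mono hNM))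
  obtain ⟨hX1, hX2⟩ := hX
  obtain ⟨hY1, hY2⟩ := hY
  set X := fun w : TreePath T => edgeEval (superFun T)
    (w.1 (firstTime t (ReturnCond T (superFun T) N M δ w))) -
      ∫ s in (0 : ℝ)..firstTime t (ReturnCond T (superFun T) N M δ w),
        (hF.testFunction h0 M).gen (w.1 s.toNNReal)
  set Y := fun w : TreePath T => edgeEval (superFun T)
    (w.1 (firstTime t fun s => ¬ InGen N (w.1 s))) -
      ∫ s in (0 : ℝ)..firstTime t (fun s => ¬ InGen N (w.1 s)),
        (hF.testFunction h0 M).gen (w.1 s.toNNReal)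
  set Z := fun w => X w - Y w + (ε + (staySet T N t).indicator (fun _ => superMax T) w)
  have hind : Integrable ((staySet T N t).indicator fun _ => superMax T) P :=
    (integrable_const _).indicator (measurableSet_staySet t)
  have hZ : Integrable Z P := (hX1.sub hY1).add ((integrable_const _).add hind)
  have hZint : ∫ w, Z w ∂P = ε + superMax T * P.real (staySet T N t) := by
    have e1 : ∫ w, Z w ∂P = ∫ w, (X w - Y w) ∂P +
        ∫ w, (ε + (staySet T N t).indicator (fun _ => superMax T) w) ∂P :=
      integral_add (hX1.sub hY1) ((integrable_const _).add hind)
    rw [e1, integral_sub hX1 hY1, hX2, hY2, integral_add (integrable_const _) hind,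
      integral_indicator (measurableSet_staySet t)]
    simp [mul_comm]
  have hkey : ∀ᵐ w ∂P, 0 ≤ Z w ∧ (w ∈ returnSet T N M δ t → δ ≤ Z w) := by
    filter_upwards [ae_inGen_zero hP (N := N) (by simp [rootPt])] with w hw0
    set σ := firstTime t (ReturnCond T (superFun T) N M δ w) with hσ
    set τ := firstTime t (fun s => ¬ InGen N (w.1 s)) with hτ
    have hin : ∀ s ≤ σ, InGen M (w.1 s) :=
      w.inGen_firstTime (hw0.mono hNM) (fun s h => Or.inr h)
    have hinτ : ∀ s ≤ τ, InGen N (w.1 s) := w.inGen_firstTime hw0 (fun s h => h)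
    have hle : τ ≤ σ := by
      refine le_firstTime ?_ firstTime_le
      rintro s (⟨-, q, hq, h⟩ | h)
      · exact (firstTime_le_of (Q := fun s => ¬ InGen N (w.1 s)) h).trans hq.le
      · exact firstTime_le_of (Q := fun s => ¬ InGen N (w.1 s)) fun h' => h (h'.mono hNM)
    have hint := (hF.exists_isBound h0 M).choose_spec.intervalIntegrable w
    have h1 : X w - Y w = edgeEval (superFun T) (w.1 σ) - edgeEval (superFun T) (w.1 τ) -
        ∫ s in (τ : ℝ)..σ, (hF.testFunction h0 M).gen (w.1 s.toNNReal) := by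
      have := intervalIntegral.integral_interval_sub_left (hint 0 σ) (hint 0 τ)
      simp only [X, Y]
      rw [← this]
      ring
    have h2 : ∫ s in (τ : ℝ)..σ, (hF.testFunction h0 M).gen (w.1 s.toNNReal) ≤ 0 := by
      have h3 : 0 ≤ ∫ s in (τ : ℝ)..σ, -(hF.testFunction h0 M).gen (w.1 s.toNNReal) := by
        refine intervalIntegral.integral_nonneg (by exact_mod_cast hle) fun s hs => ?_
        have hs' : InGen M (w.1 s.toNNReal) := hin _ (Real.toNNReal_le_iff_le_coe.2 hs.2)
        rw [hF.gen_testFunction h0 M hs']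
        obtain ⟨y, hy, -⟩ := hs'
        rw [hy]
        exact neg_nonneg.2 (edgeGen_superFun_nonpos hT _ _)
      rw [intervalIntegral.integral_neg] at h3
      linarith
    have h3 : edgeEval (superFun T) (w.1 τ) ≤
        ε + (staySet T N t).indicator (fun _ => superMax T) w := by
      by_cases hw : w ∈ staySet T N t
      · rw [Set.indicator_of_mem hw]
        obtain ⟨y, hy, -⟩ := hinτ τ le_rfl
        have := superFun_le hT (w.mem hy)
        rw [hy]
        change superFun T y.1 y.2 ≤ _
        linarith
      · rw [Set.indicator_of_notMem hw, add_zero]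
        rw [mem_staySet, not_le] at hw
        obtain ⟨v, hv, hwv⟩ := w.exists_exit_vertex hw0 hw
        rw [hwv]
        exact hε v hv
    have h4 : 0 ≤ edgeEval (superFun T) (w.1 σ) := by
      obtain ⟨y, hy, -⟩ := hin σ le_rfl
      rw [hy]
      exact superFun_nonneg hT (w.mem hy)
    refine ⟨?_, fun hw => ?_⟩
    · simp only [Z]
      linarith
    · obtain ⟨s, hst, r, hrs, hδ, hr, hs⟩ := hw
      -- If `σ < s`, the stopping condition holds at times arbitrarily close to `σ` on its right.
      -- There it cannot be the exit from `M` generations, excluded up to `s`, so the level `δ` is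
      -- exceeded and right continuity passes this to `σ`.
      have h5 : δ ≤ edgeEval (superFun T) (w.1 σ) := by
        have hQs : ReturnCond T (superFun T) N M δ w s :=
          Or.inl ⟨hδ, exists_not_inGen_ratTime hrs hr⟩
        have hσs : σ ≤ s := firstTime_le_of hQs
        rcases hσs.eq_or_lt with h | h
        · rw [h]; exact hδ.le
        · by_contra hcon
          have hc := w.continuousWithinAt_edgeEval (fun v => (hF.contDiff v).continuous)
            hF.matching σ
          have h6 : ∀ᶠ u in 𝓝[≥] σ, u < s := mem_nhdsWithin_of_mem_nhds (Iio_mem_nhds h)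
          obtain ⟨u, hu, hu1, hu2⟩ := ((frequently_of_firstTime_lt (h.trans hst)).and_eventually
            ((hc.eventually_lt_const (not_le.1 hcon)).and h6)).exists
          rcases hu with ⟨hu3, -⟩ | hu3
          · exact lt_asymm hu3 hu1
          · exact hu3 (hs u hu2.le)
      simp only [Z]
      linarith
  calc δ * P.real (returnSet T N M δ t) ≤ δ * P.real {w | δ ≤ Z w} := by
        refine mul_le_mul_of_nonneg_left ?_ hδ.le
        exact ENNReal.toReal_mono (measure_ne_top _ _)
          (measure_mono_ae (hkey.mono fun w hw => hw.2))
    _ ≤ _ := (mul_meas_ge_le_integral_of_nonneg (hkey.mono fun w hw => hw.1) hZ δ).trans_eq hZint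

/-- The time horizon and the outer generation tend to infinity together: the return events increase,
and the probability of staying vanishes. -/
theorem measure_return_le (hT : 0 < T.1 []) (hP : IsBrownianLaw T rootPt P) {δ ε : ℝ}
    (hδ : 0 < δ) (hε0 : 0 ≤ ε) (hε : ∀ v : Vertex, v.length = N → superFun T v (T.1 v) ≤ ε) :
    P.real {w | ∃ s, ∃ r < s, δ < edgeEval (superFun T) (w.1 s) ∧ ¬ InGen N (w.1 r)} ≤ ε / δ := by
  have := hP.prob
  set G : ℕ → Set (TreePath T) := fun j => returnSet T N (N + j) δ j
  have hmono : Monotone G := by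
    rintro i j hij w ⟨s, hs, r, hr, h1, h2, h3⟩
    exact ⟨s, hs.trans_le (by exact_mod_cast hij), r, hr, h1, h2,
      fun s' hs' => (h3 s' hs').mono (by omega)⟩
  have hsub : {w : TreePath T | ∃ s, ∃ r < s, δ < edgeEval (superFun T) (w.1 s) ∧
      ¬ InGen N (w.1 r)} ⊆ ⋃ j, G j := by
    rintro w ⟨s, r, hr, h1, h2⟩
    have hal : w.1 s ≠ none := by
      intro h
      rw [h] at h1
      exact lt_asymm hδ h1
    obtain ⟨M, hM⟩ := w.exists_inGen hal
    obtain ⟨j, hj⟩ := exists_nat_gt s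
    refine Set.mem_iUnion.2 ⟨max M j, s, hj.trans_le (by exact_mod_cast le_max_right _ _), r, hr,
      h1, h2, fun s' hs' => (hM s' hs').mono ?_⟩
    have := le_max_left M j
    omega
  have hlim : Tendsto (fun j => P.real (G j)) atTop (𝓝 (P.real (⋃ j, G j))) :=
    (ENNReal.tendsto_toReal (measure_ne_top _ _)).comp (tendsto_measure_iUnion_atTop hmono)
  have hlim2 : Tendsto (fun j : ℕ => (ε + superMax T * P.real (staySet T N j)) / δ) atTop
      (𝓝 ((ε + superMax T * 0) / δ)) :=
    (((tendsto_staySet hT hP (by simp [rootPt])).const_mul _).const_add _).div_const _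
  refine (measureReal_mono hsub).trans ?_
  rw [mul_zero, add_zero] at hlim2
  refine le_of_tendsto_of_tendsto' hlim hlim2 fun j => ?_
  rw [le_div_iff₀ hδ, mul_comm]
  exact measure_returnSet_le hT hP (by omega) hδ hε0 hε j

theorem ae_superFun_le (hT : 0 < T.1 []) (hP : IsBrownianLaw T rootPt P) {δ : ℝ} (hδ : 0 < δ) :
    ∀ᵐ w ∂P, ∃ N, ∀ s, ∀ r < s, ¬ InGen N (w.1 r) → edgeEval (superFun T) (w.1 s) ≤ δ := by
  have := hP.prob
  rw [ae_iff]
  refine (measureReal_eq_zero_iff).1 (le_antisymm (le_of_forall_pos_le_add fun ε hε => ?_)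
    measureReal_nonneg)
  rw [zero_add]
  -- From this generation on, `superFun ≤ exp (T.1 [] - r) ≤ ε * δ` at the branching points, which
  -- makes the return probability at most `ε`. Using `N + 1` excludes the root label, for which this
  -- bound is not available.
  obtain ⟨N, hN⟩ := T.2.exists_le (T.1 [] - Real.log (ε * δ))
  refine (measureReal_mono (s₂ := {w | ∃ s, ∃ r < s, δ < edgeEval (superFun T) (w.1 s) ∧
    ¬ InGen (N + 1) (w.1 r)}) ?_).trans
    ((measure_return_le hT hP hδ (N := N + 1) (mul_pos hε hδ).le ?_).trans_eq
      (mul_div_cancel_right₀ _ hδ.ne'))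
  · intro w hw
    simp only [Set.mem_ofPred_eq, not_exists] at hw
    have := hw (N + 1)
    push Not at this
    obtain ⟨s, r, hrs, h1, h2⟩ := this
    exact ⟨s, r, hrs, h2, h1⟩
  · intro v hv
    rcases v with _ | ⟨i, v⟩
    · simp at hv
    · refine (superFun_cons_le (vertex_mem_points T _)).trans ?_
      have h1 := hN (i :: v) (by omega)
      rw [← Real.exp_log (mul_pos hε hδ)]
      gcongr
      linarith

/-- Along the path `superFun` becomes and stays arbitrarily small after suitable exits, while it is
bounded below on every finite set of generations. -/
theorem ae_transient (hT : 0 < T.1 []) (hP : IsBrownianLaw T rootPt P) :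
    ∀ᵐ w ∂P, w.Transient := by
  have h1 : ∀ᵐ w ∂P, ∀ k : ℕ, ∃ N, ∀ s, ∀ r < s, ¬ InGen N (w.1 r) →
      edgeEval (superFun T) (w.1 s) ≤ 1 / (k + 1) :=
    ae_all_iff.2 fun k => ae_superFun_le hT hP (by positivity)
  filter_upwards [h1, ae_exists_exit hT hP, hP.start] with w hw hex hst n
  obtain ⟨δ, hδ, hq⟩ := exists_superFun_ge_of_length hT n
  obtain ⟨k, hk⟩ := exists_nat_one_div_lt hδ
  obtain ⟨N, hN⟩ := hw k
  obtain ⟨t, ht⟩ := hex N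
  set τ := firstTime (t + 1) (fun s => ¬ InGen N (w.1 s)) with hτ
  have h0 : InGen N (w.1 0) := ⟨_, hst, by simp [rootPt]⟩
  have hlt : τ < t + 1 := (firstTime_le_of (Q := fun s => ¬ InGen N (w.1 s)) ht).trans_lt
    (lt_add_one t)
  have hal : w.1 τ ≠ none := by
    obtain ⟨v, -, hv⟩ := w.exists_exit_vertex h0 hlt
    rw [hv]; simp
  have hev : ∀ᶠ s in 𝓝[≥] τ, w.1 s ≠ none :=
    mem_nhdsWithin_of_mem_nhds (w.isOpen_alive.mem_nhds hal)
  -- Just after the exit the path is still alive and has been past generation `N` at a strictly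
  -- earlier time, as the bound requires.
  obtain ⟨q, hq1, hq2, hq3⟩ := exists_ratTime hev hlt
  obtain ⟨r, hr1, hr2⟩ := firstTime_lt_iff.1 hq1 |>.resolve_right (fun h => lt_asymm h hq2)
  refine ⟨ratTime q, hq3, fun s hs hin => ?_⟩
  obtain ⟨y, hy, hl⟩ := hin
  have h2 := hN s r (hr1.trans_le hs) hr2
  rw [hy] at h2
  have h3 := hq y (w.mem hy) hl
  change superFun T y.1 y.2 ≤ _ at h2
  linarith

end Brownian

/-! ### Cylinders -/

/-- The rays that pass through the edge `v`. -/
def cylinder (v : Vertex) : Set Ray := {u | u.trunc v.length = v}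

theorem measurableSet_cylinder (v : Vertex) : MeasurableSet (cylinder v) := by
  have h : Measurable fun (u : Ray) (i : Fin v.length) => u i :=
    measurable_pi_lambda _ fun i => measurable_pi_apply _
  exact h (MeasurableSet.of_discrete (s := {a : Fin v.length → Fin 2 | List.ofFn a = v}))

theorem isPiSystem_cylinder : IsPiSystem (Set.range cylinder) := by
  have key : ∀ v v' : Vertex, v.length ≤ v'.length → (cylinder v ∩ cylinder v').Nonempty →
      cylinder v ∩ cylinder v' = cylinder v' := by
    rintro v v' hl ⟨u, hu, hu'⟩
    refine Set.inter_eq_right.2 fun u' h => ?_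
    have hp : v <+: v' := by
      rw [← show u.trunc v'.length = v' from hu']
      exact (Ray.trunc_prefix_iff hl).2 hu
    rw [← show u'.trunc v'.length = v' from h] at hp
    exact (Ray.trunc_prefix_iff hl).1 hp
  rintro _ ⟨v, rfl⟩ _ ⟨v', rfl⟩ h
  rcases le_total v.length v'.length with hl | hl
  · exact ⟨v', (key v v' hl h).symm⟩
  · rw [Set.inter_comm] at h ⊢
    exact ⟨v, (key v' v hl h).symm⟩

theorem generateFrom_cylinder :
    (inferInstance : MeasurableSpace Ray) = MeasurableSpace.generateFrom (Set.range cylinder) := by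
  refine le_antisymm ?_ (MeasurableSpace.generateFrom_le ?_)
  · refine iSup_le fun k => measurable_iff_comap_le.1 ?_
    refine @measurable_to_countable' _ _ _ _ (MeasurableSpace.generateFrom _) _ fun i => ?_
    have : (fun u : Ray => u k) ⁻¹' {i} =
        ⋃ v : {v : Vertex // v.length = k + 1 ∧ v[k]? = some i}, cylinder v.1 := by
      ext u
      simp only [Set.mem_preimage, Set.mem_singleton_iff, Set.mem_iUnion]
      constructor
      · intro h
        refine ⟨⟨u.trunc (k + 1), Ray.length_trunc _ _, ?_⟩, ?_⟩
        · rw [List.getElem?_eq_getElem (by rw [Ray.length_trunc]; omega), Ray.getElem_trunc, h]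
        · exact congrArg u.trunc (Ray.length_trunc u (k + 1))
      · rintro ⟨⟨v, hv, hi⟩, h⟩
        have h' : u.trunc v.length = v := h
        rw [← h', List.getElem?_eq_getElem (by rw [Ray.length_trunc]; omega),
          Ray.getElem_trunc] at hi
        exact Option.some.inj hi
    rw [this]
    exact MeasurableSet.iUnion fun v => MeasurableSpace.measurableSet_generateFrom ⟨v, rfl⟩
  · rintro _ ⟨v, rfl⟩
    exact measurableSet_cylinder v

/-! ### The law of the exit ray -/

section ExitLaw

variable {T : YuleTree} {x : Pt} {P : Measure (TreePath T)}

theorem TreePath.exists_hit_vertex (w : TreePath T) {N : ℕ} (h0 : InGen N (w.1 0))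
    (hex : ∃ s, ¬ InGen N (w.1 s)) : ∃ v : Vertex, v.length = N ∧
      w.1 (hitTime fun s => ¬ InGen N (w.1 s)) = some (v, T.1 v) := by
  have h1 := firstTime_eq_hitTime hex (le_self_add (b := 1))
  rw [← h1]
  refine w.exists_exit_vertex h0 ?_
  rw [h1]
  exact lt_add_one _

/-- Up to the settling time the path sees only finitely many generations, so exits from later
generations occur after it. -/
theorem TreePath.Settles.eventually_hit {w : TreePath T} {u : Vertex} (h : w.Settles u) :
    ∃ K, ∀ N ≥ K, ∀ v, v.length = N →
      w.1 (hitTime fun s => ¬ InGen N (w.1 s)) = some (v, T.1 v) → u <+: v := by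
  obtain ⟨r, hr, hb⟩ := h
  obtain ⟨M, hM⟩ := w.exists_inGen hr
  refine ⟨M + 1, fun N hN v hv hw => ?_⟩
  have h1 : r ≤ hitTime fun s => ¬ InGen N (w.1 s) := by
    by_contra hcon
    obtain ⟨y, hy, hl⟩ := hM _ (not_le.1 hcon).le
    rw [hw] at hy
    cases hy
    simp only at hl
    omega
  obtain ⟨y, hy, hp⟩ := hb _ h1 (by rw [hw]; simp)
  rw [hw] at hy
  cases hy
  exact hp

/-- Started from the target probability itself, the harmonic function has no flow at the root and is
admissible for the reflected motion. -/
theorem deriv_harm_target (T : YuleTree) (g : Option Vertex) :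
    deriv (harm T (targetProb T g) g []) 0 = 0 := by
  change deriv (odeSol _ _ _) 0 = 0
  rw [deriv_odeSol_zero]
  simp

/-- At the successive exit vertices the harmonic function with target `v` has constant mean
`exitProb T v`, and it converges almost surely to the indicator that the exit ray passes through
`v`. The same limit yields null measurability of this event. -/
theorem exitRay_law (hT : 0 < T.1 []) (hP : IsBrownianLaw T rootPt P) (v : Vertex) :
    NullMeasurableSet (exitRay ⁻¹' cylinder v) P ∧
      P.real (exitRay ⁻¹' cylinder v) = exitProb T v := by
  have := hP.prob
  set a := exitProb T v
  obtain ⟨ha0, ha1⟩ := exitProb_mem T v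
  set F := harm T a (some v)
  have hF : Glued T F := glued_harm hT _ _
  have hgen : ∀ s : State, edgeEval (fun v => edgeGen (F v)) s = 0 := by
    rintro (_ | y)
    · rfl
    · exact edgeGen_harm _ _ _ _ _
  set f : ℕ → TreePath T → ℝ := fun k w =>
    edgeEval F (w.1 (hitTime fun s => ¬ InGen (v.length + k) (w.1 s)))
  have hf : ∀ k, Integrable (f k) P ∧ ∫ w, f k w ∂P = a := by
    intro k
    have h := hF.integral_hitTime (deriv_harm_target T (some v)) hT hP
      (N := v.length + k) (by simp [rootPt]) (Q := fun w s => ¬ InGen (v.length + k) (w.1 s))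
      (fun w r h => w.eventually_not_inGen h) (measurableSet_not_inGen _) (fun _ _ h => h)
      (fun w s _ => hgen _)
    refine ⟨h.1, h.2.trans ?_⟩
    change harm T a (some v) [] 0 = a
    simp [harm_nil]
  have hvert : ∀ᵐ w ∂P, ∀ k, ∃ y : Vertex, y.length = v.length + k ∧
      w.1 (hitTime fun s => ¬ InGen (v.length + k) (w.1 s)) = some (y, T.1 y) := by
    filter_upwards [ae_exists_exit hT hP, hP.start] with w hw hst k
    exact w.exists_hit_vertex ⟨_, hst, by simp [rootPt]⟩ (hw _)
  have hclose : ∀ w : TreePath T, ∀ k (y : Vertex), y.length = v.length + k →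
      w.1 (hitTime fun s => ¬ InGen (v.length + k) (w.1 s)) = some (y, T.1 y) →
      |f k w - if v <+: y then 1 else 0| ≤ Real.exp (T.1 v - T.1 y) := by
    intro w k y hy hw
    simp only [f, hw]
    exact harm_tendsto_indicator hT ha0 ha1 (show v.length ≤ y.length by omega)
      (vertex_mem_points T y)
  have hlim : ∀ᵐ w ∂P, Tendsto (fun k => f k w) atTop
      (𝓝 ((exitRay ⁻¹' cylinder v).indicator (fun _ => 1) w)) := by
    filter_upwards [ae_transient hT hP, hvert] with w htr hw
    rw [Metric.tendsto_atTop]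
    intro ε hε
    obtain ⟨K, hK⟩ := (htr.settles_exitRay v.length).eventually_hit
    obtain ⟨K', hK'⟩ := T.2.exists_le (T.1 v - Real.log (ε / 2))
    refine ⟨max K K', fun k hk => ?_⟩
    obtain ⟨y, hy, hwy⟩ := hw k
    have h1 := hclose w k y hy hwy
    have h2 := hK (v.length + k) (by have := le_max_left K K'; omega) y hy hwy
    have h3 := hK' y (by have := le_max_right K K'; omega)
    have h4 : (if v <+: y then (1 : ℝ) else 0) = (exitRay ⁻¹' cylinder v).indicator (fun _ => 1) w := by
      have h5 : v <+: y ↔ w ∈ exitRay ⁻¹' cylinder v := by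
        constructor
        · intro h
          exact (List.prefix_of_prefix_length_le h2 h (by rw [Ray.length_trunc])).eq_of_length
            (by rw [Ray.length_trunc])
        · intro h
          rwa [show (exitRay w).trunc v.length = v from h] at h2
      by_cases hc : v <+: y
      · rw [if_pos hc, Set.indicator_of_mem (h5.1 hc)]
      · rw [if_neg hc, Set.indicator_of_notMem (fun h => hc (h5.2 h))]
    rw [Real.dist_eq, ← h4]
    calc _ ≤ Real.exp (T.1 v - T.1 y) := h1
      _ ≤ Real.exp (Real.log (ε / 2)) := by gcongr; linarith
      _ = ε / 2 := Real.exp_log (by positivity)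
      _ < ε := by linarith
  have hbound : ∀ k, ∀ᵐ w ∂P, ‖f k w‖ ≤ 1 + Real.exp (T.1 v) := by
    intro k
    filter_upwards [hvert] with w hw
    obtain ⟨y, hy, hwy⟩ := hw k
    have h1 := hclose w k y hy hwy
    have h2 : |(if v <+: y then (1 : ℝ) else 0)| ≤ 1 := by split_ifs <;> simp
    have h3 : Real.exp (T.1 v - T.1 y) ≤ Real.exp (T.1 v) := by
      gcongr
      linarith [T.2.nonneg y]
    rw [Real.norm_eq_abs]
    have h4 := abs_sub_abs_le_abs_sub (f k w) (if v <+: y then 1 else 0)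
    linarith
  have hmeas := aestronglyMeasurable_of_tendsto_ae atTop (fun k => (hf k).1.1) hlim
  have hset : NullMeasurableSet (exitRay ⁻¹' cylinder v) P := by
    have h1 := hmeas.aemeasurable.nullMeasurable (measurableSet_singleton (1 : ℝ))
    convert h1 using 1
    ext w
    simp
  refine ⟨hset, ?_⟩
  have h2 := tendsto_integral_of_dominated_convergence _ (fun k => (hf k).1.1)
    (integrable_const (1 + Real.exp (T.1 v))) hbound hlim
  simp only [(hf _).2] at h2
  have h3 := tendsto_nhds_unique tendsto_const_nhds h2
  rw [h3, integral_indicator₀ hset]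
  simp

theorem aemeasurable_exitRay (hT : 0 < T.1 []) (hP : IsBrownianLaw T rootPt P) :
    AEMeasurable (exitRay (T := T)) P := by
  have h : @Measurable (NullMeasurableSpace (TreePath T) P) Ray _
      (MeasurableSpace.generateFrom (Set.range cylinder)) exitRay := by
    refine measurable_generateFrom ?_
    rintro _ ⟨v, rfl⟩
    exact (exitRay_law hT hP v).1
  exact NullMeasurable.aemeasurable fun s hs => h (generateFrom_cylinder ▸ hs)

end ExitLaw

/-! ### The escape probability -/

/-- The state is a point of the root edge of height less than `δ`. -/
def Low (δ : ℝ) (a : State) : Prop := ∃ x, a = some x ∧ x.1 = [] ∧ x.2 < δ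

theorem measurableSet_low (δ : ℝ) : MeasurableSet {a : State | Low δ a} := by
  have h1 : MeasurableSet ((Prod.fst : Pt → Vertex) ⁻¹' {[]}) := measurable_fst trivial
  have h2 : MeasurableSet ((Prod.snd : Pt → ℝ) ⁻¹' Set.Iio δ) := measurable_snd measurableSet_Iio
  refine TreePath.measurableSet_state.2 ?_
  convert h1.inter h2 using 1
  ext ⟨v, r⟩
  simp [Low]

section Escape

variable {T : YuleTree} {δ ε : ℝ}

theorem TreePath.eventually_low (w : TreePath T) (hδ : δ ≤ T.1 []) {t : ℝ≥0}
    (h : Low δ (w.1 t)) : ∀ᶠ s in 𝓝 t, Low δ (w.1 s) := by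
  obtain ⟨x, hx, hx1, hx2⟩ := h
  filter_upwards [w.eventually_near hx (sub_pos.2 hx2)] with s hs
  obtain ⟨y, hy, hn, hd⟩ := hs
  rcases hn with h | ⟨h, -⟩
  · have := le_abs_self (y.2 - x.2)
    exact ⟨y, hy, h.trans hx1, by linarith⟩
  · rw [hx1] at h
    linarith

theorem TreePath.le_of_frequently_low (w : TreePath T) {t : ℝ≥0} {x : Pt} (hx : w.1 t = some x)
    (h : ∃ᶠ s in 𝓝 t, Low δ (w.1 s)) : x.1 = [] ∧ x.2 ≤ δ := by
  have key : ∀ η > 0, x.1 = [] ∧ x.2 ≤ δ + η := by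
    intro η hη
    obtain ⟨s, ⟨y, hy, hy1, hy2⟩, y', hy', hn, hd⟩ :=
      (h.and_eventually (w.eventually_near hx hη)).exists
    rw [hy] at hy'
    cases hy'
    have h1 := neg_abs_le (y.2 - x.2)
    refine ⟨?_, by linarith⟩
    rcases hn with h | ⟨-, i, h⟩
    · rw [← h, hy1]
    · rw [hy1] at h; simp at h
  exact ⟨(key 1 one_pos).1, le_of_forall_pos_le_add fun η hη => (key η hη).2⟩

/-- The harmonic function with value `0` at the root and `1` at infinity, flattened below height
`δ` so that its slope at the root vanishes. -/
def escapeFun (T : YuleTree) (δ : ℝ) : Vertex → ℝ → ℝ :=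
  consFun T (fun r => harm T 0 (some []) [] r * Real.smoothTransition (2 * r / δ))
    fun i => harm (T.sub i) (harm T 0 (some []) [] (T.1 [])) (some [])

theorem escapeFun_nil (T : YuleTree) (δ r : ℝ) : escapeFun T δ [] r =
    cond T * (1 - Real.exp (-r)) * Real.smoothTransition (2 * r / δ) := by
  simp [escapeFun, consFun, harm_nil, targetProb, exitProb]

theorem escapeFun_eventually (hδ : 0 < δ) {r : ℝ} (hr : δ ≤ r) :
    escapeFun T δ [] =ᶠ[𝓝 r] harm T 0 (some []) [] := by
  filter_upwards [Ioi_mem_nhds (show δ / 2 < r by linarith)] with s hs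
  have h1 : 1 ≤ 2 * s / δ := by
    rw [le_div_iff₀ hδ]
    have : δ / 2 < s := hs
    linarith
  simp [escapeFun, consFun, Real.smoothTransition.one_of_one_le h1]

theorem glued_escapeFun (hT : 0 < T.1 []) (hδ : 0 < δ) (hδT : δ ≤ T.1 []) :
    Glued T (escapeFun T δ) := by
  have hF := glued_harm hT 0 (some [])
  refine glued_consFun ?_ (fun i => glued_harm (sub_pos_root T i) _ _) (fun i => ?_) ?_
  · have h : ContDiff ℝ 2 Real.smoothTransition := Real.smoothTransition.contDiff
    exact (hF.contDiff []).mul (h.comp (by fun_prop))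
  · rw [show harm T 0 (some []) [] (T.1 []) * Real.smoothTransition (2 * T.1 [] / δ) =
      escapeFun T δ [] (T.1 []) from rfl, (escapeFun_eventually hδ hδT).self_of_nhds, harm_nil]
    simp
  · refine (escapeFun_eventually hδ hδT).deriv_eq.trans ((hF.glue []).trans ?_)
    refine Finset.sum_congr rfl fun i _ => ?_
    change deriv (fun r => harm (T.sub i) (harm T 0 (some []) [] (T.1 [])) (some []) []
      (r - T.1 [])) (T.1 []) = _
    rw [deriv_comp_sub_const, sub_self]

theorem deriv_escapeFun (T : YuleTree) (δ : ℝ) : deriv (escapeFun T δ []) 0 = 0 := by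
  have h1 : DifferentiableAt ℝ (harm T 0 (some []) []) 0 :=
    ((contDiff_odeSol _ _ _).differentiable (by norm_num)) 0
  have h2 : DifferentiableAt ℝ (fun r => Real.smoothTransition (2 * r / δ)) 0 := by
    have h : ContDiff ℝ 2 Real.smoothTransition := Real.smoothTransition.contDiff
    have h3 : ContDiff ℝ 2 (fun r => Real.smoothTransition (2 * r / δ)) := h.comp (by fun_prop)
    exact (h3.differentiable (by norm_num)) 0
  have h3 := (h1.hasDerivAt.mul h2.hasDerivAt).deriv
  refine Eq.trans ?_ (h3.trans ?_)
  · rfl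
  · simp [harm_nil, Real.smoothTransition.zero]

theorem escapeFun_cons (T : YuleTree) (δ : ℝ) (i : Fin 2) (v : Vertex) :
    escapeFun T δ (i :: v) = harm T 0 (some []) (i :: v) := rfl

theorem edgeGen_escapeFun (hδ : 0 < δ) {v : Vertex} {r : ℝ} (h : v = [] → δ ≤ r) :
    edgeGen (escapeFun T δ v) r = 0 := by
  rcases v with _ | ⟨i, v⟩
  · have h1 := escapeFun_eventually (T := T) hδ (h rfl)
    rw [edgeGen, h1.deriv.deriv_eq, h1.deriv_eq]
    exact edgeGen_harm _ _ _ _ _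
  · rw [escapeFun_cons]
    exact edgeGen_harm _ _ _ _ _

theorem escapeFun_low_bounds (hT : 0 < T.1 []) {r : ℝ} (h0 : 0 ≤ r) (h : r ≤ δ) :
    0 ≤ escapeFun T δ [] r ∧ escapeFun T δ [] r ≤ cond T * (1 - Real.exp (-δ)) := by
  have h1 : 0 ≤ cond T * (1 - Real.exp (-r)) :=
    mul_nonneg (by linarith [one_le_cond hT]) (sub_nonneg.2 (exp_neg_le_one h0))
  rw [escapeFun_nil]
  refine ⟨mul_nonneg h1 (Real.smoothTransition.nonneg _), ?_⟩
  refine (mul_le_of_le_one_right h1 (Real.smoothTransition.le_one _)).trans ?_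
  have := one_le_cond hT
  gcongr

theorem escapeFun_vertex_bounds (hT : 0 < T.1 []) {v : Vertex} (hv : v ≠ []) :
    1 - Real.exp (-T.1 v) ≤ escapeFun T δ v (T.1 v) ∧ escapeFun T δ v (T.1 v) ≤ 1 := by
  rcases v with _ | ⟨i, v⟩
  · exact absurd rfl hv
  · obtain ⟨h1, h2⟩ := harm_none_bounds hT zero_le_one (vertex_mem_points T (i :: v))
    rw [escapeFun_cons, harm_some_nil, sub_zero]
    constructor <;> linarith

/-- Exit from the first `N` generations, or from the part of the tree outside the neighbourhood of
radius `δ` of the root. -/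
def EscapeCond (N : ℕ) (δ : ℝ) (w : TreePath T) (s : ℝ≥0) : Prop :=
  ¬ InGen N (w.1 s) ∨ Low δ (w.1 s)

variable {P : Measure (TreePath T)} {N : ℕ}

/-- Flattening `escapeFun` spoils harmonicity only below height `δ` on the root edge, and the motion
is stopped on entering that region. -/
theorem integral_escape (hT : 0 < T.1 []) (hP : IsBrownianLaw T ([], ε) P) (hδ : 0 < δ)
    (hδε : δ ≤ ε) (hεT : ε ≤ T.1 []) :
    Integrable (fun w => edgeEval (escapeFun T δ) (w.1 (hitTime (EscapeCond N δ w)))) P ∧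
      ∫ w, edgeEval (escapeFun T δ) (w.1 (hitTime (EscapeCond N δ w))) ∂P =
        cond T * (1 - Real.exp (-ε)) := by
  have hF := glued_escapeFun hT hδ (hδε.trans hεT)
  have h := hF.integral_hitTime (deriv_escapeFun T δ) hT hP (N := N) (by simp)
    (Q := EscapeCond N δ) ?_ ?_ (fun _ _ h => Or.inl h) ?_
  · refine ⟨h.1, h.2.trans ?_⟩
    rw [(escapeFun_eventually hδ hδε).self_of_nhds, harm_nil]
    simp [targetProb, exitProb]
  · rintro w r (h | h)
    · filter_upwards [w.eventually_not_inGen h] with s hs using Or.inl hs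
    · filter_upwards [nhdsWithin_le_nhds (w.eventually_low (hδε.trans hεT) h)] with s hs
        using Or.inr hs
  · exact fun s => (measurableSet_not_inGen N s).union (measurable_coord s (measurableSet_low δ))
  · intro w s hs
    rcases hw : w.1 s with _ | y
    · rfl
    · refine edgeGen_escapeFun hδ fun h0 => ?_
      by_contra hcon
      exact hs (Or.inr ⟨y, hw, h0, not_le.1 hcon⟩)

theorem escape_position (hT : 0 < T.1 []) (hP : IsBrownianLaw T ([], ε) P) :
    ∀ᵐ w ∂P, (∃ r, 0 ≤ r ∧ r ≤ δ ∧ w.1 (hitTime (EscapeCond N δ w)) = some ([], r)) ∨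
      ∃ v : Vertex, v.length = N ∧ w.1 (hitTime (EscapeCond N δ w)) = some (v, T.1 v) := by
  filter_upwards [ae_exists_exit hT hP, ae_inGen_zero hP (N := N) (by simp)] with w hex h0
  obtain ⟨s, hs⟩ := hex N
  have h1 := firstTime_eq_hitTime (Q := EscapeCond N δ w) ⟨s, Or.inl hs⟩ (le_self_add (b := 1))
  have hlt : firstTime (hitTime (EscapeCond N δ w) + 1) (EscapeCond N δ w) <
      hitTime (EscapeCond N δ w) + 1 := by rw [h1]; exact lt_add_one _
  have hin := w.inGen_firstTime (t := hitTime (EscapeCond N δ w) + 1) h0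
    (Q := EscapeCond N δ w) (fun _ h => Or.inl h)
  have hfr := (frequently_of_firstTime_lt hlt).filter_mono nhdsWithin_le_nhds
  rw [h1] at hin hfr
  obtain ⟨y, hy, hl⟩ := hin _ le_rfl
  rcases Filter.frequently_or_distrib.1 hfr with h | h
  · exact Or.inr (w.eq_branching_of_frequently (hin _ le_rfl) h)
  · left
    obtain ⟨h2, h3⟩ := w.le_of_frequently_low hy h
    exact ⟨y.2, YuleTree.nonneg_of_mem (w.mem hy), h3, by rw [hy, ← h2]⟩

/-- The paths that do not visit the root at positive times. -/
def escapeSet (T : YuleTree) : Set (TreePath T) := {w | ∀ t > 0, w.1 t ≠ some rootPt}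

/-- A path that visits the root before leaving the first `N` generations is stopped near it, where
the value is at most `b`; everywhere else it is at most `1`. Hence the mean of `f` is at most `b +
P(f > b)`. -/
theorem escape_lower_aux (hT : 0 < T.1 []) (hP : IsBrownianLaw T ([], ε) P) (hδ : 0 < δ)
    (hδε : δ ≤ ε) (hεT : ε ≤ T.1 []) :
    P.real {w | ∃ s, w.1 s = some rootPt ∧ ∀ s' ≤ s, InGen N (w.1 s')} ≤
      1 - cond T * (1 - Real.exp (-ε)) + cond T * (1 - Real.exp (-δ)) := by
  have := hP.prob
  -- With one generation more, a path still in generation `N` cannot have been stopped by an exit.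
  obtain ⟨h1, h2⟩ := integral_escape (N := N + 1) hT hP hδ hδε hεT
  set f := fun w : TreePath T =>
    edgeEval (escapeFun T δ) (w.1 (hitTime (EscapeCond (N + 1) δ w)))
  set b := cond T * (1 - Real.exp (-δ))
  have hb : 0 ≤ b := mul_nonneg (by linarith [one_le_cond hT]) (sub_nonneg.2 (exp_neg_le_one hδ.le))
  set S := {w | b < f w}
  have hS : NullMeasurableSet S P := h1.1.aemeasurable.nullMeasurable measurableSet_Ioi
  have h3 : ∫ w, f w ∂P ≤ ∫ w, (b + S.indicator (fun _ => 1) w) ∂P := by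
    refine integral_mono_ae h1 ((integrable_const _).add ?_) ?_
    · exact (integrable_const (1 : ℝ)).indicator₀ hS
    · filter_upwards [escape_position (N := N + 1) (δ := δ) hT hP] with w hw
      by_cases hwS : w ∈ S
      · rw [Set.indicator_of_mem hwS]
        have h4 : f w ≤ 1 := by
          rcases hw with ⟨r, hr0, hr, hw⟩ | ⟨v, hv, hw⟩
          · have : f w = escapeFun T δ [] r := by simp only [f, hw]; rfl
            rw [this]
            exact ((escapeFun_low_bounds hT hr0 hr).2.trans_lt
              (cond_mul_lt_one hT (hδε.trans hεT))).le
          · have : f w = escapeFun T δ v (T.1 v) := by simp only [f, hw]; rfl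
            rw [this]
            exact (escapeFun_vertex_bounds hT (by rintro rfl; simp at hv)).2
        linarith
      · rw [Set.indicator_of_notMem hwS, add_zero]
        exact not_lt.1 hwS
  rw [h2, integral_add (integrable_const _)
    ((integrable_const (1 : ℝ)).indicator₀ hS),
    integral_indicator₀ hS] at h3
  have h5 : P.real {w | ∃ s, w.1 s = some rootPt ∧ ∀ s' ≤ s, InGen N (w.1 s')} ≤ P.real Sᶜ := by
    refine ENNReal.toReal_mono (measure_ne_top _ _) (measure_mono_ae ?_)
    filter_upwards [escape_position (N := N + 1) (δ := δ) hT hP] with w hw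
    rintro ⟨s, hs, hin⟩
    have h6 : hitTime (EscapeCond (N + 1) δ w) ≤ s :=
      csInf_le' (Or.inr ⟨_, hs, rfl, hδ⟩)
    rcases hw with ⟨r, hr0, hr, hw⟩ | ⟨v, hv, hw⟩
    · have : f w = escapeFun T δ [] r := by simp only [f, hw]; rfl
      exact not_lt.2 (this.trans_le (escapeFun_low_bounds hT hr0 hr).2)
    · obtain ⟨y, hy, hl⟩ := hin _ h6
      rw [hw] at hy
      cases hy
      simp only at hl
      omega
  have h7 : P.real Sᶜ = 1 - P.real S := by
    rw [measureReal_compl₀ hS]; simp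
  simp at h3
  linarith

theorem tendsto_mul_one_sub_exp (c : ℝ) :
    Tendsto (fun k : ℕ => c * (1 - Real.exp (-(1 / ((k : ℝ) + 1))))) atTop (𝓝 0) := by
  have h : Continuous fun r : ℝ => c * (1 - Real.exp (-r)) := by fun_prop
  have h1 := (h.tendsto 0).comp (tendsto_one_div_add_atTop_nhds_zero_nat (𝕜 := ℝ))
  simpa [Function.comp_def] using h1

/-- In `escape_lower_aux`, first `δ → 0`, then `N → ∞`: every visit to the root happens after
finitely many generations have been seen. -/
theorem le_escape (hT : 0 < T.1 []) (hP : IsBrownianLaw T ([], ε) P) (hε : 0 < ε)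
    (hεT : ε ≤ T.1 []) : cond T * (1 - Real.exp (-ε)) ≤ P.real (escapeSet T) := by
  have := hP.prob
  set G : ℕ → Set (TreePath T) := fun N =>
    {w | ∃ s, w.1 s = some rootPt ∧ ∀ s' ≤ s, InGen (N + 1) (w.1 s')}
  have hmono : Monotone G := by
    rintro i j hij w ⟨s, hs, h⟩
    exact ⟨s, hs, fun s' hs' => (h s' hs').mono (by omega)⟩
  have hsub : (escapeSet T)ᶜ ⊆ ⋃ N, G N := by
    intro w hw
    simp only [escapeSet, Set.mem_compl_iff, Set.mem_ofPred_eq, not_forall, not_not] at hw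
    obtain ⟨s, -, hs⟩ := hw
    obtain ⟨M, hM⟩ := w.exists_inGen (t := s) (by simp [hs])
    exact Set.mem_iUnion.2 ⟨M, s, hs, fun s' hs' => (hM s' hs').mono (by omega)⟩
  have hlim : Tendsto (fun j => P.real (G j)) atTop (𝓝 (P.real (⋃ j, G j))) :=
    (ENNReal.tendsto_toReal (measure_ne_top _ _)).comp (tendsto_measure_iUnion_atTop hmono)
  have h1 : ∀ N, P.real (G N) ≤ 1 - cond T * (1 - Real.exp (-ε)) := by
    intro N
    have h2 := (tendsto_mul_one_sub_exp (cond T)).const_add (1 - cond T * (1 - Real.exp (-ε)))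
    rw [add_zero] at h2
    refine ge_of_tendsto h2 ?_
    filter_upwards [tendsto_one_div_add_atTop_nhds_zero_nat.eventually_lt_const hε] with k hk
    exact escape_lower_aux hT hP (by positivity) hk.le hεT
  have h3 := le_of_tendsto' hlim h1
  have h4 : P.real (escapeSet T)ᶜ ≤ P.real (⋃ j, G j) := measureReal_mono hsub
  -- Subadditivity holds for arbitrary sets, so measurability of the escape event plays no role.
  have h5 : 1 ≤ P.real (escapeSet T) + P.real (escapeSet T)ᶜ := by
    have := measureReal_union_le (μ := P) (escapeSet T) (escapeSet T)ᶜ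
    rwa [Set.union_compl_self, probReal_univ] at this
  linarith

/-- On a compact interval of times a continuous path that avoids the root keeps a positive distance
from it. -/
theorem TreePath.exists_not_low (w : TreePath T) (h0 : w.1 0 ≠ some rootPt) (hw : w ∈ escapeSet T)
    {t : ℝ≥0} (ht : w.1 t ≠ none) :
    ∃ k : ℕ, ∀ s ≤ t, ¬ Low (1 / ((k : ℝ) + 1)) (w.1 s) := by
  have hmono : ∀ {i j : ℕ} {a : State}, i ≤ j → ¬ Low (1 / ((i : ℝ) + 1)) a →
      ¬ Low (1 / ((j : ℝ) + 1)) a := by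
    rintro i j a hij h ⟨x, hx, h1, h2⟩
    exact h ⟨x, hx, h1, h2.trans_le (by gcongr)⟩
  have key : ∃ k : ℕ, ∀ s ∈ Set.Icc 0 t, ¬ Low (1 / ((k : ℝ) + 1)) (w.1 s) := by
    refine isCompact_Icc.induction_on
      (p := fun S => ∃ k : ℕ, ∀ s ∈ S, ¬ Low (1 / ((k : ℝ) + 1)) (w.1 s))
      ⟨0, by simp⟩ (fun s u hsu ⟨M, hM⟩ => ⟨M, fun r hr => hM r (hsu hr)⟩) ?_ ?_
    · rintro s u ⟨M, hM⟩ ⟨M', hM'⟩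
      refine ⟨max M M', fun r hr => ?_⟩
      rcases hr with hr | hr
      · exact hmono (le_max_left _ _) (hM r hr)
      · exact hmono (le_max_right _ _) (hM' r hr)
    · intro s hs
      obtain ⟨x, hx⟩ := Option.ne_none_iff_exists'.1 (w.alive_of_le hs.2 ht)
      have hne : w.1 s ≠ some rootPt := by
        rcases eq_or_lt_of_le hs.1 with h | h
        · rwa [← h]
        · exact hw s h
      have hx0 : x.1 = [] → 0 < x.2 := by
        intro h
        refine lt_of_le_of_ne (YuleTree.nonneg_of_mem (w.mem hx)) fun h' => hne ?_
        rw [hx]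
        exact congrArg some (Prod.ext h h'.symm)
      obtain ⟨η, hη, hη'⟩ : ∃ η > 0, x.1 = [] → η ≤ x.2 / 2 := by
        by_cases h : x.1 = []
        · exact ⟨x.2 / 2, half_pos (hx0 h), fun _ => le_rfl⟩
        · exact ⟨1, one_pos, fun h' => absurd h' h⟩
      obtain ⟨k, hk⟩ := exists_nat_one_div_lt hη
      refine ⟨{r | ∃ y, w.1 r = some y ∧ T.Near x y ∧ |y.2 - x.2| < η},
        mem_nhdsWithin_of_mem_nhds (w.eventually_near hx hη), k, ?_⟩
      rintro r ⟨y, hy, hn, hd⟩ ⟨y', hy', h1, h2⟩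
      rw [hy] at hy'
      cases hy'
      rcases hn with h | ⟨-, i, h⟩
      · have h3 := hη' (h ▸ h1)
        have h4 := neg_abs_le (y.2 - x.2)
        linarith
      · rw [h1] at h; simp at h
  obtain ⟨k, hk⟩ := key
  exact ⟨k, fun s hs => hk s ⟨zero_le, hs⟩⟩

/-- A path that avoids the root until it leaves the first `N` generations stays out of some
neighbourhood of radius `1/(k+1)` until then. On that event the stopped value of `escapeFun` is at
least `1 - η`, and Markov's inequality compares its probability with the mean `h`. -/
theorem escape_le (hT : 0 < T.1 []) (hP : IsBrownianLaw T ([], ε) P) (hε : 0 < ε)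
    (hεT : ε ≤ T.1 []) : P.real (escapeSet T) ≤ cond T * (1 - Real.exp (-ε)) := by
  have := hP.prob
  set h := cond T * (1 - Real.exp (-ε))
  have key : ∀ η > 0, (1 - η) * P.real (escapeSet T) ≤ h := by
    intro η hη
    obtain ⟨N₀, hN₀⟩ := T.2.exists_le (-Real.log η)
    -- The exit vertex is then different from `[]`, as `escapeFun_vertex_bounds` requires.
    set N := N₀ + 1
    set L : ℕ → Set (TreePath T) := fun k => {w | ∀ s ≤ hitTime fun s => ¬ InGen N (w.1 s),
      ¬ Low (1 / ((k : ℝ) + 1)) (w.1 s)}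
    have hmono : Monotone L := by
      rintro i j hij w hw s hs ⟨x, hx, h1, h2⟩
      exact hw s hs ⟨x, hx, h1, h2.trans_le (by gcongr)⟩
    have hlim : Tendsto (fun j => (1 - η) * P.real (L j)) atTop
        (𝓝 ((1 - η) * P.real (⋃ j, L j))) :=
      ((ENNReal.tendsto_toReal (measure_ne_top _ _)).comp
        (tendsto_measure_iUnion_atTop hmono)).const_mul _
    have hsub : P.real (escapeSet T) = P.real (escapeSet T ∩ ⋃ j, L j) := by
      refine measureReal_congr ?_
      filter_upwards [ae_exists_exit hT hP, hP.start] with w hex hst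
      refine propext ⟨fun hw => ⟨hw, ?_⟩, fun hw => hw.1⟩
      obtain ⟨v, -, hv⟩ := w.exists_hit_vertex (N := N) ⟨_, hst, by simp⟩ (hex N)
      obtain ⟨k, hk⟩ := w.exists_not_low (by rw [hst]; simp [rootPt, hε.ne']) hw
        (t := hitTime fun s => ¬ InGen N (w.1 s)) (by rw [hv]; simp)
      exact Set.mem_iUnion.2 ⟨k, hk⟩
    rcases le_or_gt 1 η with hη1 | hη1
    · refine (mul_nonpos_of_nonpos_of_nonneg (by linarith) measureReal_nonneg).trans ?_
      exact mul_nonneg (by linarith [one_le_cond hT]) (sub_nonneg.2 (exp_neg_le_one hε.le))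
    have h1 : ∀ᶠ k : ℕ in atTop, (1 - η) * P.real (L k) ≤ h := by
      filter_upwards [tendsto_one_div_add_atTop_nhds_zero_nat.eventually_lt_const hε] with k hk
      set δ : ℝ := 1 / ((k : ℝ) + 1)
      have hδ : 0 < δ := by positivity
      obtain ⟨h1, h2⟩ := integral_escape (N := N) hT hP hδ hk.le hεT
      set f := fun w : TreePath T => edgeEval (escapeFun T δ) (w.1 (hitTime (EscapeCond N δ w)))
      have hf0 : 0 ≤ᵐ[P] f := by
        filter_upwards [escape_position (N := N) (δ := δ) hT hP] with w hw
        rcases hw with ⟨r, hr0, hr, hw⟩ | ⟨v, hv, hw⟩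
        · have : f w = escapeFun T δ [] r := by simp only [f, hw]; rfl
          change 0 ≤ f w
          rw [this]
          exact (escapeFun_low_bounds hT hr0 hr).1
        · have : f w = escapeFun T δ v (T.1 v) := by simp only [f, hw]; rfl
          change 0 ≤ f w
          rw [this]
          refine le_trans ?_ (escapeFun_vertex_bounds hT (by rintro rfl; simp [N] at hv)).1
          exact sub_nonneg.2 (exp_neg_le_one (T.2.nonneg _))
      refine le_trans ?_ ((mul_meas_ge_le_integral_of_nonneg hf0 h1 (1 - η)).trans_eq h2)
      refine mul_le_mul_of_nonneg_left ?_ (by linarith)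
      refine ENNReal.toReal_mono (measure_ne_top _ _) (measure_mono_ae ?_)
      filter_upwards [ae_exists_exit hT hP, hP.start] with w hex hst hw
      obtain ⟨v, hv, hwv⟩ := w.exists_hit_vertex (N := N) ⟨_, hst, by simp⟩ (hex N)
      have heq : hitTime (EscapeCond N δ w) = hitTime fun s => ¬ InGen N (w.1 s) := by
        refine le_antisymm (csInf_le_csInf' (hex N) fun s hs => Or.inl hs) ?_
        refine le_csInf (Set.Nonempty.mono (fun s hs => Or.inl hs) (hex N)) ?_
        rintro s (hs | hs)
        · exact csInf_le' hs
        · by_contra hcon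
          exact hw s (not_le.1 hcon).le hs
      have : f w = escapeFun T δ v (T.1 v) := by simp only [f, heq, hwv]; rfl
      change 1 - η ≤ f w
      rw [this]
      refine le_trans ?_ (escapeFun_vertex_bounds hT (by rintro rfl; simp [N] at hv)).1
      have h3 := hN₀ v (by omega)
      have h4 : Real.exp (-T.1 v) ≤ η := by
        calc _ ≤ Real.exp (Real.log η) := by gcongr; linarith
          _ = η := Real.exp_log hη
      linarith
    calc _ ≤ (1 - η) * P.real (⋃ j, L j) := by
          rw [hsub]
          exact mul_le_mul_of_nonneg_left (measureReal_mono Set.inter_subset_right) (by linarith)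
      _ ≤ h := le_of_tendsto hlim h1
  have h1 : Tendsto (fun k : ℕ => (1 - 1 / ((k : ℝ) + 1)) * P.real (escapeSet T)) atTop
      (𝓝 ((1 - 0) * P.real (escapeSet T))) :=
    (tendsto_one_div_add_atTop_nhds_zero_nat.const_sub 1).mul_const _
  rw [sub_zero, one_mul] at h1
  exact le_of_tendsto' h1 fun k => key _ (by positivity)

/-- The two bounds give the escape probability `cond T * (1 - exp (-ε))` exactly for small `ε`; the
limit is its derivative at `0`. -/
theorem tendsto_escapeRate {BM : ∀ T : YuleTree, Pt → Measure (TreePath T)}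
    (hBM : IsBrownianFamily BM) (hT : 0 < T.1 []) :
    Tendsto (escapeRate BM T) (𝓝[>] (0 : ℝ)) (𝓝 (cond T)) := by
  have h1 : HasDerivAt (fun r : ℝ => cond T * (1 - Real.exp (-r))) (cond T) 0 := by
    have h2 := (((hasDerivAt_neg (0 : ℝ)).exp).const_sub 1).const_mul (cond T)
    refine h2.congr_deriv ?_
    simp
  have h2 := h1.tendsto_slope_zero_right
  refine h2.congr' ?_
  filter_upwards [self_mem_nhdsWithin, Ioo_mem_nhdsGT hT] with ε hε hεT
  have hε' : (0 : ℝ) < ε := hε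
  have hP := hBM T ([], ε) ⟨hεT.2.le, Or.inl ⟨rfl, hε'.le⟩⟩
  rw [escapeRate]
  have h3 := le_antisymm (escape_le hT hP hε' hεT.2.le) (le_escape hT hP hε' hεT.2.le)
  rw [show {w : TreePath T | ∀ t > 0, w.1 t ≠ some rootPt} = escapeSet T from rfl, h3]
  simp

theorem conductance_eq {BM : ∀ T : YuleTree, Pt → Measure (TreePath T)}
    (hBM : IsBrownianFamily BM) (hT : 0 < T.1 []) : conductance BM T = cond T :=
  (tendsto_escapeRate hBM hT).limUnder_eq

end Escape

/-! ### The law of the Yule tree -/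

instance : IsProbabilityMeasure (expMeasure 1) := isProbabilityMeasure_expMeasure one_pos

/-- The law of the lifetimes. -/
def lifetimeLaw : Measure (Vertex → ℝ) := Measure.infinitePi fun _ : Vertex => expMeasure 1

instance : IsProbabilityMeasure lifetimeLaw := by unfold lifetimeLaw; infer_instance

/-- The collection made of a value at the root and of two collections for the subtrees. -/
def assemble (p : ℝ × (Vertex → ℝ) × (Vertex → ℝ)) : Vertex → ℝ
  | [] => p.1
  | i :: v => if i = 0 then p.2.1 v else p.2.2 v

theorem measurable_assemble : Measurable assemble := by
  refine measurable_pi_lambda _ fun v => ?_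
  rcases v with _ | ⟨i, v⟩
  · exact measurable_fst
  · by_cases h : i = 0
    · simp only [assemble, h, if_true]
      exact (measurable_pi_apply v).comp (measurable_fst.comp measurable_snd)
    · simp only [assemble, h, if_false]
      exact (measurable_pi_apply v).comp (measurable_snd.comp measurable_snd)

/-- A product measure indexed by words factorises according to whether the word is empty and, if
not, to its first letter; it is enough to check boxes. -/
theorem map_assemble :
    ((expMeasure 1).prod (lifetimeLaw.prod lifetimeLaw)).map assemble = lifetimeLaw := by
  classical
  refine Measure.eq_infinitePi (fun _ : Vertex => expMeasure 1) fun s t ht => ?_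
  -- Free coordinates receive the whole line, a factor of mass `1`; the products over `s` can then
  -- be taken over the root and two complete copies of `r 0` and `r 1`.
  set t' : Vertex → Set ℝ := fun v => if v ∈ s then t v else Set.univ with ht'
  have htm : ∀ v, MeasurableSet (t' v) := fun v => by
    simp only [ht']; split_ifs; exacts [ht v, MeasurableSet.univ]
  set c : Fin 2 → Vertex ↪ Vertex := fun i => ⟨fun v => i :: v, List.cons_injective⟩
  set r : Fin 2 → Finset Vertex := fun i => s.preimage (c i) (c i).injective.injOn
  have hpre : assemble ⁻¹' Set.pi s t = t' [] ×ˢ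
      (Set.pi (r 0) (fun v => t' (0 :: v)) ×ˢ Set.pi (r 1) (fun v => t' (1 :: v))) := by
    ext p
    simp only [Set.mem_preimage, Set.mem_pi, Set.mem_prod, Finset.mem_coe, r, Finset.mem_preimage]
    constructor
    · intro h
      refine ⟨?_, fun v hv => ?_, fun v hv => ?_⟩
      · simp only [ht']
        split_ifs with h0
        · exact h _ h0
        · trivial
      · simp only [ht', show (0 :: v) ∈ s from hv, if_true]
        exact h _ hv
      · simp only [ht', show (1 :: v) ∈ s from hv, if_true]
        exact h _ hv
    · rintro ⟨h0, h1, h2⟩ v hv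
      rcases v with _ | ⟨i, v⟩
      · simp only [ht', hv, if_true] at h0
        exact h0
      · fin_cases i
        · have := h1 v hv
          simp only [ht', show (0 :: v) ∈ s from hv, if_true] at this
          exact this
        · have := h2 v hv
          simp only [ht', show (1 :: v) ∈ s from hv, if_true] at this
          exact this
  have hprod : ∏ v ∈ s, expMeasure 1 (t v) = expMeasure 1 (t' []) *
      ((∏ v ∈ r 0, expMeasure 1 (t' (0 :: v))) * ∏ v ∈ r 1, expMeasure 1 (t' (1 :: v))) := by
    set S : Finset Vertex := insert [] ((r 0).map (c 0) ∪ (r 1).map (c 1)) with hS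
    have hsub : s ⊆ S := by
      intro v hv
      rcases v with _ | ⟨i, v⟩
      · simp [hS]
      · fin_cases i
        · refine Finset.mem_insert_of_mem (Finset.mem_union_left _ ?_)
          exact Finset.mem_map.2 ⟨v, by simpa [r, c] using hv, rfl⟩
        · refine Finset.mem_insert_of_mem (Finset.mem_union_right _ ?_)
          exact Finset.mem_map.2 ⟨v, by simpa [r, c] using hv, rfl⟩
    have h1 : ∏ v ∈ s, expMeasure 1 (t v) = ∏ v ∈ S, expMeasure 1 (t' v) := by
      rw [← Finset.prod_subset hsub]
      · refine Finset.prod_congr rfl fun v hv => ?_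
        simp [ht', hv]
      · intro v _ hv
        simp [ht', hv]
    rw [h1, hS, Finset.prod_insert (by simp [c]), Finset.prod_union, Finset.prod_map,
      Finset.prod_map]
    · rfl
    · rw [Finset.disjoint_left]
      intro v h0 h1
      obtain ⟨a, -, ha⟩ := Finset.mem_map.1 h0
      obtain ⟨b, -, hb⟩ := Finset.mem_map.1 h1
      have : (0 : Fin 2) :: a = 1 :: b := ha.trans hb.symm
      simp at this
  rw [Measure.map_apply measurable_assemble (MeasurableSet.pi s.countable_toSet fun v _ => ht v),
    hpre, Measure.prod_prod, Measure.prod_prod, hprod, lifetimeLaw,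
    Measure.infinitePi_pi _ fun v _ => htm _, Measure.infinitePi_pi _ fun v _ => htm _]

theorem heightsOfLifetimes_nil (V : Vertex → ℝ) : heightsOfLifetimes V [] = V [] := by
  simp [heightsOfLifetimes]

theorem heightsOfLifetimes_cons (V : Vertex → ℝ) (i : Fin 2) (v : Vertex) :
    heightsOfLifetimes V (i :: v) = V [] + heightsOfLifetimes (fun u => V (i :: u)) v := by
  simp [heightsOfLifetimes, Function.comp_def]

theorem heightsOfLifetimes_concat (V : Vertex → ℝ) (v : Vertex) (i : Fin 2) :
    heightsOfLifetimes V (v ++ [i]) = heightsOfLifetimes V v + V (v ++ [i]) := by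
  induction v generalizing V with
  | nil => simp [heightsOfLifetimes]
  | cons j v ih =>
    rw [List.cons_append, heightsOfLifetimes_cons, heightsOfLifetimes_cons, ih]
    ring

theorem measurable_heightsOfLifetimes : Measurable heightsOfLifetimes := by
  refine measurable_pi_lambda _ fun v => ?_
  induction v using List.reverseRecOn with
  | nil =>
    simp only [heightsOfLifetimes_nil]
    exact measurable_pi_apply _
  | append_singleton v i ih =>
    simp only [heightsOfLifetimes_concat]
    exact ih.add (measurable_pi_apply _)

theorem heightsOfLifetimes_assemble (a : ℝ) (V₀ V₁ : Vertex → ℝ) (i : Fin 2) (v : Vertex) :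
    heightsOfLifetimes (assemble (a, V₀, V₁)) (i :: v) =
      a + heightsOfLifetimes (if i = 0 then V₀ else V₁) v := by
  rw [heightsOfLifetimes_cons]
  congr 2
  fin_cases i <;> rfl

theorem ae_expMeasure_pos : ∀ᵐ x ∂expMeasure 1, 0 < x := by
  change ∀ᵐ x ∂volume.withDensity (exponentialPDF 1), 0 < x
  have hm : Measurable (exponentialPDF 1) := (measurable_exponentialPDFReal 1).ennreal_ofReal
  rw [ae_withDensity_iff hm]
  have h0 : ∀ᵐ x : ℝ, x ≠ 0 := by simp [ae_iff]
  filter_upwards [h0] with x hx h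
  rcases lt_or_ge x 0 with hx' | hx'
  · exact absurd (exponentialPDF_of_neg hx') h
  · exact lt_of_le_of_ne hx' (Ne.symm hx)

theorem lintegral_exp_neg_two :
    ∫⁻ x, ENNReal.ofReal (Real.exp (-(2 * x))) ∂expMeasure 1 = ENNReal.ofReal (1 / 3) := by
  change ∫⁻ x, ENNReal.ofReal (Real.exp (-(2 * x))) ∂volume.withDensity (exponentialPDF 1) = _
  have hm : Measurable (exponentialPDF 1) := (measurable_exponentialPDFReal 1).ennreal_ofReal
  have hm3 : Measurable (exponentialPDF 3) := (measurable_exponentialPDFReal 3).ennreal_ofReal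
  rw [lintegral_withDensity_eq_lintegral_mul _ hm (by fun_prop)]
  have h : ∀ x, (exponentialPDF 1 * fun x => ENNReal.ofReal (Real.exp (-(2 * x)))) x =
      ENNReal.ofReal (1 / 3) * exponentialPDF 3 x := by
    intro x
    rw [Pi.mul_apply, exponentialPDF_eq, exponentialPDF_eq]
    split_ifs with hx
    · rw [← ENNReal.ofReal_mul (by positivity), ← ENNReal.ofReal_mul (by positivity), one_mul,
        ← Real.exp_add]
      congr 1
      ring_nf
    · simp
  rw [lintegral_congr h, lintegral_const_mul _ hm3, lintegral_exponentialPDF_eq_one (by norm_num),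
    mul_one]

theorem lintegral_exp_height (v : Vertex) :
    ∫⁻ V, ENNReal.ofReal (Real.exp (-(2 * heightsOfLifetimes V v))) ∂lifetimeLaw =
      ENNReal.ofReal (1 / 3) ^ (v.length + 1) := by
  have hm : ∀ v, Measurable fun V : Vertex → ℝ =>
      ENNReal.ofReal (Real.exp (-(2 * heightsOfLifetimes V v))) := by
    intro v
    have := (measurable_pi_apply v).comp measurable_heightsOfLifetimes
    exact (Real.measurable_exp.comp (this.const_mul 2).neg).ennreal_ofReal
  have he : Measurable fun x : ℝ => ENNReal.ofReal (Real.exp (-(2 * x))) := by fun_prop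
  induction v with
  | nil =>
    have h := Measure.infinitePi_map_eval (fun _ : Vertex => expMeasure 1) []
    simp only [heightsOfLifetimes_nil, List.length_nil, zero_add, pow_one]
    rw [← lintegral_exp_neg_two, ← h, lintegral_map he (measurable_pi_apply _)]
    rfl
  | cons i v ih =>
    have h1 : ∀ p : ℝ × (Vertex → ℝ) × (Vertex → ℝ),
        ENNReal.ofReal (Real.exp (-(2 * heightsOfLifetimes (assemble p) (i :: v)))) =
        ENNReal.ofReal (Real.exp (-(2 * p.1))) * ENNReal.ofReal (Real.exp
          (-(2 * heightsOfLifetimes (if i = 0 then p.2.1 else p.2.2) v))) := by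
      rintro ⟨a, V₀, V₁⟩
      rw [heightsOfLifetimes_assemble, ← ENNReal.ofReal_mul (Real.exp_pos _).le, ← Real.exp_add]
      ring_nf
    conv_lhs => rw [← map_assemble]
    rw [lintegral_map (hm _) measurable_assemble, lintegral_congr h1]
    have h2 : Measurable fun q : (Vertex → ℝ) × (Vertex → ℝ) => ENNReal.ofReal (Real.exp
          (-(2 * heightsOfLifetimes (if i = 0 then q.1 else q.2) v))) := by
      by_cases hi : i = 0
      · simp only [hi, if_true]
        exact (hm v).comp measurable_fst
      · simp only [hi, if_false]
        exact (hm v).comp measurable_snd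
    rw [lintegral_prod_mul he.aemeasurable h2.aemeasurable, lintegral_exp_neg_two]
    have h3 : ∫⁻ q : (Vertex → ℝ) × (Vertex → ℝ), ENNReal.ofReal (Real.exp
          (-(2 * heightsOfLifetimes (if i = 0 then q.1 else q.2) v))) ∂lifetimeLaw.prod lifetimeLaw
        = ENNReal.ofReal (1 / 3) ^ (v.length + 1) := by
      by_cases hi : i = 0
      · simp only [hi, if_true]
        rw [← ih, ← (measurePreserving_fst (μ := lifetimeLaw) (ν := lifetimeLaw)).lintegral_comp
          (hm v)]
      · simp only [hi, if_false]
        rw [← ih, ← (measurePreserving_snd (μ := lifetimeLaw) (ν := lifetimeLaw)).lintegral_comp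
          (hm v)]
    rw [h3, List.length_cons, pow_succ' _ (v.length + 1)]

/-- Divergence along uncountably many rays is uniform divergence by generation, a countable
condition. -/
theorem isYuleType_iff {z : Vertex → ℝ} : IsYuleType z ↔
    (∀ v, 0 ≤ z v) ∧ (∀ v i, z v < z (v ++ [i])) ∧
      ∀ R : ℕ, ∃ N, ∀ v : Vertex, N ≤ v.length → (R : ℝ) ≤ z v := by
  constructor
  · exact fun h => ⟨h.nonneg, h.lt_child, fun R => h.exists_le R⟩
  · rintro ⟨h0, h1, h2⟩
    refine ⟨h0, h1, fun u => tendsto_atTop.2 fun R => ?_⟩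
    obtain ⟨n, hn⟩ := exists_nat_ge R
    obtain ⟨N, hN⟩ := h2 n
    filter_upwards [eventually_ge_atTop N] with k hk
    exact hn.trans (hN _ (by rwa [Ray.length_trunc]))

theorem measurableSet_isYuleType : MeasurableSet {z : Vertex → ℝ | IsYuleType z} := by
  simp only [isYuleType_iff]
  have h1 : ∀ v : Vertex, Measurable fun z : Vertex → ℝ => z v := fun v => measurable_pi_apply v
  refine MeasurableSet.inter ?_ (MeasurableSet.inter ?_ ?_)
  · have : {z : Vertex → ℝ | ∀ v, 0 ≤ z v} = ⋂ v, {z | 0 ≤ z v} := by ext; simp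
    change MeasurableSet {z : Vertex → ℝ | ∀ v, 0 ≤ z v}
    rw [this]
    exact MeasurableSet.iInter fun v => measurableSet_le measurable_const (h1 v)
  · have : {z : Vertex → ℝ | ∀ v i, z v < z (v ++ [i])} = ⋂ v, ⋂ i, {z | z v < z (v ++ [i])} := by
      ext; simp
    change MeasurableSet {z : Vertex → ℝ | ∀ v i, z v < z (v ++ [i])}
    rw [this]
    exact MeasurableSet.iInter fun v => MeasurableSet.iInter fun i =>
      measurableSet_lt (h1 v) (h1 _)
  · have : {z : Vertex → ℝ | ∀ R : ℕ, ∃ N, ∀ v : Vertex, N ≤ v.length → (R : ℝ) ≤ z v} =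
        ⋂ R : ℕ, ⋃ N : ℕ, ⋂ v : {v : Vertex // N ≤ v.length}, {z | (R : ℝ) ≤ z v.1} := by
      ext; simp
    change MeasurableSet {z : Vertex → ℝ | ∀ R : ℕ, ∃ N, ∀ v : Vertex, N ≤ v.length → (R : ℝ) ≤ z v}
    rw [this]
    exact MeasurableSet.iInter fun R => MeasurableSet.iUnion fun N =>
      MeasurableSet.iInter fun v => measurableSet_le measurable_const (h1 v)

theorem ae_lifetime_pos : ∀ᵐ V ∂lifetimeLaw, ∀ v, 0 < V v := by
  rw [ae_all_iff]
  intro v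
  exact (measurePreserving_eval_infinitePi (fun _ : Vertex => expMeasure 1) v).quasiMeasurePreserving.ae
    ae_expMeasure_pos

/-- Exponential Markov inequality and a union bound over `2 ^ N` vertices. The exponent `2` is
chosen so that E exp(-2V) = 1/3 is less than `1/2`. -/
theorem measure_exists_height_lt_le (R : ℝ) (N : ℕ) :
    lifetimeLaw {V | ∃ v : Vertex, v.length = N ∧ heightsOfLifetimes V v < R} ≤
      ENNReal.ofReal (Real.exp (2 * R)) * ENNReal.ofReal (2 / 3) ^ N := by
  have hm : ∀ v, Measurable fun V : Vertex → ℝ =>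
      ENNReal.ofReal (Real.exp (-(2 * heightsOfLifetimes V v))) := by
    intro v
    have := (measurable_pi_apply v).comp measurable_heightsOfLifetimes
    exact (Real.measurable_exp.comp (this.const_mul 2).neg).ennreal_ofReal
  have hsub : {V | ∃ v : Vertex, v.length = N ∧ heightsOfLifetimes V v < R} ⊆
      ⋃ a : Fin N → Fin 2, {V | ENNReal.ofReal (Real.exp (-(2 * R))) ≤
        ENNReal.ofReal (Real.exp (-(2 * heightsOfLifetimes V (List.ofFn a))))} := by
    rintro V ⟨v, rfl, hv⟩
    refine Set.mem_iUnion.2 ⟨v.get, ?_⟩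
    rw [List.ofFn_get]
    refine ENNReal.ofReal_le_ofReal (Real.exp_le_exp.2 ?_)
    linarith
  have h1 : ∀ a : Fin N → Fin 2, lifetimeLaw {V | ENNReal.ofReal (Real.exp (-(2 * R))) ≤
        ENNReal.ofReal (Real.exp (-(2 * heightsOfLifetimes V (List.ofFn a))))} ≤
      ENNReal.ofReal (Real.exp (2 * R)) * ENNReal.ofReal (1 / 3) ^ (N + 1) := by
    intro a
    refine (meas_ge_le_lintegral_div (hm _).aemeasurable ?_ ENNReal.ofReal_ne_top).trans_eq ?_
    · simp [Real.exp_pos]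
    · rw [lintegral_exp_height, List.length_ofFn, Real.exp_neg,
        ENNReal.ofReal_inv_of_pos (Real.exp_pos _), div_eq_mul_inv, inv_inv, mul_comm]
  calc _ ≤ ∑ a : Fin N → Fin 2, ENNReal.ofReal (Real.exp (2 * R)) *
        ENNReal.ofReal (1 / 3) ^ (N + 1) :=
      (measure_mono hsub).trans ((measure_iUnion_fintype_le _ _).trans
        (Finset.sum_le_sum fun a _ => h1 a))
    _ = ENNReal.ofReal (Real.exp (2 * R)) * ENNReal.ofReal (2 ^ N * (1 / 3) ^ (N + 1)) := by
      rw [Finset.sum_const, Finset.card_univ, Fintype.card_fun, Fintype.card_fin, Fintype.card_fin,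
        nsmul_eq_mul, ENNReal.ofReal_mul (by positivity), ENNReal.ofReal_pow (by norm_num),
        ENNReal.ofReal_pow (by norm_num)]
      simp
      ring
    _ ≤ _ := by
      rw [← ENNReal.ofReal_pow (by norm_num)]
      gcongr
      rw [div_pow, div_pow, one_pow, pow_succ]
      have : (0 : ℝ) < 3 ^ N := by positivity
      rw [mul_one_div]
      gcongr
      linarith

theorem ae_isYuleType : ∀ᵐ V ∂lifetimeLaw, IsYuleType (heightsOfLifetimes V) := by
  have h1 : ∀ᵐ V ∂lifetimeLaw, ∀ R : ℕ, ∃ N, ∀ v : Vertex, v.length = N →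
      (R : ℝ) ≤ heightsOfLifetimes V v := by
    rw [ae_all_iff]
    intro R
    rw [ae_iff]
    have hlim : Tendsto (fun N : ℕ => ENNReal.ofReal (Real.exp (2 * R)) *
        ENNReal.ofReal (2 / 3) ^ N) atTop (𝓝 (ENNReal.ofReal (Real.exp (2 * R)) * 0)) := by
      refine ENNReal.Tendsto.const_mul (ENNReal.tendsto_pow_atTop_nhds_zero_of_lt_one ?_)
        (Or.inr ENNReal.ofReal_ne_top)
      rw [← ENNReal.ofReal_one]
      exact (ENNReal.ofReal_lt_ofReal_iff one_pos).2 (by norm_num)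
    rw [mul_zero] at hlim
    refine le_antisymm (ge_of_tendsto' hlim fun N => ?_) (zero_le)
    refine (measure_mono ?_).trans (measure_exists_height_lt_le R N)
    intro V hV
    simp only [Set.mem_ofPred_eq, not_exists, not_forall, not_le] at hV
    obtain ⟨v, hv, h⟩ := hV N
    exact ⟨v, hv, h⟩
  filter_upwards [h1, ae_lifetime_pos] with V hV hpos
  have hlt : ∀ v i, heightsOfLifetimes V v < heightsOfLifetimes V (v ++ [i]) := fun v i => by
    rw [heightsOfLifetimes_concat]
    linarith [hpos (v ++ [i])]
  have hmono : ∀ v s : Vertex, heightsOfLifetimes V v ≤ heightsOfLifetimes V (v ++ s) := by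
    intro v s
    induction s using List.reverseRecOn with
    | nil => simp
    | append_singleton s i ih => rw [← List.append_assoc]; exact ih.trans (hlt _ _).le
  refine isYuleType_iff.2 ⟨fun v => ?_, hlt, fun R => ?_⟩
  · refine le_trans ?_ (hmono [] v)
    rw [heightsOfLifetimes_nil]
    exact (hpos []).le
  · obtain ⟨N, hN⟩ := hV R
    refine ⟨N, fun v hv => (hN (v.take N) (by simp [hv])).trans ?_⟩
    have := hmono (v.take N) (v.drop N)
    rwa [List.take_append_drop] at this

theorem measurableEmbedding_coe : MeasurableEmbedding (Subtype.val : YuleTree → Vertex → ℝ) :=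
  MeasurableEmbedding.subtype_coe measurableSet_isYuleType

theorem map_coe_yuleLaw :
    yuleLaw.map Subtype.val = lifetimeLaw.map heightsOfLifetimes := by
  rw [yuleLaw, measurableEmbedding_coe.map_comap]
  refine Measure.restrict_eq_self_of_ae_mem ?_
  have h := (ae_map_iff measurable_heightsOfLifetimes.aemeasurable measurableSet_isYuleType).2
    ae_isYuleType
  filter_upwards [h] with z hz
  exact ⟨⟨z, hz⟩, rfl⟩

instance : IsProbabilityMeasure yuleLaw := by
  have h : IsProbabilityMeasure (yuleLaw.map Subtype.val) := by
    rw [map_coe_yuleLaw]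
    exact Measure.isProbabilityMeasure_map measurable_heightsOfLifetimes.aemeasurable
  exact (Measure.isProbabilityMeasure_map_iff measurable_subtype_coe.aemeasurable).1 h

theorem ae_root_pos : ∀ᵐ T ∂yuleLaw, 0 < T.1 [] := by
  have h : ∀ᵐ z ∂yuleLaw.map Subtype.val, 0 < z [] := by
    rw [map_coe_yuleLaw, ae_map_iff measurable_heightsOfLifetimes.aemeasurable
      (measurableSet_lt measurable_const (measurable_pi_apply _))]
    filter_upwards [ae_lifetime_pos] with V hV
    rw [heightsOfLifetimes_nil]
    exact hV []
  exact ae_of_ae_map measurable_subtype_coe.aemeasurable h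

/-! ### The branching property -/

/-- The height of the first branching point and the two subtrees. -/
def split (T : YuleTree) : ℝ × YuleTree × YuleTree := (T.1 [], T.sub 0, T.sub 1)

theorem measurable_split : Measurable split :=
  (measurable_height []).prodMk ((measurable_sub 0).prodMk (measurable_sub 1))

/-- The branching property of the Yule tree. -/
theorem map_split_yuleLaw :
    yuleLaw.map split = (expMeasure 1).prod (yuleLaw.prod yuleLaw) := by
  set E : ℝ × YuleTree × YuleTree → ℝ × (Vertex → ℝ) × (Vertex → ℝ) :=
    Prod.map id (Prod.map Subtype.val Subtype.val)
  have hE : MeasurableEmbedding E :=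
    MeasurableEmbedding.id.prodMap (measurableEmbedding_coe.prodMap measurableEmbedding_coe)
  refine hE.map_injective ?_
  set D : (Vertex → ℝ) → ℝ × (Vertex → ℝ) × (Vertex → ℝ) := fun z =>
    (z [], fun v => z (0 :: v) - z [], fun v => z (1 :: v) - z [])
  have hD : Measurable D := by
    have h : ∀ i : Fin 2, Measurable fun (z : Vertex → ℝ) v => z (i :: v) - z [] := fun i =>
      measurable_pi_lambda _ fun v => (measurable_pi_apply _).sub (measurable_pi_apply _)
    exact (measurable_pi_apply _).prodMk ((h 0).prodMk (h 1))
  have hH := measurable_heightsOfLifetimes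
  have h1 : (yuleLaw.map split).map E = (lifetimeLaw.map heightsOfLifetimes).map D := by
    rw [← map_coe_yuleLaw, Measure.map_map hE.measurable measurable_split,
      Measure.map_map hD measurable_subtype_coe]
    rfl
  have h2 : D ∘ heightsOfLifetimes ∘ assemble =
      Prod.map id (Prod.map heightsOfLifetimes heightsOfLifetimes) := by
    funext ⟨a, V₀, V₁⟩
    simp only [D, Function.comp_apply, heightsOfLifetimes_assemble, heightsOfLifetimes_nil]
    simp [assemble]
  have h3 : ((expMeasure 1).prod (yuleLaw.prod yuleLaw)).map E =
      (expMeasure 1).prod ((lifetimeLaw.map heightsOfLifetimes).prod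
        (lifetimeLaw.map heightsOfLifetimes)) := by
    rw [← map_coe_yuleLaw, Measure.map_prod_map _ _ measurable_subtype_coe measurable_subtype_coe,
      ← Measure.map_prod_map _ _ measurable_id
        (measurable_subtype_coe.prodMap measurable_subtype_coe), Measure.map_id]
  rw [h1, h3, Measure.map_prod_map _ _ hH hH]
  conv_lhs => rw [← map_assemble]
  rw [Measure.map_map hH measurable_assemble, Measure.map_map hD (hH.comp measurable_assemble), h2,
    ← Measure.map_prod_map _ _ measurable_id (hH.prodMap hH), Measure.map_id]

/-! ### The law of the exit ray as a kernel -/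

section Harmonic

variable {BM : ∀ T : YuleTree, Pt → Measure (TreePath T)} {T : YuleTree}

theorem rootPt_mem_points (T : YuleTree) : rootPt ∈ T.points :=
  ⟨T.2.nonneg _, Or.inl ⟨rfl, le_rfl⟩⟩

theorem isProbabilityMeasure_harmonicMeasure (hBM : IsBrownianFamily BM) (hT : 0 < T.1 []) :
    IsProbabilityMeasure (harmonicMeasure BM T) := by
  have hP := hBM T rootPt (rootPt_mem_points T)
  have := hP.prob
  exact Measure.isProbabilityMeasure_map (aemeasurable_exitRay hT hP)

theorem harmonicMeasure_cylinder (hBM : IsBrownianFamily BM) (hT : 0 < T.1 []) (v : Vertex) :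
    harmonicMeasure BM T (cylinder v) = ENNReal.ofReal (exitProb T v) := by
  have hP := hBM T rootPt (rootPt_mem_points T)
  have := hP.prob
  rw [harmonicMeasure, Measure.map_apply_of_aemeasurable (aemeasurable_exitRay hT hP)
    (measurableSet_cylinder v), ← (exitRay_law hT hP v).2, ofReal_measureReal]

open Classical in
/-- The harmonic measure, replaced by a point mass if the root edge is reduced to a point. -/
def harmonicKernel (BM : ∀ T : YuleTree, Pt → Measure (TreePath T)) (T : YuleTree) : Measure Ray :=
  if 0 < T.1 [] then harmonicMeasure BM T else Measure.dirac fun _ => 0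

theorem harmonicKernel_of_pos (hT : 0 < T.1 []) : harmonicKernel BM T = harmonicMeasure BM T :=
  if_pos hT

theorem isProbabilityMeasure_harmonicKernel (hBM : IsBrownianFamily BM) (T : YuleTree) :
    IsProbabilityMeasure (harmonicKernel BM T) := by
  unfold harmonicKernel
  split_ifs with hT
  · exact isProbabilityMeasure_harmonicMeasure hBM hT
  · infer_instance

/-- The masses of the cylinders, a generating π-system, are given by `exitProb`, which is measurable
in the tree. -/
theorem measurable_harmonicKernel (hBM : IsBrownianFamily BM) :
    Measurable (harmonicKernel BM) := by
  have := isProbabilityMeasure_harmonicKernel hBM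
  refine Measurable.measure_of_isPiSystem_of_isProbabilityMeasure generateFrom_cylinder
    isPiSystem_cylinder ?_
  rintro _ ⟨v, rfl⟩
  have h : (fun T => harmonicKernel BM T (cylinder v)) = fun T : YuleTree =>
      open Classical in if 0 < T.1 [] then ENNReal.ofReal (exitProb T v) else
        Measure.dirac (fun _ => 0 : Ray) (cylinder v) := by
    funext T
    unfold harmonicKernel
    split_ifs with hT
    · exact harmonicMeasure_cylinder hBM hT v
    · rfl
  rw [h]
  exact Measurable.ite (measurableSet_lt measurable_const (measurable_height []))
    (measurable_exitProb v).ennreal_ofReal measurable_const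

theorem ae_harmonicKernel : harmonicKernel BM =ᵐ[yuleLaw] harmonicMeasure BM :=
  ae_root_pos.mono fun _ hT => harmonicKernel_of_pos hT

theorem lintegral_yuleRayLaw (hBM : IsBrownianFamily BM) {F : YuleTree × Ray → ℝ≥0∞}
    (hF : Measurable F) : ∫⁻ p, F p ∂yuleRayLaw BM =
      ∫⁻ T, ∫⁻ u, F (T, u) ∂harmonicKernel BM T ∂yuleLaw := by
  have := isProbabilityMeasure_harmonicKernel hBM
  set k : Kernel YuleTree Ray := ⟨harmonicKernel BM, measurable_harmonicKernel hBM⟩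
  have : IsMarkovKernel k := ⟨isProbabilityMeasure_harmonicKernel hBM⟩
  have hk : Measurable fun T => (harmonicKernel BM T).map (Prod.mk T) := by
    refine Measure.measurable_of_measurable_coe _ fun s hs => ?_
    simp only [Measure.map_apply measurable_prodMk_left hs]
    exact Kernel.measurable_kernel_prodMk_left (κ := k) hs
  rw [yuleRayLaw, Measure.bind_congr_right (g := fun T => (harmonicKernel BM T).map (Prod.mk T)),
    Measure.lintegral_bind hk.aemeasurable hF.aemeasurable]
  · exact lintegral_congr fun T => lintegral_map hF measurable_prodMk_left
  · filter_upwards [ae_harmonicKernel (BM := BM)] with T hT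
    rw [hT]

theorem measurable_lintegral_harmonicKernel (hBM : IsBrownianFamily BM)
    {F : YuleTree × Ray → ℝ≥0∞} (hF : Measurable F) :
    Measurable fun T => ∫⁻ u, F (T, u) ∂harmonicKernel BM T := by
  set k : Kernel YuleTree Ray := ⟨harmonicKernel BM, measurable_harmonicKernel hBM⟩
  have : IsMarkovKernel k := ⟨isProbabilityMeasure_harmonicKernel hBM⟩
  exact hF.lintegral_kernel_prod_right' (κ := k)

/-! ### One-step decomposition of the harmonic measure -/

/-- The ray that starts with a given letter and goes on along a given ray. -/
def Ray.cons (i : Fin 2) (u : Ray) : Ray := fun n => Nat.casesOn n i u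

theorem Ray.measurable_cons (i : Fin 2) : Measurable (Ray.cons i) := by
  refine measurable_pi_lambda _ fun n => ?_
  cases n with
  | zero => exact measurable_const
  | succ n => exact measurable_pi_apply n

theorem preimage_cons_cylinder (i j : Fin 2) (v : Vertex) :
    Ray.cons i ⁻¹' cylinder (j :: v) = if i = j then cylinder v else ∅ := by
  have h : ∀ u : Ray, (Ray.cons i u).trunc (v.length + 1) = i :: u.trunc v.length := fun u => by
    simp [Ray.trunc, List.ofFn_succ, Ray.cons]
  ext u
  simp only [cylinder, List.length_cons, Set.mem_preimage]
  change (Ray.cons i u).trunc (v.length + 1) = j :: v ↔ _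
  rw [h, List.cons.injEq]
  split_ifs with hij
  · simp only [hij, true_and]
    rfl
  · simp [hij]

/-- The probability that the exit ray starts in a given direction. -/
def stepProb (T : YuleTree) (i : Fin 2) : ℝ≥0∞ := ENNReal.ofReal (cond (T.sub i) / condSum T)

theorem sum_stepProb (T : YuleTree) : ∑ i, stepProb T i = 1 := by
  have h0 := one_le_cond (sub_pos_root T 0)
  have h1 := one_le_cond (sub_pos_root T 1)
  have h2 := two_le_condSum T
  rw [Fin.sum_univ_two, stepProb, stepProb, ← ENNReal.ofReal_add (by positivity) (by positivity),
    ← add_div, ← condSum, div_self (by positivity), ENNReal.ofReal_one]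

/-- Both sides agree on cylinders, where the identity is the recursion that defines `exitProb`. -/
theorem harmonicMeasure_eq (hBM : IsBrownianFamily BM) (hT : 0 < T.1 []) :
    harmonicMeasure BM T =
      ∑ i, stepProb T i • (harmonicMeasure BM (T.sub i)).map (Ray.cons i) := by
  have := isProbabilityMeasure_harmonicMeasure hBM hT
  have hs := fun i => isProbabilityMeasure_harmonicMeasure hBM (sub_pos_root T i)
  have h : cylinder [] = Set.univ := Set.eq_univ_of_forall fun u => rfl
  have key : ∀ v, harmonicMeasure BM T (cylinder v) =
      (∑ i, stepProb T i • (harmonicMeasure BM (T.sub i)).map (Ray.cons i)) (cylinder v) := by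
    intro v
    rw [Measure.finsetSum_apply]
    simp only [Measure.smul_apply, smul_eq_mul,
      Measure.map_apply (Ray.measurable_cons _) (measurableSet_cylinder v)]
    rcases v with _ | ⟨j, v⟩
    · simp only [h, Set.preimage_univ, measure_univ, mul_one, sum_stepProb]
    · rw [harmonicMeasure_cylinder hBM hT, Finset.sum_eq_single j]
      · rw [preimage_cons_cylinder, if_pos rfl, harmonicMeasure_cylinder hBM (sub_pos_root T j),
          stepProb, ← ENNReal.ofReal_mul]
        · rfl
        · have h0 := one_le_cond (sub_pos_root T j)
          have h2 := two_le_condSum T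
          positivity
      · intro i _ hij
        rw [preimage_cons_cylinder, if_neg hij, measure_empty, mul_zero]
      · simp
  refine ext_of_generate_finite _ generateFrom_cylinder isPiSystem_cylinder ?_ ?_
  · rintro _ ⟨v, rfl⟩
    exact key v
  · rw [← h]
    exact key []

theorem lintegral_harmonicMeasure (hBM : IsBrownianFamily BM) (hT : 0 < T.1 []) {F : Ray → ℝ≥0∞}
    (hF : Measurable F) : ∫⁻ u, F u ∂harmonicMeasure BM T =
      ∑ i, stepProb T i * ∫⁻ u, F (Ray.cons i u) ∂harmonicMeasure BM (T.sub i) := by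
  rw [harmonicMeasure_eq hBM hT, lintegral_finsetSum_measure]
  refine Finset.sum_congr rfl fun i _ => ?_
  rw [lintegral_smul_measure, smul_eq_mul, lintegral_map hF (Ray.measurable_cons i)]

end Harmonic

/-! ### The law of the conductance -/

/-- The law of `cond` for the Yule tree. -/
def condLaw : Measure ℝ := yuleLaw.map cond

instance : IsProbabilityMeasure condLaw := Measure.isProbabilityMeasure_map measurable_cond.aemeasurable

theorem ae_one_le_condLaw : ∀ᵐ s ∂condLaw, 1 ≤ s :=
  (ae_map_iff measurable_cond.aemeasurable measurableSet_Ici).2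
    (ae_root_pos.mono fun _ hT => one_le_cond hT)

theorem lintegral_condLaw {f : ℝ → ℝ≥0∞} (hf : Measurable f) :
    ∫⁻ s, f s ∂condLaw = ∫⁻ T, f (cond T) ∂yuleLaw := lintegral_map hf measurable_cond

theorem lintegral_split {f : ℝ × YuleTree × YuleTree → ℝ≥0∞} (hf : Measurable f) :
    ∫⁻ T, f (split T) ∂yuleLaw =
      ∫⁻ a, ∫⁻ T₀, ∫⁻ T₁, f (a, T₀, T₁) ∂yuleLaw ∂yuleLaw ∂expMeasure 1 := by
  rw [← lintegral_map hf measurable_split, map_split_yuleLaw, lintegral_prod _ hf.aemeasurable]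
  exact lintegral_congr fun a =>
    lintegral_prod _ (hf.comp measurable_prodMk_left).aemeasurable

theorem measurable_serial : Measurable fun p : ℝ × ℝ => serial p.1 p.2 := by
  unfold serial
  fun_prop

/-- The law of the conductance solves a distributional fixed point equation. -/
theorem lintegral_condLaw_eq {f : ℝ → ℝ≥0∞} (hf : Measurable f) :
    ∫⁻ s, f s ∂condLaw =
      ∫⁻ a, ∫⁻ s, ∫⁻ t, f (serial a (s + t)) ∂condLaw ∂condLaw ∂expMeasure 1 := by
  have hg : Measurable fun q : ℝ × ℝ × ℝ => f (serial q.1 (q.2.1 + q.2.2)) :=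
    hf.comp (measurable_serial.comp
      (measurable_fst.prodMk ((measurable_fst.comp measurable_snd).add
        (measurable_snd.comp measurable_snd))))
  have hc : Measurable fun p : ℝ × YuleTree × YuleTree => (p.1, cond p.2.1, cond p.2.2) :=
    measurable_fst.prodMk ((measurable_cond.comp (measurable_fst.comp measurable_snd)).prodMk
      (measurable_cond.comp (measurable_snd.comp measurable_snd)))
  rw [lintegral_condLaw hf, lintegral_congr_ae (g := fun T => f (serial (split T).1
    (cond (split T).2.1 + cond (split T).2.2))) (ae_root_pos.mono fun T hT => by
      rw [cond_eq hT]; rfl), lintegral_split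
      (f := fun p => f (serial p.1 (cond p.2.1 + cond p.2.2))) (hg.comp hc)]
  refine lintegral_congr fun a => ?_
  rw [lintegral_condLaw (Measurable.lintegral_prod_right' (f := fun q : ℝ × ℝ =>
    f (serial a (q.1 + q.2))) (hg.comp (measurable_prodMk_left (x := a))))]
  refine lintegral_congr fun T₀ => ?_
  rw [lintegral_condLaw (f := fun y => f (serial a (cond T₀ + y))) (hg.comp ((measurable_prodMk_left (x := a)).comp
    (measurable_prodMk_left (x := cond T₀))))]

/-! ### The density and its functional equation -/

/-- The density of the invariant measure, in terms of `condLaw`. -/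
def kap (r : ℝ) : ℝ≥0∞ :=
  ∫⁻ s, ∫⁻ t, ENNReal.ofReal (r * s / (r + s + t - 1)) ∂condLaw ∂condLaw

theorem measurable_kap : Measurable kap := by
  refine Measurable.lintegral_prod_right' (f := fun q : ℝ × ℝ =>
    ∫⁻ t, ENNReal.ofReal (q.1 * q.2 / (q.1 + q.2 + t - 1)) ∂condLaw) ?_
  refine Measurable.lintegral_prod_right' (f := fun q : (ℝ × ℝ) × ℝ =>
    ENNReal.ofReal (q.1.1 * q.1.2 / (q.1.1 + q.1.2 + q.2 - 1))) ?_
  fun_prop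

/-- The variables `s` and `t` are exchangeable; adding the two versions replaces the numerator `r *
s` by `r * (s + t)`. -/
theorem two_mul_kap {r : ℝ} (hr : 1 ≤ r) : 2 * kap r =
    ∫⁻ s, ∫⁻ t, ENNReal.ofReal (r * (s + t) / (r + (s + t) - 1)) ∂condLaw ∂condLaw := by
  have hm : Measurable fun q : ℝ × ℝ => ENNReal.ofReal (r * q.1 / (r + q.1 + q.2 - 1)) := by
    fun_prop
  have h : kap r = ∫⁻ s, ∫⁻ t, ENNReal.ofReal (r * t / (r + t + s - 1)) ∂condLaw ∂condLaw :=
    lintegral_lintegral_swap hm.aemeasurable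
  rw [two_mul]
  nth_rw 2 [h]
  rw [kap, ← lintegral_add_left (Measurable.lintegral_prod_right' hm)]
  refine lintegral_congr_ae ?_
  filter_upwards [ae_one_le_condLaw] with s hs
  rw [← lintegral_add_left (by fun_prop)]
  refine lintegral_congr_ae ?_
  filter_upwards [ae_one_le_condLaw] with t ht
  have h1 : 0 < r + s + t - 1 := by linarith
  have h2 : 0 < r + t + s - 1 := by linarith
  rw [← ENNReal.ofReal_add (by positivity) (by positivity)]
  congr 1
  rw [show r + t + s - 1 = r + s + t - 1 by ring, ← add_div]
  congr 1 <;> ring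

/-- With `e = exp (-a)`, both denominators reduce to `e (r + s + t - 1) + (1 - e) s (r + t)`, which
is symmetric in `s` and `r + t` (this is `hM`). The edge can thus be put in series with either of
the two. -/
theorem serial_ratio {a r s t : ℝ} (ha : 0 ≤ a) (hr : 1 ≤ r) (hs : 1 ≤ s) (ht : 1 ≤ t) :
    serial a (r + t) * s / (serial a (r + t) + s - 1) * (r / (r + t)) =
      r * serial a s / (r + serial a s + t - 1) := by
  have h1 := serial_denom_pos ha (show 0 ≤ r + t by linarith)
  have h2 := serial_denom_pos ha (show 0 ≤ s by linarith)
  set e := Real.exp (-a)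
  set D := e + (r + t) * (1 - e)
  set D' := e + s * (1 - e)
  have hM : r + t + (s - 1) * D = s + (r + t - 1) * D' := by simp only [D, D']; ring
  have h3 : serial a (r + t) = (r + t) / D := rfl
  have h4 : serial a s = s / D' := rfl
  have h5 : 0 < r + t + (s - 1) * D := by nlinarith
  have h6 : serial a (r + t) + s - 1 = (r + t + (s - 1) * D) / D := by
    rw [h3]; field_simp; ring
  have h7 : r + serial a s + t - 1 = (r + t + (s - 1) * D) / D' := by
    rw [h4, hM]; field_simp; ring
  have h8 : 0 < r + t := by linarith
  rw [h6, h7, h3, h4]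
  field_simp

/-- One of the two conductances is expanded by its fixed point equation into `serial a (s + s')`;
`serial_ratio` moves the edge to `r + t`, and the integral over `s` and `s'` is the symmetrised
density of `two_mul_kap`. -/
theorem kap_eq {r : ℝ} (hr : 1 ≤ r) : kap r =
    ∫⁻ a, ∫⁻ t, 2 * kap (serial a (r + t)) * ENNReal.ofReal (r / (r + t)) ∂condLaw
      ∂expMeasure 1 := by
  set G : ℝ → ℝ → ℝ≥0∞ := fun s t => ENNReal.ofReal (r * s / (r + s + t - 1))
  have hG : Measurable fun q : ℝ × ℝ => G q.1 q.2 := by fun_prop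
  have hG4 : Measurable fun q : ((ℝ × ℝ) × ℝ) × ℝ => G (serial q.1.1.2 (q.1.2 + q.2)) q.1.1.1 :=
    hG.comp ((measurable_serial.comp (by fun_prop :
      Measurable fun q : ((ℝ × ℝ) × ℝ) × ℝ => (q.1.1.2, q.1.2 + q.2))).prodMk (by fun_prop))
  calc kap r = ∫⁻ t, ∫⁻ s, G s t ∂condLaw ∂condLaw := lintegral_lintegral_swap hG.aemeasurable
    _ = ∫⁻ t, ∫⁻ a, ∫⁻ s, ∫⁻ s', G (serial a (s + s')) t ∂condLaw ∂condLaw ∂expMeasure 1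
          ∂condLaw :=
      lintegral_congr fun t => lintegral_condLaw_eq (f := fun s => G s t)
        (hG.comp measurable_prodMk_right)
    _ = ∫⁻ a, ∫⁻ t, ∫⁻ s, ∫⁻ s', G (serial a (s + s')) t ∂condLaw ∂condLaw ∂condLaw
          ∂expMeasure 1 :=
      lintegral_lintegral_swap
        (hG4.lintegral_prod_right'.lintegral_prod_right').aemeasurable
    _ = _ := by
      refine lintegral_congr_ae ?_
      filter_upwards [ae_expMeasure_pos] with a ha
      refine lintegral_congr_ae ?_
      filter_upwards [ae_one_le_condLaw] with t ht
      rw [two_mul_kap (one_le_serial ha.le (by linarith)), ← lintegral_mul_const']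
      · refine lintegral_congr_ae ?_
        filter_upwards [ae_one_le_condLaw] with s hs
        rw [← lintegral_mul_const' _ _ ENNReal.ofReal_ne_top]
        refine lintegral_congr_ae ?_
        filter_upwards [ae_one_le_condLaw] with s' hs'
        rw [← ENNReal.ofReal_mul' (by positivity),
          serial_ratio ha.le hr (by linarith : 1 ≤ s + s') ht]
      · exact ENNReal.ofReal_ne_top

/-! ### Integrability -/

/-- Against the exponential density the integrand has the bounded primitive `2 √(1 - exp (-x))`. -/
theorem lintegral_inv_sqrt_lt_top :
    ∫⁻ a, ENNReal.ofReal ((√(1 - Real.exp (-a)))⁻¹) ∂expMeasure 1 < ⊤ := by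
  have hm : Measurable (exponentialPDF 1) := (measurable_exponentialPDFReal 1).ennreal_ofReal
  have hpos : ∀ x : ℝ, 0 < x → 0 < 1 - Real.exp (-x) := fun x hx =>
    sub_pos.2 (Real.exp_lt_one_iff.2 (by linarith))
  have hder : ∀ x ∈ Set.Ioi (0 : ℝ), HasDerivAt (fun x => 2 * √(1 - Real.exp (-x)))
      (Real.exp (-x) * (√(1 - Real.exp (-x)))⁻¹) x := by
    intro x hx
    have h := ((((hasDerivAt_neg x).exp).const_sub 1).sqrt (hpos x hx).ne').const_mul 2
    refine h.congr_deriv ?_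
    have := Real.sqrt_pos.2 (hpos x hx)
    field_simp
  have hint : IntegrableOn (fun x => Real.exp (-x) * (√(1 - Real.exp (-x)))⁻¹) (Set.Ioi 0) := by
    refine integrableOn_Ioi_deriv_of_nonneg (l := 2 * √(1 - 0))
      (Continuous.continuousWithinAt (by fun_prop)) hder (fun x _ => by positivity) ?_
    exact ((Real.tendsto_exp_neg_atTop_nhds_zero.const_sub 1).sqrt).const_mul 2
  change ∫⁻ a, _ ∂volume.withDensity (exponentialPDF 1) < ⊤
  rw [lintegral_withDensity_eq_lintegral_mul _ hm (by fun_prop)]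
  refine lt_of_le_of_lt ?_ hint.lintegral_lt_top
  rw [← lintegral_indicator measurableSet_Ioi]
  refine lintegral_mono_ae ?_
  have h0 : ∀ᵐ x : ℝ, x ≠ 0 := by simp [ae_iff]
  filter_upwards [h0] with x hx
  rw [Pi.mul_apply, exponentialPDF_eq]
  split_ifs with h
  · rw [Set.indicator_of_mem (Set.mem_Ioi.2 (lt_of_le_of_ne h hx.symm)),
      ← ENNReal.ofReal_mul (by positivity)]
    simp
  · simp

theorem serial_le {a K : ℝ} (ha : 0 < a) (hK : 0 ≤ K) :
    serial a K ≤ (1 - Real.exp (-a))⁻¹ := by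
  have h : 0 < 1 - Real.exp (-a) := sub_pos.2 (Real.exp_lt_one_iff.2 (by linarith))
  rw [← one_div, le_div_iff₀ h]
  exact (serial_mul_lt_one ha.le hK).le

/-- The bound `1 / (1 - exp (-a))` on the conductance is not integrable for the exponential law, but
its square root is. -/
theorem lintegral_sqrt_condLaw_lt_top : ∫⁻ s, ENNReal.ofReal (√s) ∂condLaw < ⊤ := by
  rw [lintegral_condLaw_eq (by fun_prop)]
  refine lt_of_le_of_lt (lintegral_mono_ae ?_) lintegral_inv_sqrt_lt_top
  filter_upwards [ae_expMeasure_pos] with a ha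
  calc _ ≤ ∫⁻ s, ∫⁻ t, ENNReal.ofReal ((√(1 - Real.exp (-a)))⁻¹) ∂condLaw ∂condLaw := by
        refine lintegral_mono_ae ?_
        filter_upwards [ae_one_le_condLaw] with s hs
        refine lintegral_mono_ae ?_
        filter_upwards [ae_one_le_condLaw] with t ht
        refine ENNReal.ofReal_le_ofReal ?_
        rw [← Real.sqrt_inv]
        exact Real.sqrt_le_sqrt (serial_le ha (by linarith))
    _ = _ := by simp

/-- As `t ≥ 1`, the denominator is at least `r + s ≥ √r * √s`, so the integrand is at most `√r *
√s`, a product of integrable functions of independent variables. -/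
theorem lintegral_kap_lt_top : ∫⁻ r, kap r ∂condLaw < ⊤ := by
  set A := ∫⁻ s, ENNReal.ofReal (√s) ∂condLaw
  have hA : A < ⊤ := lintegral_sqrt_condLaw_lt_top
  have h : ∀ r, 1 ≤ r → kap r ≤ ENNReal.ofReal (√r) * A := by
    intro r hr
    rw [← lintegral_const_mul _ (by fun_prop)]
    refine lintegral_mono_ae ?_
    filter_upwards [ae_one_le_condLaw] with s hs
    calc _ ≤ ∫⁻ t, ENNReal.ofReal (√r) * ENNReal.ofReal (√s) ∂condLaw := by
          refine lintegral_mono_ae ?_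
          filter_upwards [ae_one_le_condLaw] with t ht
          rw [← ENNReal.ofReal_mul (Real.sqrt_nonneg _)]
          refine ENNReal.ofReal_le_ofReal ?_
          rw [div_le_iff₀ (by linarith)]
          have h1 := Real.mul_self_sqrt (show 0 ≤ r by linarith)
          have h2 := Real.mul_self_sqrt (show 0 ≤ s by linarith)
          have h3 : √r * √s ≤ r + s + t - 1 := by nlinarith [sq_nonneg (√r - √s)]
          calc r * s = (√r * √s) * (√r * √s) := by rw [← h1, ← h2]; simp; ring
            _ ≤ _ := by gcongr
      _ = _ := by simp
  calc ∫⁻ r, kap r ∂condLaw ≤ ∫⁻ r, ENNReal.ofReal (√r) * A ∂condLaw :=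
        lintegral_mono_ae (ae_one_le_condLaw.mono h)
    _ = A * A := lintegral_mul_const _ (by fun_prop)
    _ < ⊤ := ENNReal.mul_lt_top hA hA

/-! ### Invariance -/

section Invariance

variable {BM : ∀ T : YuleTree, Pt → Measure (TreePath T)}

theorem conductance_ae_eq (hBM : IsBrownianFamily BM) : conductance BM =ᵐ[yuleLaw] cond :=
  ae_root_pos.mono fun _ hT => conductance_eq hBM hT

theorem kappa_eq_kap (hBM : IsBrownianFamily BM) : kappa BM = kap := by
  have h : conductanceLaw BM = condLaw := Measure.map_congr (conductance_ae_eq hBM)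
  funext r
  rw [kappa, h, kap]

theorem measurable_shift : Measurable shift := by
  have h0 : Measurable fun p : YuleTree × Ray => p.2 0 := (measurable_pi_apply 0).comp measurable_snd
  refine Measurable.prodMk ?_ (measurable_pi_lambda _ fun n =>
    (measurable_pi_apply (n + 1)).comp measurable_snd)
  exact measurable_from_prod_countable_left (f := fun q : YuleTree × Fin 2 => q.1.sub q.2)
    measurable_sub |>.comp (measurable_fst.prodMk h0)

theorem shift_cons (T : YuleTree) (i : Fin 2) (u : Ray) :
    shift (T, Ray.cons i u) = (T.sub i, u) := rfl

theorem map_fst_yuleRayLaw (hBM : IsBrownianFamily BM) : (yuleRayLaw BM).map Prod.fst = yuleLaw := by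
  have := isProbabilityMeasure_harmonicKernel hBM
  refine Measure.ext_of_lintegral _ fun f hf => ?_
  rw [lintegral_map hf measurable_fst, lintegral_yuleRayLaw hBM (F := fun p => f p.1)
    (hf.comp measurable_fst)]
  simp

theorem invariantMeasure_eq (hBM : IsBrownianFamily BM) :
    invariantMeasure BM = (yuleRayLaw BM).withDensity fun p => kap (cond p.1) := by
  rw [invariantMeasure, kappa_eq_kap hBM]
  refine withDensity_congr_ae ?_
  have h : ∀ᵐ T ∂(yuleRayLaw BM).map Prod.fst, conductance BM T = cond T := by
    rw [map_fst_yuleRayLaw hBM]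
    exact conductance_ae_eq hBM
  filter_upwards [ae_of_ae_map measurable_fst.aemeasurable h] with p hp
  rw [hp]

theorem lintegral_invariantMeasure (hBM : IsBrownianFamily BM) {F : YuleTree × Ray → ℝ≥0∞}
    (hF : Measurable F) : ∫⁻ p, F p ∂invariantMeasure BM =
      ∫⁻ T, kap (cond T) * ∫⁻ u, F (T, u) ∂harmonicKernel BM T ∂yuleLaw := by
  have hk : Measurable fun p : YuleTree × Ray => kap (cond p.1) :=
    measurable_kap.comp (measurable_cond.comp measurable_fst)
  rw [invariantMeasure_eq hBM, lintegral_withDensity_eq_lintegral_mul _ hk hF,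
    lintegral_yuleRayLaw hBM (hk.mul hF)]
  exact lintegral_congr fun T => lintegral_const_mul (f := fun u => F (T, u)) (kap (cond T))
    (hF.comp measurable_prodMk_left)

theorem isFiniteMeasure_invariantMeasure (hBM : IsBrownianFamily BM) :
    IsFiniteMeasure (invariantMeasure BM) := by
  have := isProbabilityMeasure_harmonicKernel hBM
  constructor
  have h := lintegral_invariantMeasure hBM (F := fun _ => 1) measurable_const
  simp only [lintegral_one, measure_univ, mul_one] at h
  rw [h, ← lintegral_condLaw measurable_kap]
  exact lintegral_kap_lt_top

/-- The effect of grafting a tree onto an independent Yule tree, biased by `kap`. -/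
theorem lintegral_kap_mul_stepProb {G : YuleTree → ℝ≥0∞} (hG : Measurable G) :
    ∫⁻ T, kap (cond T) * ∑ i, stepProb T i * G (T.sub i) ∂yuleLaw =
      ∫⁻ T, kap (cond T) * G T ∂yuleLaw := by
  -- `W a s t` is the density of the whole tree times the probability of entering the subtree of
  -- conductance `s`, when the root edge has length `a` and the other subtree has conductance `t`.
  obtain ⟨W, hWeq⟩ : ∃ W : ℝ → ℝ → ℝ → ℝ≥0∞, ∀ a s t,
      W a s t = kap (serial a (s + t)) * ENNReal.ofReal (s / (s + t)) := ⟨_, fun _ _ _ => rfl⟩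
  have hW : Measurable fun q : ℝ × ℝ × ℝ => W q.1 q.2.1 q.2.2 := by
    simp only [hWeq]
    refine Measurable.mul (measurable_kap.comp (measurable_serial.comp (by fun_prop :
      Measurable fun q : ℝ × ℝ × ℝ => (q.1, q.2.1 + q.2.2)))) (by fun_prop)
  have hc0 : Measurable fun p : ℝ × YuleTree × YuleTree => cond p.2.1 :=
    measurable_cond.comp (measurable_fst.comp measurable_snd)
  have hc1 : Measurable fun p : ℝ × YuleTree × YuleTree => cond p.2.2 :=
    measurable_cond.comp (measurable_snd.comp measurable_snd)
  have hf0 : Measurable fun p : ℝ × YuleTree × YuleTree =>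
      W p.1 (cond p.2.1) (cond p.2.2) * G p.2.1 :=
    (hW.comp (measurable_fst.prodMk (hc0.prodMk hc1))).mul
      (hG.comp (measurable_fst.comp measurable_snd))
  have hf1 : Measurable fun p : ℝ × YuleTree × YuleTree =>
      W p.1 (cond p.2.2) (cond p.2.1) * G p.2.2 :=
    (hW.comp (measurable_fst.prodMk (hc1.prodMk hc0))).mul
      (hG.comp (measurable_snd.comp measurable_snd))
  have h1 : ∀ᵐ T ∂yuleLaw, kap (cond T) * ∑ i, stepProb T i * G (T.sub i) =
      W (split T).1 (cond (split T).2.1) (cond (split T).2.2) * G (split T).2.1 +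
      W (split T).1 (cond (split T).2.2) (cond (split T).2.1) * G (split T).2.2 := by
    filter_upwards [ae_root_pos] with T hT
    simp only [hWeq, split]
    rw [add_comm (cond (T.sub 1)), Fin.sum_univ_two, stepProb, stepProb]
    change _ = kap (serial (T.1 []) (condSum T)) * ENNReal.ofReal (_ / condSum T) * _ +
      kap (serial (T.1 []) (condSum T)) * ENNReal.ofReal (_ / condSum T) * _
    rw [← cond_eq hT, mul_add, mul_assoc, mul_assoc]
  -- The subtrees are exchangeable, so both directions contribute equally: this is the factor `2` in
  -- `kap_eq`.
  have h2 : ∫⁻ a, ∫⁻ T₀, ∫⁻ T₁, W a (cond T₁) (cond T₀) * G T₁ ∂yuleLaw ∂yuleLaw ∂expMeasure 1 =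
      ∫⁻ a, ∫⁻ T₀, ∫⁻ T₁, W a (cond T₀) (cond T₁) * G T₀ ∂yuleLaw ∂yuleLaw ∂expMeasure 1 :=
    lintegral_congr fun a => lintegral_lintegral_swap
      (hf1.comp (measurable_prodMk_left (x := a))).aemeasurable
  rw [lintegral_congr_ae h1, lintegral_add_left (f := fun T =>
      W (split T).1 (cond (split T).2.1) (cond (split T).2.2) * G (split T).2.1)
      (hf0.comp measurable_split),
    lintegral_split hf0, lintegral_split hf1, h2, ← two_mul,
    lintegral_lintegral_swap (f := fun a T₀ =>
      ∫⁻ T₁, W a (cond T₀) (cond T₁) * G T₀ ∂yuleLaw), ← lintegral_const_mul']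
  · refine lintegral_congr_ae ?_
    filter_upwards [ae_root_pos] with T₀ hT
    have hq : Measurable fun q : ℝ × ℝ => (q.1, cond T₀, q.2) :=
      measurable_fst.prodMk (measurable_const.prodMk measurable_snd)
    have hm : Measurable fun q : ℝ × ℝ => W q.1 (cond T₀) q.2 := hW.comp hq
    have hm' : ∀ a, Measurable (W a (cond T₀)) := fun a =>
      hm.comp (measurable_prodMk_left (x := a))
    have h3 : ∀ a, ∫⁻ T₁, W a (cond T₀) (cond T₁) * G T₀ ∂yuleLaw =
        (∫⁻ t, W a (cond T₀) t ∂condLaw) * G T₀ := fun a => by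
      rw [lintegral_condLaw (hm' a)]
      exact lintegral_mul_const (f := fun T₁ => W a (cond T₀) (cond T₁)) _
        ((hm' a).comp measurable_cond)
    simp only [h3]
    rw [lintegral_mul_const _ hm.lintegral_prod_right', ← mul_assoc, kap_eq (one_le_cond hT),
      ← lintegral_const_mul _ hm.lintegral_prod_right']
    congr 1
    refine lintegral_congr fun a => ?_
    rw [← lintegral_const_mul _ (hm' a)]
    simp only [hWeq, mul_assoc]
  · exact ENNReal.ofNat_ne_top
  · exact (Measurable.lintegral_prod_right' (f := fun q : (ℝ × YuleTree) × YuleTree =>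
      W q.1.1 (cond q.1.2) (cond q.2) * G q.1.2)
      (hf0.comp MeasurableEquiv.prodAssoc.measurable)).aemeasurable

/-- Integrating `F ∘ shift` over the exit ray gives the `stepProb`-average of the integrals of `F`
over the exit rays of the subtrees; `lintegral_kap_mul_stepProb` turns this average back into one
integral over a Yule tree with the same density. -/
theorem measurePreserving_shift (hBM : IsBrownianFamily BM) :
    MeasurePreserving shift (invariantMeasure BM) (invariantMeasure BM) := by
  refine ⟨measurable_shift, Measure.ext_of_lintegral _ fun F hF => ?_⟩
  rw [lintegral_map hF measurable_shift,
    lintegral_invariantMeasure hBM (F := fun p => F (shift p)) (hF.comp measurable_shift), lintegral_invariantMeasure hBM hF,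
    ← lintegral_kap_mul_stepProb (measurable_lintegral_harmonicKernel hBM hF)]
  refine lintegral_congr_ae ?_
  filter_upwards [ae_root_pos] with T hT
  have hm : Measurable fun u : Ray => F (shift (T, u)) :=
    (hF.comp measurable_shift).comp measurable_prodMk_left
  rw [harmonicKernel_of_pos hT]
  change kap (cond T) * ∫⁻ u, F (shift (T, u)) ∂harmonicMeasure BM T = _
  rw [lintegral_harmonicMeasure hBM hT hm]
  simp only [shift_cons, harmonicKernel_of_pos (sub_pos_root T _)]

end Invariance

end YuleConductance

end

open YuleConductance in
theorem mainTheorem9 (BM : ∀ T : YuleTree, Pt → Measure (TreePath T))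
    (hBM : IsBrownianFamily BM) :
    -- the objects are well defined
    IsProbabilityMeasure yuleLaw ∧
    (∀ᵐ T ∂yuleLaw,
      AEMeasurable (exitRay (T := T)) (BM T rootPt) ∧
      (∀ᵐ w ∂(BM T rootPt), ∃! u, IsExitRay w u) ∧
      Tendsto (escapeRate BM T) (𝓝[>] (0 : ℝ)) (𝓝 (conductance BM T)) ∧
      1 ≤ conductance BM T) ∧
    AEMeasurable (conductance BM) yuleLaw ∧
    AEMeasurable (harmonicMeasure BM) yuleLaw ∧
    -- the measure is finite and invariant under the shift
    IsFiniteMeasure (invariantMeasure BM) ∧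
    MeasurePreserving shift (invariantMeasure BM) (invariantMeasure BM) := by
  refine ⟨inferInstance, ?_, ⟨cond, measurable_cond, conductance_ae_eq hBM⟩,
    ⟨harmonicKernel BM, measurable_harmonicKernel hBM, ae_harmonicKernel.symm⟩,
    isFiniteMeasure_invariantMeasure hBM, measurePreserving_shift hBM⟩
  filter_upwards [ae_root_pos] with T hT
  have hP := hBM T rootPt (rootPt_mem_points T)
  have hc := conductance_eq hBM hT
  exact ⟨aemeasurable_exitRay hT hP, (ae_transient hT hP).mono fun w hw => hw.existsUnique_exitRay,
    hc ▸ tendsto_escapeRate hBM hT, hc ▸ one_le_cond hT⟩
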